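/- Let $\mathcal M=(M,\mathcal O_{\mathcal M})$ be a real smooth (or real analytic) supermanifold of dimension $n|m$, i.e. $M$ is an $n$-dimensional smooth (analytic) manifold and $\mathcal O_{\mathcal M}$ is a sheaf of real commutative superalgebras on $M$ locally isomorphic to $\mathcal O_M\otimes\Lambda_{\xi^1,\dots,\xi^m}$, where $\mathcal O_M$ is the sheaf of smooth (analytic) functions; write $f\mapsto\tilde f$ for the canonical projection $\mathcal O_{\mathcal M}\to\mathcal O_M$. Let $\mathcal T_{\mathcal M}$ be the sheaf of superderivations of $\mathcal O_{\mathcal M}$, let $\mathcal E$ be a locally free sheaf of $\mathcal O_{\mathcal M}$-supermodules of rank $p|q$, and let $\nabla$ be a connection on $\mathcal E$, i.e. an even morphism $\mathcal T_{\mathcal M}\otimes_{\mathbb R}\mathcal E\to\mathcal E$ with $\nabla_{fY}X=f\nabla_YX$ and $\nabla_Y(fX)=(Yf)X+(-1)^{|Y||f|}f\nabla_YX$. Let $0\le p_1\le p$ and $0\le q_1\le q$. For $x\in M$ let $\mathcal E_x$ be the fibre of $\mathcal E$ at $x$ (the germs of sections at $x$ modulo the products of sections with superfunctions $f$ such that $\tilde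 f(x)=0$), a vector superspace of dimension $p|q$. The connection $\nabla$ induces a connection $\tilde\nabla$ on the vector bundle $E=\bigcup_{x\in M}\mathcal E_x$ over $M$. For a piecewise smooth curve $\gamma$ in $M$ let $\tau_\gamma$ be the parallel displacement of $\tilde\nabla$ along $\gamma$, and let $\mathrm{Hol}(\tilde\nabla)_x$ be the group of the $\tau_\gamma$ for all piecewise smooth loops $\gamma$ at $x$. Let $R(Y,Z)=[\nabla_Y,\nabla_Z]-\nabla_{[Y,Z]}$ be the curvature of $\nabla$ (super brackets), and, for a connection $\bar\nabla$ on $\mathcal T_{\mathcal M}|_U$, let $\bar\nabla^r_{Y_r,\dots,Y_1}R(Y,Z)$ be its $r$-th covariant derivative with respect to $\nabla$ and $\bar\nabla$. The holonomy algebra $\mathfrak{hol}(\nabla)_x$ is the supersubalgebra of the Lie superalgebra $\mathfrak{gl}(\mathcal E_x)$ generated by all operators $$\tau_\gamma^{-1}\circ\bar\nabla^r_{Y_r,\dots,Y_1}R_y(Y,Z)\circ\tau_\gamma,$$ where $\gamma$ is a piecewise smooth curve from $x$ to a point $y\in M$, $\bar\nabla$ is a connection on $\mathcal T_{\mathcal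 M}|_U$ for an open neighbourhood $U$ of $y$, $r\ge 0$, and $Y,Z,Y_1,\dots,Y_r\in T_y\mathcal M$. A subsheaf $\mathcal F\subset\mathcal E$ of $\mathcal O_{\mathcal M}$-supermodules is a locally direct subsheaf of rank $p_1|q_1$ if locally $\mathcal E$ has a homogeneous basis ($p$ even and $q$ odd sections) of which the first $p_1$ even and the first $q_1$ odd members form a basis of $\mathcal F$; it is parallel if $\nabla_YX\in\mathcal F(U)$ for all open $U\subset M$, $Y\in\mathcal T_{\mathcal M}(U)$ and $X\in\mathcal F(U)$. Then the following conditions are equivalent: (i) there exists a parallel locally direct subsheaf $\mathcal F\subset\mathcal E$ of rank $p_1|q_1$; (ii) for every point $x\in M$ there exists a vector supersubspace $F_x\subset\mathcal E_x$ of dimension $p_1|q_1$ preserved by $\mathfrak{hol}(\nabla)_x$ and by $\mathrm{Hol}(\tilde\nabla)_x$. If $M$ is connected, then, for each fixed point $x\in M$, condition (i) is also equivalent to the existence of such a supersubspace $F_x$ at this one point $x$. -/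

import Mathlib

open CategoryTheory TopologicalSpace Opposite Set
open scoped Manifold ContDiff TensorProduct Topology

universe u

noncomputable section

/-- The sign `(-1)^i` of a parity `i`. -/
def superSign (i : ZMod 2) : ℝ := if i = 0 then 1 else -1

/-- The algebra of real functions of class `C^k` on an open subset `U` of an `n`-dimensional
manifold `M`. -/
abbrev CkFun (k : WithTop ℕ∞) (n : ℕ) {M : Type u} [TopologicalSpace M]
    [ChartedSpace (EuclideanSpace ℝ (Fin n)) M] (U : Opens M) : Type u :=
  C^k⟮𝓡 n, U; 𝓘(ℝ, ℝ), ℝ⟯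

/-- Restriction of `C^k` functions to a smaller open subset. -/
def CkFun.res {k : WithTop ℕ∞} {n : ℕ} {M : Type u} [TopologicalSpace M]
    [ChartedSpace (EuclideanSpace ℝ (Fin n)) M] {V U : Opens M} (h : V ≤ U) :
    CkFun k n U →ₐ[ℝ] CkFun k n V where
  toRingHom := ContMDiffMap.restrictRingHom (𝓡 n) 𝓘(ℝ, ℝ) ℝ h
  commutes' _ := rfl

/-- The Grassmann algebra on `m` generators. -/
abbrev Grassmann (m : ℕ) : Type := ExteriorAlgebra ℝ (Fin m → ℝ)

/-- The even (`i = 0`) and odd (`i = 1`) parts of the Grassmann algebra. -/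
def Grassmann.par (m : ℕ) (i : ZMod 2) : Submodule ℝ (Grassmann m) :=
  CliffordAlgebra.evenOdd (0 : QuadraticForm ℝ (Fin m → ℝ)) i

/-- The local model `C^k(U) ⊗ Λ(ξ¹, …, ξᵐ)` of the algebra of superfunctions. -/
abbrev ModelFun (k : WithTop ℕ∞) (n m : ℕ) {M : Type u} [TopologicalSpace M]
    [ChartedSpace (EuclideanSpace ℝ (Fin n)) M] (U : Opens M) : Type u :=
  CkFun k n U ⊗[ℝ] Grassmann m

/-- Restriction in the local model. -/
def ModelFun.res {k : WithTop ℕ∞} {n m : ℕ} {M : Type u} [TopologicalSpace M]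
    [ChartedSpace (EuclideanSpace ℝ (Fin n)) M] {V U : Opens M} (h : V ≤ U) :
    ModelFun k n m U →ₐ[ℝ] ModelFun k n m V :=
  Algebra.TensorProduct.map (CkFun.res h) (AlgHom.id ℝ (Grassmann m))

/-- The projection `∑ f_α ξ^α ↦ f_∅` in the local model. -/
def ModelFun.body {k : WithTop ℕ∞} {n m : ℕ} {M : Type u} [TopologicalSpace M]
    [ChartedSpace (EuclideanSpace ℝ (Fin n)) M] (U : Opens M) :
    ModelFun k n m U →ₐ[ℝ] CkFun k n U :=
  (Algebra.TensorProduct.rid ℝ ℝ (CkFun k n U)).toAlgHom.comp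
    (Algebra.TensorProduct.map (AlgHom.id ℝ (CkFun k n U)) ExteriorAlgebra.algebraMapInv)

/-- A supermanifold `(M, 𝒪)` of class `C^k` and dimension `n|m`: a sheaf `𝒪` of (commutative)
real superalgebras on the manifold `M` that is locally isomorphic to `C^k ⊗ Λ(ξ¹, …, ξᵐ)`.
The field `body` is the canonical projection `f ↦ f~` of `𝒪` to the sheaf of `C^k` functions; it is
determined by its values in the local models. -/
structure Supermanifold (k : WithTop ℕ∞) (n m : ℕ) (M : Type u) [TopologicalSpace M]
    [ChartedSpace (EuclideanSpace ℝ (Fin n)) M] where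
  presheaf : TopCat.Presheaf (AlgCat.{u} ℝ) (TopCat.of M)
  isSheaf : presheaf.IsSheaf
  par : ∀ U : Opens M, ZMod 2 → Submodule ℝ (presheaf.obj (op U))
  par_isCompl : ∀ U, IsCompl (par U 0) (par U 1)
  one_mem : ∀ U, (1 : presheaf.obj (op U)) ∈ par U 0
  mul_mem : ∀ U (i j : ZMod 2) (f g : presheaf.obj (op U)),
    f ∈ par U i → g ∈ par U j → f * g ∈ par U (i + j)
  supercomm : ∀ U (i j : ZMod 2) (f g : presheaf.obj (op U)),
    f ∈ par U i → g ∈ par U j → f * g = superSign (i * j) • (g * f)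
  par_res : ∀ {V U : Opens M} (h : V ≤ U) (i : ZMod 2) (f : presheaf.obj (op U)),
    f ∈ par U i → (presheaf.map (homOfLE h).op).hom f ∈ par V i
  body : ∀ U : Opens M, presheaf.obj (op U) →ₐ[ℝ] CkFun k n U
  body_res : ∀ {V U : Opens M} (h : V ≤ U) (f : presheaf.obj (op U)),
    body V ((presheaf.map (homOfLE h).op).hom f) = CkFun.res h (body U f)
  local_model : ∀ x : M, ∃ U : Opens M, x ∈ U ∧
    ∃ φ : ∀ W : Opens M, W ≤ U → (presheaf.obj (op W) ≃ₐ[ℝ] ModelFun k n m W),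
      (∀ (V W : Opens M) (hW : W ≤ U) (h : V ≤ W) (f : presheaf.obj (op W)),
        φ V (h.trans hW) ((presheaf.map (homOfLE h).op).hom f) = ModelFun.res h (φ W hW f)) ∧
      (∀ (W : Opens M) (hW : W ≤ U) (i : ZMod 2) (f : presheaf.obj (op W)),
        f ∈ par W i ↔ φ W hW f ∈ (Grassmann.par m i).baseChange (CkFun k n W)) ∧
      (∀ (W : Opens M) (hW : W ≤ U) (f : presheaf.obj (op W)),
        body W f = ModelFun.body W (φ W hW f))

namespace Supermanifold

variable {k : WithTop ℕ∞} {n m : ℕ} {M : Type u} [TopologicalSpace M]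
  [ChartedSpace (EuclideanSpace ℝ (Fin n)) M] (X : Supermanifold k n m M)

/-- The superalgebra `𝒪(U)` of superfunctions on `U`. -/
abbrev O (U : Opens M) : Type u := X.presheaf.obj (op U)

/-- Restriction of superfunctions. -/
def res {V U : Opens M} (h : V ≤ U) : X.O U →ₐ[ℝ] X.O V :=
  (X.presheaf.map (homOfLE h).op).hom

theorem res_self {U : Opens M} (f : X.O U) : X.res le_rfl f = f := by
  have h : (homOfLE (le_refl U)).op = 𝟙 (op U) := rfl
  simp only [res, h, X.presheaf.map_id]
  rfl

theorem res_res {W V U : Opens M} (h' : W ≤ V) (h : V ≤ U) (f : X.O U) :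
    X.res h' (X.res h f) = X.res (h'.trans h) f := by
  have e : (homOfLE (h'.trans h)).op = (homOfLE h).op ≫ (homOfLE h').op := rfl
  simp only [res, e, X.presheaf.map_comp]
  rfl

/-- The function `f~` of a superfunction `f` on `U`, extended by `0` outside `U`.  Its value at a
point of `U` is the value of `f` at this point. -/
def val {U : Opens M} (f : X.O U) (x : M) : ℝ :=
  open Classical in if h : x ∈ U then X.body U f ⟨x, h⟩ else 0

/-! ### Presheaves of supermodules -/

/-- A presheaf of (left) supermodules over the structure sheaf. -/
structure SuperModulePresheaf where
  presheaf : TopCat.Presheaf (ModuleCat.{u} ℝ) (TopCat.of M)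
  module : ∀ U : Opens M, Module (X.O U) (presheaf.obj (op U))
  isScalarTower : ∀ U : Opens M, IsScalarTower ℝ (X.O U) (presheaf.obj (op U))
  smul_res : ∀ {V U : Opens M} (h : V ≤ U) (f : X.O U) (s : presheaf.obj (op U)),
    (presheaf.map (homOfLE h).op).hom (f • s) = X.res h f • (presheaf.map (homOfLE h).op).hom s
  par : ∀ U : Opens M, ZMod 2 → Submodule ℝ (presheaf.obj (op U))
  par_isCompl : ∀ U, IsCompl (par U 0) (par U 1)
  smul_mem : ∀ U (i j : ZMod 2) (f : X.O U) (s : presheaf.obj (op U)),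
    f ∈ X.par U i → s ∈ par U j → f • s ∈ par U (i + j)
  par_res : ∀ {V U : Opens M} (h : V ≤ U) (i : ZMod 2) (s : presheaf.obj (op U)),
    s ∈ par U i → (presheaf.map (homOfLE h).op).hom s ∈ par V i

namespace SuperModulePresheaf

variable {X} (E : X.SuperModulePresheaf)

/-- The sections of `E` over `U`. -/
abbrev Sec (U : Opens M) : Type u := E.presheaf.obj (op U)

instance (U : Opens M) : Module (X.O U) (E.Sec U) := E.module U

instance (U : Opens M) : IsScalarTower ℝ (X.O U) (E.Sec U) := E.isScalarTower U

/-- Restriction of sections. -/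
def res {V U : Opens M} (h : V ≤ U) : E.Sec U →ₗ[ℝ] E.Sec V :=
  (E.presheaf.map (homOfLE h).op).hom

/-- A homogeneous section: a section together with its parity. -/
structure HomSec (U : Opens M) where
  deg : ZMod 2
  sec : E.Sec U
  mem : sec ∈ E.par U deg

/-- Restriction of homogeneous sections. -/
def HomSec.res {E : X.SuperModulePresheaf} {V U : Opens M} (h : V ≤ U) (s : E.HomSec U) : E.HomSec V :=
  ⟨s.deg, E.res h s.sec, E.par_res h _ _ s.mem⟩

/-- `e` is a basis of the sheaf `E` over `U`. -/
def IsBasis {ι : Type} [Fintype ι] {U : Opens M} (e : ι → E.Sec U) : Prop :=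
  ∀ (W : Opens M) (h : W ≤ U) (s : E.Sec W), ∃! c : ι → X.O W, s = ∑ A, c A • E.res h (e A)

/-- `e` is a homogeneous basis of `E` over `U` with `p` even and `q` odd members. -/
structure IsSuperBasis {p q : ℕ} {U : Opens M} (e : Fin p ⊕ Fin q → E.Sec U) : Prop where
  isBasis : E.IsBasis e
  even : ∀ I, e (Sum.inl I) ∈ E.par U 0
  odd : ∀ J, e (Sum.inr J) ∈ E.par U 1

/-- `E` is a locally free sheaf of supermodules of rank `p|q`. -/
structure IsLocallyFreeSheaf (p q : ℕ) : Prop where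
  isSheaf : E.presheaf.IsSheaf
  locallyFree : ∀ x : M, ∃ U : Opens M, x ∈ U ∧
    ∃ e : Fin p ⊕ Fin q → E.Sec U, E.IsSuperBasis e

/-! ### Fibres -/

/-- The germs at `x` of the products `f • s`, where the superfunction `f` vanishes at `x`, span the
kernel of the evaluation at `x`. -/
def vanishing (x : M) : Submodule ℝ (E.presheaf.stalk (x : TopCat.of M)) :=
  Submodule.span ℝ {g | ∃ (V : Opens M) (hx : x ∈ V) (f : X.O V) (s : E.Sec V),
    X.val f x = 0 ∧ g = (E.presheaf.germ V (x : TopCat.of M) hx).hom (f • s)}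

/-- The fibre `E_x`. -/
abbrev Fiber (x : M) : Type u := (E.presheaf.stalk (x : TopCat.of M)) ⧸ E.vanishing x

/-- The value at `x` of a section. -/
def ev {V : Opens M} (x : M) (hx : x ∈ V) : E.Sec V →ₗ[ℝ] E.Fiber x :=
  (E.vanishing x).mkQ ∘ₗ (E.presheaf.germ V (x : TopCat.of M) hx).hom

/-- The even and odd parts of the fibre. -/
def fiberPar (x : M) (i : ZMod 2) : Submodule ℝ (E.Fiber x) :=
  ⨆ (V : Opens M) (hx : x ∈ V), (E.par V i).map (E.ev x hx)

/-- `F` is a vector supersubspace of `E_x` of dimension `p|q`. -/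
structure IsSuperSubspace {E : X.SuperModulePresheaf} {x : M} (F : Submodule ℝ (E.Fiber x)) (p q : ℕ) :
    Prop where
  graded : F = (F ⊓ E.fiberPar x 0) ⊔ (F ⊓ E.fiberPar x 1)
  dim_even : Module.finrank ℝ ↥(F ⊓ E.fiberPar x 0) = p
  dim_odd : Module.finrank ℝ ↥(F ⊓ E.fiberPar x 1) = q

/-- The even and odd parts of `gl(E_x)`. -/
def glPar (x : M) (i : ZMod 2) : Submodule ℝ (Module.End ℝ (E.Fiber x)) where
  carrier := {A | ∀ (j : ZMod 2), ∀ v ∈ E.fiberPar x j, A v ∈ E.fiberPar x (i + j)}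
  add_mem' hA hB j v hv := add_mem (hA j v hv) (hB j v hv)
  zero_mem' _ _ _ := zero_mem _
  smul_mem' c _ hA j v hv := Submodule.smul_mem _ c (hA j v hv)

/-- `L` is a supersubalgebra of the Lie superalgebra `gl(E_x)`: a graded subspace closed under the
superbracket `[A, B] = A B - (-1)^{|A||B|} B A`. -/
structure IsSuperSubalgebra {E : X.SuperModulePresheaf} {x : M}
    (L : Submodule ℝ (Module.End ℝ (E.Fiber x))) : Prop where
  graded : L = (L ⊓ E.glPar x 0) ⊔ (L ⊓ E.glPar x 1)
  bracket_mem : ∀ (i j : ZMod 2) (A B : Module.End ℝ (E.Fiber x)),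
    A ∈ L → A ∈ E.glPar x i → B ∈ L → B ∈ E.glPar x j → A * B - superSign (i * j) • (B * A) ∈ L

end SuperModulePresheaf

/-! ### The tangent sheaf -/

/-- Families of linear operators on the superalgebras `𝒪(W)`, `W ⊆ U`. -/
abbrev OpFam (U : Opens M) : Type u := ∀ W : {W : Opens M // W ≤ U}, X.O W.1 →ₗ[ℝ] X.O W.1

/-- The superderivations of parity `i` of the sheaf `𝒪|_U`. -/
def derPar (U : Opens M) (i : ZMod 2) : Submodule ℝ (X.OpFam U) where
  carrier := {D |
    (∀ (V W : Opens M) (hW : W ≤ U) (h : V ≤ W) (f : X.O W),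
      X.res h (D ⟨W, hW⟩ f) = D ⟨V, h.trans hW⟩ (X.res h f)) ∧
    (∀ (W : Opens M) (hW : W ≤ U) (j : ZMod 2), ∀ f ∈ X.par W j, D ⟨W, hW⟩ f ∈ X.par W (i + j)) ∧
    (∀ (W : Opens M) (hW : W ≤ U) (j : ZMod 2), ∀ f ∈ X.par W j, ∀ g : X.O W,
      D ⟨W, hW⟩ (f * g) = D ⟨W, hW⟩ f * g + superSign (i * j) • (f * D ⟨W, hW⟩ g))}
  add_mem' := by
    rintro D D' ⟨h1, h2, h3⟩ ⟨h1', h2', h3'⟩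
    refine ⟨fun V W hW h f => ?_, fun W hW j f hf => ?_, fun W hW j f hf g => ?_⟩
    · simp [h1 V W hW h f, h1' V W hW h f]
    · exact add_mem (h2 W hW j f hf) (h2' W hW j f hf)
    · simp only [Pi.add_apply, LinearMap.add_apply, h3 W hW j f hf g, h3' W hW j f hf g, add_mul,
        mul_add, smul_add]
      abel
  zero_mem' := by
    refine ⟨fun V W hW h f => ?_, fun W hW j f hf => ?_, fun W hW j f hf g => ?_⟩ <;> simp
  smul_mem' := by
    rintro c D ⟨h1, h2, h3⟩
    refine ⟨fun V W hW h f => ?_, fun W hW j f hf => ?_, fun W hW j f hf g => ?_⟩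
    · simp [h1 V W hW h f]
    · exact Submodule.smul_mem _ c (h2 W hW j f hf)
    · simp only [Pi.smul_apply, LinearMap.smul_apply, h3 W hW j f hf g, smul_add, smul_mul_assoc,
        mul_smul_comm, smul_comm c]

/-- The vector fields on `U`: sums of even and odd superderivations of `𝒪|_U`. -/
def Der (U : Opens M) : Submodule ℝ (X.OpFam U) := X.derPar U 0 ⊔ X.derPar U 1

variable {X}

theorem derPar_le_Der (U : Opens M) (i : ZMod 2) : X.derPar U i ≤ X.Der U := by
  fin_cases i
  · exact le_sup_left
  · exact le_sup_right

/-- Multiplication of an operator by a superfunction. -/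
def mulOp {U : Opens M} (f : X.O U) : X.OpFam U →ₗ[ℝ] X.OpFam U where
  toFun D W := (LinearMap.mulLeft ℝ (X.res W.2 f)) ∘ₗ D W
  map_add' D D' := by ext W g; simp [mul_add]
  map_smul' c D := by ext W g; simp

theorem superSign_mul_self (i : ZMod 2) : superSign i * superSign i = 1 := by
  unfold superSign; split_ifs <;> norm_num

theorem superSign_add (i j : ZMod 2) : superSign (i + j) = superSign i * superSign j := by
  have h : (1 : ZMod 2) + 1 = 0 := rfl
  obtain rfl | rfl : i = 0 ∨ i = 1 := by revert i; decide
  · simp [superSign]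
  · obtain rfl | rfl : j = 0 ∨ j = 1 := by revert j; decide
    · simp [superSign]
    · simp [superSign, h]

theorem mulOp_mem_derPar {U : Opens M} {i j : ZMod 2} {f : X.O U} (hf : f ∈ X.par U i)
    {D : X.OpFam U} (hD : D ∈ X.derPar U j) : mulOp f D ∈ X.derPar U (i + j) := by
  obtain ⟨h1, h2, h3⟩ := hD
  refine ⟨fun V W hW h g => ?_, fun W hW l g hg => ?_, fun W hW l g hg g' => ?_⟩
  · simp [mulOp, h1 V W hW h g, res_res]
  · have := X.mul_mem W i (j + l) (X.res hW f) _ (X.par_res hW i f hf) (h2 W hW l g hg)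
    rw [add_assoc]; exact this
  · have hc := X.supercomm W i l (X.res hW f) g (X.par_res hW i f hf) hg
    simp only [mulOp, LinearMap.coe_mk, AddHom.coe_mk, LinearMap.comp_apply,
      LinearMap.mulLeft_apply, h3 W hW l g hg g', mul_add, mul_smul_comm, ← mul_assoc, hc,
      smul_mul_assoc, smul_smul]
    rw [add_mul, superSign_add, mul_comm (superSign (i * l))]

theorem mulOp_mem_Der {U : Opens M} (f : X.O U) {D : X.OpFam U} (hD : D ∈ X.Der U) :
    mulOp f D ∈ X.Der U := by
  obtain ⟨D0, h0, D1, h1, rfl⟩ := Submodule.mem_sup.1 hD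
  obtain ⟨f0, hf0, f1, hf1, rfl⟩ := Submodule.mem_sup.1
    ((X.par_isCompl U).sup_eq_top ▸ Submodule.mem_top : f ∈ X.par U 0 ⊔ X.par U 1)
  have hadd : ∀ D : X.OpFam U, mulOp (f0 + f1) D = mulOp f0 D + mulOp f1 D := by
    intro D; ext W g; simp [mulOp, add_mul]
  rw [hadd, map_add, map_add]
  exact add_mem
    (add_mem (derPar_le_Der _ _ (mulOp_mem_derPar hf0 h0))
      (derPar_le_Der _ _ (mulOp_mem_derPar hf0 h1)))
    (add_mem (derPar_le_Der _ _ (mulOp_mem_derPar hf1 h0))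
      (derPar_le_Der _ _ (mulOp_mem_derPar hf1 h1)))

/-- Restriction of operators to smaller open sets. -/
def resOp {V U : Opens M} (h : V ≤ U) : X.OpFam U →ₗ[ℝ] X.OpFam V where
  toFun D W := D ⟨W.1, W.2.trans h⟩
  map_add' _ _ := rfl
  map_smul' _ _ := rfl

theorem resOp_mem_derPar {V U : Opens M} (h : V ≤ U) {i : ZMod 2} {D : X.OpFam U}
    (hD : D ∈ X.derPar U i) : resOp h D ∈ X.derPar V i :=
  ⟨fun V' W hW h' f => hD.1 V' W (hW.trans h) h' f, fun W hW => hD.2.1 W (hW.trans h),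
    fun W hW => hD.2.2 W (hW.trans h)⟩

theorem resOp_mem_Der {V U : Opens M} (h : V ≤ U) {D : X.OpFam U} (hD : D ∈ X.Der U) :
    resOp h D ∈ X.Der V := by
  obtain ⟨D0, h0, D1, h1, rfl⟩ := Submodule.mem_sup.1 hD
  rw [map_add]
  exact add_mem (derPar_le_Der _ _ (resOp_mem_derPar h h0))
    (derPar_le_Der _ _ (resOp_mem_derPar h h1))

/-- The `𝒪(U)`-module structure of the vector fields on `U`: `(f D)(g) = f D(g)`. -/
instance derModule (U : Opens M) : Module (X.O U) (X.Der U) where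
  smul f D := ⟨mulOp f D.1, mulOp_mem_Der f D.2⟩
  one_smul D := by
    apply Subtype.ext; funext W; ext g
    change X.res W.2 1 * D.1 W g = D.1 W g
    simp
  mul_smul f f' D := by
    apply Subtype.ext; funext W; ext g
    change X.res W.2 (f * f') * D.1 W g = X.res W.2 f * (X.res W.2 f' * D.1 W g)
    simp [mul_assoc]
  smul_zero f := by
    apply Subtype.ext; funext W; ext g
    change X.res W.2 f * 0 = 0
    simp
  smul_add f D D' := by
    apply Subtype.ext; funext W; ext g
    change X.res W.2 f * (D.1 W g + D'.1 W g) = X.res W.2 f * D.1 W g + X.res W.2 f * D'.1 W g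
    rw [mul_add]
  add_smul f f' D := by
    apply Subtype.ext; funext W; ext g
    change X.res W.2 (f + f') * D.1 W g = X.res W.2 f * D.1 W g + X.res W.2 f' * D.1 W g
    rw [map_add, add_mul]
  zero_smul D := by
    apply Subtype.ext; funext W; ext g
    change X.res W.2 0 * D.1 W g = 0
    rw [map_zero, zero_mul]

theorem derPar_disjoint (U : Opens M) : Disjoint (X.derPar U 0) (X.derPar U 1) := by
  rw [Submodule.disjoint_def]
  intro D h0 h1
  have key : ∀ (W : Opens M) (hW : W ≤ U) (j : ZMod 2), ∀ f ∈ X.par W j, D ⟨W, hW⟩ f = 0 := by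
    intro W hW j f hf
    have a0 := h0.2.1 W hW j f hf
    have a1 := h1.2.1 W hW j f hf
    have hd := Submodule.disjoint_def.1 (X.par_isCompl W).disjoint
    fin_cases j
    · exact hd _ a0 a1
    · exact hd _ a1 a0
  funext W; ext f
  obtain ⟨f0, hf0, f1, hf1, rfl⟩ := Submodule.mem_sup.1
    ((X.par_isCompl W.1).sup_eq_top ▸ Submodule.mem_top : f ∈ X.par W.1 0 ⊔ X.par W.1 1)
  simp [key W.1 W.2 0 f0 hf0, key W.1 W.2 1 f1 hf1]

/-- The even and odd vector fields on `U`. -/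
def derSub (U : Opens M) (i : ZMod 2) : Submodule ℝ (X.Der U) :=
  (X.derPar U i).comap (X.Der U).subtype

theorem derSub_isCompl (U : Opens M) : IsCompl (derSub (X := X) U 0) (derSub U 1) := by
  constructor
  · rw [Submodule.disjoint_def]
    intro D h0 h1
    exact Subtype.ext (Submodule.disjoint_def.1 (derPar_disjoint U) _ h0 h1)
  · rw [codisjoint_iff, Submodule.eq_top_iff']
    intro D
    obtain ⟨D0, h0, D1, h1, hD⟩ := Submodule.mem_sup.1 D.2
    exact Submodule.mem_sup.2
      ⟨⟨D0, derPar_le_Der U 0 h0⟩, h0, ⟨D1, derPar_le_Der U 1 h1⟩, h1, Subtype.ext hD⟩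

theorem der_isScalarTower (U : Opens M) : IsScalarTower ℝ (X.O U) (X.Der U) := ⟨fun c f D => by
  apply Subtype.ext; funext W; ext g
  change X.res W.2 (c • f) * D.1 W g = c • (X.res W.2 f * D.1 W g)
  simp⟩

/-- Restriction of vector fields. -/
def derRes {V U : Opens M} (h : V ≤ U) : X.Der U →ₗ[ℝ] X.Der V :=
  LinearMap.restrict (resOp h) fun _ hD => resOp_mem_Der h hD

theorem derRes_smul {V U : Opens M} (h : V ≤ U) (f : X.O U) (D : X.Der U) :
    derRes h (f • D) = X.res h f • derRes h D := by
  apply Subtype.ext; funext W; ext g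
  change X.res (W.2.trans h) f * D.1 ⟨W.1, W.2.trans h⟩ g =
    X.res W.2 (X.res h f) * D.1 ⟨W.1, W.2.trans h⟩ g
  rw [res_res]

variable (X) in
/-- The tangent sheaf: the sheaf of superderivations of the structure sheaf. -/
def tangent : X.SuperModulePresheaf where
  presheaf :=
    { obj := fun U => ModuleCat.of ℝ (X.Der U.unop)
      map := fun i => ModuleCat.ofHom (derRes (leOfHom i.unop))
      map_id := fun _ => rfl
      map_comp := fun _ _ => rfl }
  module U := derModule U
  isScalarTower U := der_isScalarTower U
  smul_res h f D := derRes_smul h f D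
  par U i := derSub U i
  par_isCompl U := derSub_isCompl U
  smul_mem _ _ _ _ _ hf hD := mulOp_mem_derPar hf hD
  par_res h _ _ hD := resOp_mem_derPar h hD

/-- The action of a vector field on `U` on the superfunctions on `U`. -/
def lieDer {U : Opens M} (Y : X.tangent.Sec U) : X.O U →ₗ[ℝ] X.O U :=
  (show X.Der U from Y).1 ⟨U, le_rfl⟩

/-- The superbracket `[Y, Z] = Y Z - (-1)^{|Y||Z|} Z Y` of operators of parities `i` and `j`. -/
def bracketOp {U : Opens M} (i j : ZMod 2) (D D' : X.OpFam U) : X.OpFam U :=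
  fun W => D W ∘ₗ D' W - superSign (i * j) • (D' W ∘ₗ D W)

theorem bracketOp_mem {U : Opens M} {i j : ZMod 2} {D D' : X.OpFam U}
    (h : D ∈ X.derPar U i) (h' : D' ∈ X.derPar U j) : bracketOp i j D D' ∈ X.derPar U (i + j) := by
  obtain ⟨h1, h2, h3⟩ := h
  obtain ⟨h1', h2', h3'⟩ := h'
  refine ⟨fun V W hW h f => ?_, fun W hW l f hf => ?_, fun W hW l f hf g => ?_⟩
  · simp [bracketOp, h1 V W hW h, h1' V W hW h]
  · refine sub_mem ?_ (Submodule.smul_mem _ _ ?_)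
    · have := h2 W hW _ _ (h2' W hW l f hf)
      rwa [add_assoc]
    · have := h2' W hW _ _ (h2 W hW l f hf)
      rwa [add_comm i j, add_assoc]
  · have a := h3 W hW _ _ (h2' W hW l f hf) g
    have a' := h3' W hW _ _ (h2 W hW l f hf) g
    have b := h3 W hW l f hf (D' ⟨W, hW⟩ g)
    have b' := h3' W hW l f hf (D ⟨W, hW⟩ g)
    have s1 : superSign (j * (i + l)) = superSign (i * j) * superSign (j * l) := by
      rw [mul_add, superSign_add, mul_comm j i]
    have s2 : superSign (i * (j + l)) = superSign (i * j) * superSign (i * l) := by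
      rw [mul_add, superSign_add]
    have s3 : superSign ((i + j) * l) = superSign (i * l) * superSign (j * l) := by
      rw [add_mul, superSign_add]
    have q := superSign_mul_self (i * j)
    simp only [bracketOp, LinearMap.sub_apply, LinearMap.comp_apply, LinearMap.smul_apply,
      h3 W hW l f hf g, h3' W hW l f hf g, map_add, map_smul, a, a', b, b', s1, s2, s3,
      sub_mul, mul_sub, smul_add, smul_sub, smul_smul, smul_mul_assoc, mul_smul_comm]
    have e : superSign (i * j) * (superSign (i * j) * superSign (j * l)) = superSign (j * l) := by
      rw [← mul_assoc, q, one_mul]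
    rw [e]
    module

/-- The superbracket of homogeneous vector fields. -/
def bracket {U : Opens M} (Y Z : X.tangent.HomSec U) : X.tangent.HomSec U where
  deg := Y.deg + Z.deg
  sec := (⟨bracketOp Y.deg Z.deg (show X.Der U from Y.sec).1 (show X.Der U from Z.sec).1,
    derPar_le_Der _ _ (bracketOp_mem Y.mem Z.mem)⟩ : X.Der U)
  mem := bracketOp_mem Y.mem Z.mem

/-! ### Connections, curvature and its covariant derivatives -/

/-- A connection on the restriction of `E` to the open set `U`. -/
structure Connection (E : X.SuperModulePresheaf) (U : Opens M) where
  nabla : ∀ V : Opens M, V ≤ U → (X.tangent.Sec V →ₗ[ℝ] E.Sec V →ₗ[ℝ] E.Sec V)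
  nabla_res : ∀ (W V : Opens M) (hV : V ≤ U) (h : W ≤ V) (Y : X.tangent.Sec V) (s : E.Sec V),
    E.res h (nabla V hV Y s) = nabla W (h.trans hV) (X.tangent.res h Y) (E.res h s)
  even : ∀ (V : Opens M) (hV : V ≤ U) (i j : ZMod 2), ∀ Y ∈ X.tangent.par V i, ∀ s ∈ E.par V j,
    nabla V hV Y s ∈ E.par V (i + j)
  smul_left : ∀ (V : Opens M) (hV : V ≤ U) (f : X.O V) (Y : X.tangent.Sec V) (s : E.Sec V),
    nabla V hV (f • Y) s = f • nabla V hV Y s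
  leibniz : ∀ (V : Opens M) (hV : V ≤ U) (i j : ZMod 2), ∀ Y ∈ X.tangent.par V i,
    ∀ f ∈ X.par V j, ∀ s : E.Sec V,
      nabla V hV Y (f • s) = lieDer Y f • s + superSign (i * j) • (f • nabla V hV Y s)

namespace Connection

variable {E : X.SuperModulePresheaf}

/-- The covariant derivative of a homogeneous section along a homogeneous vector field. -/
def nablaHom {U : Opens M} (N : Connection E U) {V : Opens M} (hV : V ≤ U)
    (Y : X.tangent.HomSec V) (s : E.HomSec V) : E.HomSec V :=
  ⟨Y.deg + s.deg, N.nabla V hV Y.sec s.sec, N.even V hV _ _ _ Y.mem _ s.mem⟩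

/-- The curvature `R(Y, Z) = [∇_Y, ∇_Z] - ∇_{[Y, Z]}` over `V`. -/
def curvature (N : Connection E ⊤) {V : Opens M} (Y Z : X.tangent.HomSec V) :
    E.Sec V →ₗ[ℝ] E.Sec V :=
  N.nabla V le_top Y.sec ∘ₗ N.nabla V le_top Z.sec
    - superSign (Y.deg * Z.deg) • (N.nabla V le_top Z.sec ∘ₗ N.nabla V le_top Y.sec)
    - N.nabla V le_top (bracket Y Z).sec

/-- The covariant derivatives of the curvature with respect to an auxiliary connection `N'` on the
tangent sheaf over `U`: for `Y = (Y_r, …, Y_1)`, listed from the outermost to the innermost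
derivative, `covCurv N N' hV r Y A B` is the operator `∇'^r_{Y_r, …, Y_1} R(A, B)`. -/
def covCurv (N : Connection E ⊤) {U : Opens M} (N' : Connection X.tangent U) {V : Opens M}
    (hV : V ≤ U) : (r : ℕ) → (Fin r → X.tangent.HomSec V) →
      X.tangent.HomSec V → X.tangent.HomSec V → (E.Sec V →ₗ[ℝ] E.Sec V)
  | 0, _, A, B => N.curvature A B
  | r + 1, Y, A, B =>
    let D := Y 0
    let L : Fin r → X.tangent.HomSec V := Fin.tail Y
    let d : ZMod 2 := ∑ l, (L l).deg
    N.nabla V le_top D.sec ∘ₗ covCurv N N' hV r L A B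
      - ∑ l : Fin r, superSign (D.deg * ∑ j ∈ Finset.univ.filter (· < l), (L j).deg) •
          covCurv N N' hV r (Function.update L l (N'.nablaHom hV D (L l))) A B
      - superSign (D.deg * d) • covCurv N N' hV r L (N'.nablaHom hV D A) B
      - superSign (D.deg * (d + A.deg)) • covCurv N N' hV r L A (N'.nablaHom hV D B)
      - superSign (D.deg * (d + A.deg + B.deg)) •
          (covCurv N N' hV r L A B ∘ₗ N.nabla V le_top D.sec)

/-! ### Parallel displacement and holonomy -/

/-- The value at `γ t` of the vector field `Y` is the velocity of the curve `γ : [a, b] → M`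
at `t`, as a derivation. -/
def IsVelocity (γ : ℝ → M) (a b t : ℝ) {V : Opens M} (Y : X.tangent.Sec V) : Prop :=
  ∀ (W : Opens M) (h : W ≤ V), γ t ∈ W → ∀ f : X.O W,
    HasDerivWithinAt (fun s => X.val f (γ s)) (X.val (lieDer (X.tangent.res h Y) f) (γ t))
      (Icc a b) t

/-- The section `s` of the bundle of the fibres of `E` along `γ : [a, b] → M` is parallel.
In a local basis `e` of `E` one has `s = ∑ c^A e_A`, and the equation reads
`∑ (ċ^A e_A + c^A ∇_{γ̇} e_A) = 0` at the points of the curve. -/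
def IsParallelAlong (N : Connection E ⊤) (γ : ℝ → M) (a b : ℝ) (s : ∀ t, E.Fiber (γ t)) : Prop :=
  ∀ t₀ ∈ Icc a b, ∃ (U : Opens M) (d : ℕ) (e : Fin d → E.Sec U) (c : Fin d → ℝ → ℝ),
    E.IsBasis e ∧ ∀ᶠ t in 𝓝[Icc a b] t₀, ∃ ht : γ t ∈ U,
      s t = ∑ A, c A t • E.ev (γ t) ht (e A) ∧
      ∃ c' : Fin d → ℝ, (∀ A, HasDerivWithinAt (c A) (c' A) (Icc a b) t) ∧
        ∃ (V : Opens M) (hV : V ≤ U) (ht' : γ t ∈ V), ∃ Y ∈ X.tangent.par V 0,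
          IsVelocity γ a b t Y ∧
          ∑ A, (c' A • E.ev (γ t) ht (e A)
            + c A t • E.ev (γ t) ht' (N.nabla V le_top Y (E.res hV (e A)))) = 0

/-- `N.IsTransport x y τ`: the isomorphism `τ : E_x → E_y` is the parallel displacement along some
piecewise smooth curve from `x` to `y`. -/
inductive IsTransport (N : Connection E ⊤) : ∀ x y : M, (E.Fiber x ≃ₗ[ℝ] E.Fiber y) → Prop
  | smooth (γ : ℝ → M) (a b : ℝ) (hab : a < b)
      (hγ : ContMDiffOn 𝓘(ℝ, ℝ) (𝓡 n) ∞ γ (Icc a b))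
      (τ : E.Fiber (γ a) ≃ₗ[ℝ] E.Fiber (γ b))
      (hτ : ∀ v : E.Fiber (γ a), ∃ s : ∀ t, E.Fiber (γ t),
        N.IsParallelAlong γ a b s ∧ s a = v ∧ s b = τ v) :
      IsTransport N (γ a) (γ b) τ
  | trans {x y z : M} {τ : E.Fiber x ≃ₗ[ℝ] E.Fiber y} {τ' : E.Fiber y ≃ₗ[ℝ] E.Fiber z}
      (h : IsTransport N x y τ) (h' : IsTransport N y z τ') : IsTransport N x z (τ.trans τ')

/-- The holonomy group at `x` of the induced connection on the bundle of the fibres of `E`: the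
group of the parallel displacements along piecewise smooth loops at `x`. -/
def Hol (N : Connection E ⊤) (x : M) : Subgroup (E.Fiber x ≃ₗ[ℝ] E.Fiber x) :=
  Subgroup.closure {τ | N.IsTransport x x τ}

/-- The value at `y` of the operator `∇'^r_{Y_r, …, Y_1} R(A, B)` is the endomorphism `T` of
`E_y`. -/
def IsCovCurvAt (N : Connection E ⊤) {U : Opens M} (N' : Connection X.tangent U) (y : M) (r : ℕ)
    (Y : Fin r → X.tangent.HomSec U) (A B : X.tangent.HomSec U)
    (T : Module.End ℝ (E.Fiber y)) : Prop :=
  ∀ (V : Opens M) (hV : V ≤ U) (hy : y ∈ V) (s : E.Sec V),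
    T (E.ev y hy s) =
      E.ev y hy (N.covCurv N' hV r (fun l => (Y l).res hV) (A.res hV) (B.res hV) s)

/-- The operators `τ_γ⁻¹ ∘ (∇'^r_{Y_r, …, Y_1} R(A, B))_y ∘ τ_γ` on `E_x`, where `γ` is a curve from
`x` to `y` and `∇'` is a connection on the tangent sheaf near `y`. -/
def holGenerators (N : Connection E ⊤) (x : M) : Set (Module.End ℝ (E.Fiber x)) :=
  {S | ∃ (y : M) (τ : E.Fiber x ≃ₗ[ℝ] E.Fiber y), N.IsTransport x y τ ∧
    ∃ (U : Opens M) (_ : y ∈ U) (N' : Connection X.tangent U) (r : ℕ)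
      (Y : Fin r → X.tangent.HomSec U) (A B : X.tangent.HomSec U) (T : Module.End ℝ (E.Fiber y)),
      N.IsCovCurvAt N' y r Y A B T ∧ S = τ.symm.toLinearMap ∘ₗ T ∘ₗ τ.toLinearMap}

/-- The holonomy algebra at `x`: the supersubalgebra of `gl(E_x)` generated by the operators
above. -/
def holAlg (N : Connection E ⊤) (x : M) : Submodule ℝ (Module.End ℝ (E.Fiber x)) :=
  sInf {L | N.holGenerators x ⊆ (L : Set (Module.End ℝ (E.Fiber x))) ∧ SuperModulePresheaf.IsSuperSubalgebra L}

/-- `F` is a supersubspace of `E_x` of dimension `p₁|q₁` preserved by the holonomy algebra and by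
the holonomy group at `x`. -/
structure IsHolInvariant (N : Connection E ⊤) (x : M) (p₁ q₁ : ℕ)
    (F : Submodule ℝ (E.Fiber x)) : Prop where
  superSubspace : SuperModulePresheaf.IsSuperSubspace F p₁ q₁
  holAlg_map_le : ∀ A ∈ N.holAlg x, F.map A ≤ F
  Hol_map_eq : ∀ τ ∈ N.Hol x, F.map τ.toLinearMap = F

end Connection

/-! ### Locally direct subsheaves -/

/-- A locally direct subsheaf of rank `p₁|q₁` of the sheaf `E` of rank `p|q`: a subsheaf of
supermodules such that, locally, `E` has a basis whose first `p₁` even and first `q₁` odd members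
form a basis of the subsheaf. -/
structure LocallyDirectSubsheaf (E : X.SuperModulePresheaf) (p q p₁ q₁ : ℕ) where
  sec : ∀ U : Opens M, Submodule (X.O U) (E.Sec U)
  graded : ∀ U : Opens M, ∀ s ∈ sec U,
    ∃ s₀ ∈ sec U, ∃ s₁ ∈ sec U, s₀ ∈ E.par U 0 ∧ s₁ ∈ E.par U 1 ∧ s = s₀ + s₁
  res_mem : ∀ {V U : Opens M} (h : V ≤ U), ∀ s ∈ sec U, E.res h s ∈ sec V
  glue : ∀ (U : Opens M) (s : E.Sec U),
    (∀ x ∈ U, ∃ (V : Opens M) (h : V ≤ U), x ∈ V ∧ E.res h s ∈ sec V) → s ∈ sec U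
  locally_direct : ∀ x : M, ∃ U : Opens M, x ∈ U ∧
    ∃ e : Fin p ⊕ Fin q → E.Sec U, E.IsSuperBasis e ∧
      ∀ (W : Opens M) (h : W ≤ U), sec W = Submodule.span (X.O W)
        (range (fun A : {A : Fin p ⊕ Fin q //
            Sum.elim (fun I : Fin p => (I : ℕ) < p₁) (fun J : Fin q => (J : ℕ) < q₁) A} => E.res h (e A.1)))

/-- The subsheaf `F` is parallel. -/
def LocallyDirectSubsheaf.IsParallel {E : X.SuperModulePresheaf} {p q p₁ q₁ : ℕ}
    (F : LocallyDirectSubsheaf E p q p₁ q₁) (N : Connection E ⊤) : Prop :=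
  ∀ (U : Opens M) (Y : X.tangent.Sec U), ∀ s ∈ F.sec U, N.nabla U le_top Y s ∈ F.sec U

end Supermanifold

end

/-! From a parallel subsheaf to invariant subspaces. Let `G` be parallel and take its values in each
fibre. In a basis adapted to `G`, the covariant derivative of a basis section of `G` has no
component outside `G`. Hence the outer components of a section parallel along a curve satisfy a
homogeneous linear differential system of their own, and by Gronwall they vanish everywhere once
they vanish at one time (`eventually_mem_iff`). So parallel displacement preserves the fibres of
`G`. Covariant derivatives of the curvature are built from `∇`, so they preserve sections of `G` and
therefore its fibres. The stabilizer of a graded subspace is a supersubalgebra of `gl`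
(`isSuperSubalgebra_stabilizerEnd`), so it contains the whole holonomy algebra.

From invariant subspaces to a parallel subsheaf. Keep one base point in each class of points joined
by parallel displacements and carry its subspace to the other points of the class. Invariance under
the holonomy group makes the result independent of the displacement, and invariance under the
holonomy algebra makes every covariant derivative of the curvature preserve it. This is an
`IsParallelField` `F`. The sections all of whose iterated covariant derivatives have values in `F`
form a parallel subsheaf almost by definition (`derivIn`, `exists_subsheaf`). The content is that
this subsheaf is locally direct of the right rank.

Fix a point `y` with coordinates `x, ξ`. By `exists_radial_frame` there is a homogeneous frame `f`
near `y` that is parallel along the coordinate rays from `y` on the level of fibres and satisfies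
`∇_T f_A = 0` for the Euler field `T = ∑ ξ^a ∂/∂ξ^a`. If the frame is adapted to `F` at `y`, radial
transport makes it adapted to `F` at every nearby point. Two inductions on the number of derivatives
finish the argument.

The members of `f` with values in `F` belong to the subsheaf (`mem_derivIn_of_euler_eq_zero`). Even
derivatives preserve values in `F`, and derivatives can be interchanged at the cost of curvature,
which also preserves `F`. For an odd derivative, `∇_T t = 0` gives `∇_T (∇_b t) + ∇_b t = ∑ ξ^a
R(∂_b, ∂_a) t`, and an equation `∇_T u + λ u = v` with `λ > 0` transfers membership from `v` to `u`.

Nothing else belongs to it (`coef_mem_J`). If the derivatives of `t` of order at most `r` have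
values in `F`, then the coefficients of `t` along the remaining members of `f` are sums of products
of `r + 1` odd coordinates, because `T` acts on products of `r` odd coordinates as multiplication by
`r`, modulo longer products. Products of `m + 1` odd coordinates vanish, so the derivatives of order
at most `m` already decide.

No cut-off functions occur, so the smooth and the analytic case are treated together. The price is
that the radial frame has to depend on its endpoint in class `C^k`, which is proved by solving an
integral equation in a Banach algebra. -/

set_option linter.unusedSectionVars false

/-! ### Analysis on Euclidean space: restriction to rays, Hadamard's lemma, radially parallel
frames. -/

noncomputable section

/-! ### Smooth and analytic dependence along rays -/

section Ray

open Metric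

variable {E W : Type} [NormedAddCommGroup E] [NormedSpace ℝ E] [NormedAddCommGroup W]
  [NormedSpace ℝ W]

/-- The restriction of `g` to the ray segment from `0` to `w`, as a continuous function on the unit
interval (and `0` where this restriction is not continuous). -/
def rayMap (g : E → W) (w : E) : C(unitInterval, W) :=
  open Classical in
  if h : Continuous (fun s : unitInterval => g ((s : ℝ) • w)) then ⟨_, h⟩ else 0

theorem smul_mem_ball_of_mem_unitInterval {ρ : ℝ} {w : E} (hw : w ∈ ball (0 : E) ρ)
    (s : unitInterval) : (s : ℝ) • w ∈ ball (0 : E) ρ := by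
  rw [mem_ball_zero_iff] at hw ⊢
  rw [norm_smul, Real.norm_eq_abs, abs_of_nonneg s.2.1]
  nlinarith [s.2.1, s.2.2, norm_nonneg w]

theorem rayMap_apply {g : E → W} {ρ : ℝ} (hg : ContinuousOn g (ball 0 ρ)) {w : E}
    (hw : w ∈ ball (0 : E) ρ) (s : unitInterval) : rayMap g w s = g ((s : ℝ) • w) := by
  have h : Continuous (fun s : unitInterval => g ((s : ℝ) • w)) :=
    hg.comp_continuous (by fun_prop) fun s => smul_mem_ball_of_mem_unitInterval hw s
  simp [rayMap, h]

theorem continuousOn_rayMap {g : E → W} {ρ : ℝ} (hg : ContinuousOn g (ball 0 ρ)) :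
    ContinuousOn (rayMap g) (ball 0 ρ) := by
  rw [continuousOn_iff_continuous_domRestrict]
  let G : C(ball (0 : E) ρ × unitInterval, W) :=
    ⟨fun q => g ((q.2 : ℝ) • (q.1 : E)), hg.comp_continuous (by fun_prop)
      fun q => smul_mem_ball_of_mem_unitInterval q.1.2 q.2⟩
  have : (ball (0 : E) ρ).domRestrict (rayMap g) = G.curry := by
    funext w
    ext s
    change rayMap g w s = _
    simp [rayMap_apply hg w.2, G]
  rw [this]
  exact G.curry.continuous

/-- The operator `a ↦ (h ↦ (s ↦ θ(s) • a(s) h))`. -/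
def rayEval (E W : Type) [NormedAddCommGroup E] [NormedSpace ℝ E] [NormedAddCommGroup W]
    [NormedSpace ℝ W] (θ : C(unitInterval, ℝ)) :
    C(unitInterval, E →L[ℝ] W) →L[ℝ] (E →L[ℝ] C(unitInterval, W)) :=
  LinearMap.mkContinuous₂ (LinearMap.mk₂ ℝ
    (fun (a : C(unitInterval, E →L[ℝ] W)) (h : E) =>
      (⟨fun s => θ s • a s h, by fun_prop⟩ : C(unitInterval, W)))
    (fun a a' h => by ext s; simp) (fun c a h => by ext s; simp [smul_comm _ c])
    (fun a h h' => by ext s; simp) (fun c a h => by ext s; simp [smul_comm _ c]))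
    ‖θ‖ (fun a h => by
      rw [ContinuousMap.norm_le _ (by positivity)]
      intro s
      simp only [LinearMap.mk₂_apply, ContinuousMap.coe_mk, norm_smul]
      calc ‖θ s‖ * ‖a s h‖ ≤ ‖θ‖ * (‖a‖ * ‖h‖) := by
            gcongr
            · exact θ.norm_coe_le_norm s
            · exact (a s).le_opNorm h |>.trans (by gcongr; exact a.norm_coe_le_norm s)
        _ = ‖θ‖ * ‖a‖ * ‖h‖ := (mul_assoc _ _ _).symm)

/-- The operator `a ↦ (h ↦ (s ↦ s • a(s) h))`. -/
def rayDeriv (E W : Type) [NormedAddCommGroup E] [NormedSpace ℝ E] [NormedAddCommGroup W]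
    [NormedSpace ℝ W] : C(unitInterval, E →L[ℝ] W) →L[ℝ] (E →L[ℝ] C(unitInterval, W)) :=
  rayEval E W ⟨Subtype.val, continuous_subtype_val⟩

theorem rayDeriv_apply (a : C(unitInterval, E →L[ℝ] W)) (h : E) (s : unitInterval) :
    rayDeriv E W a h s = (s : ℝ) • a s h := rfl

/-- The mean value inequality for each `u ↦ g (s • u)` bounds the remainder by the oscillation of
the derivative along the ray. That oscillation is small uniformly in `s`, because `rayMap (fderiv ℝ
g)` is continuous for the sup norm. -/
theorem hasFDerivAt_rayMap {g : E → W} {ρ : ℝ} (hg : ContDiffOn ℝ 1 g (ball 0 ρ)) {w : E}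
    (hw : w ∈ ball (0 : E) ρ) :
    HasFDerivAt (rayMap g) (rayDeriv E W (rayMap (fderiv ℝ g) w)) w := by
  have hc : ContinuousOn (fderiv ℝ g) (ball 0 ρ) :=
    hg.continuousOn_fderiv_of_isOpen isOpen_ball le_rfl
  have hr := (continuousOn_rayMap hc).continuousAt (isOpen_ball.mem_nhds hw)
  rw [hasFDerivAt_iff_isLittleO, Asymptotics.isLittleO_iff]
  intro ε hε
  obtain ⟨δ, hδ, hδs⟩ := Metric.mem_nhds_iff.1
    (Filter.inter_mem (isOpen_ball.mem_nhds hw) (hr (Metric.ball_mem_nhds _ hε)))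
  filter_upwards [Metric.ball_mem_nhds w hδ] with u hu
  rw [ContinuousMap.norm_le _ (by positivity)]
  intro s
  have key := Convex.norm_image_sub_le_of_norm_hasFDerivWithin_le' (𝕜 := ℝ)
    (f := fun u => g ((s : ℝ) • u)) (f' := fun u => (s : ℝ) • fderiv ℝ g ((s : ℝ) • u))
    (φ := (s : ℝ) • fderiv ℝ g ((s : ℝ) • w)) (s := ball w δ) (C := ε) (x := w) (y := u)
    (fun v hv => by
      have hv' := smul_mem_ball_of_mem_unitInterval (hδs hv).1 s
      have h1 : HasFDerivAt g (fderiv ℝ g ((s : ℝ) • v)) ((s : ℝ) • v) :=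
        ((hg.differentiableOn one_ne_zero).differentiableAt
          (isOpen_ball.mem_nhds hv')).hasFDerivAt
      have h2 : HasFDerivAt (fun v : E => (s : ℝ) • v) ((s : ℝ) • ContinuousLinearMap.id ℝ E) v :=
        (hasFDerivAt_id v).const_smul (s : ℝ)
      have h3 := h1.comp v h2
      refine HasFDerivAt.hasFDerivWithinAt ?_
      convert! h3 using 1
      ext x; simp)
    (fun v hv => by
      have h1 : ‖(s : ℝ)‖ ≤ 1 := by
        rw [Real.norm_eq_abs, abs_of_nonneg s.2.1]; exact s.2.2
      have h2 := (hδs hv).2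
      rw [mem_preimage, mem_ball, dist_eq_norm] at h2
      have h3 := (rayMap (fderiv ℝ g) v - rayMap (fderiv ℝ g) w).norm_coe_le_norm s
      rw [ContinuousMap.sub_apply, rayMap_apply hc (hδs hv).1, rayMap_apply hc hw] at h3
      rw [← smul_sub, norm_smul]
      nlinarith [norm_nonneg (fderiv ℝ g ((s : ℝ) • v) - fderiv ℝ g ((s : ℝ) • w))])
    (convex_ball w δ) (mem_ball_self hδ) hu
  have hu' := (hδs hu).1
  simpa [rayMap_apply hg.continuousOn hu', rayMap_apply hg.continuousOn hw, rayDeriv_apply,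
    rayMap_apply hc hw, smul_sub] using key

/-- The derivative of `rayMap g` is the fixed bounded operator `rayDeriv` applied to `rayMap (fderiv
ℝ g)`. The target space varies in the induction because `fderiv ℝ g` has values in a space of
operators. -/
theorem contDiffOn_rayMap_nat (j : ℕ) : ∀ {W : Type} [NormedAddCommGroup W] [NormedSpace ℝ W]
    {g : E → W} {ρ : ℝ}, ContDiffOn ℝ j g (ball 0 ρ) → ContDiffOn ℝ j (rayMap g) (ball 0 ρ) := by
  induction j with
  | zero =>
    intro W _ _ g ρ hg
    simp only [Nat.cast_zero, contDiffOn_zero] at hg ⊢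
    exact continuousOn_rayMap hg
  | succ j ih =>
    intro W _ _ g ρ hg
    have hg' := (contDiffOn_succ_iff_fderiv_of_isOpen (n := (j : WithTop ℕ∞))
      (isOpen_ball (x := (0 : E)) (ε := ρ))).1 (by exact_mod_cast hg)
    have h1 : ContDiffOn ℝ 1 g (ball 0 ρ) := hg.of_le (by exact_mod_cast Nat.le_add_left 1 j)
    have : ContDiffOn ℝ ((j : WithTop ℕ∞) + 1) (rayMap g) (ball 0 ρ) := by
      refine (contDiffOn_succ_iff_fderiv_of_isOpen isOpen_ball).2
        ⟨fun w hw => (hasFDerivAt_rayMap h1 hw).differentiableAt.differentiableWithinAt, by simp, ?_⟩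
      refine ((rayDeriv E W).contDiff.comp_contDiffOn (ih hg'.2.2)).congr fun w hw => ?_
      exact (hasFDerivAt_rayMap h1 hw).fderiv
    exact_mod_cast this

/-- The operator `w ↦ (s ↦ s ^ j • w)`. -/
def rayPow (W : Type) [NormedAddCommGroup W] [NormedSpace ℝ W] (j : ℕ) :
    W →L[ℝ] C(unitInterval, W) :=
  LinearMap.mkContinuous
    { toFun := fun w => ⟨fun s => (s : ℝ) ^ j • w, by fun_prop⟩
      map_add' := fun h h' => by ext s; simp
      map_smul' := fun c h => by ext s; simp [smul_comm _ c] } 1 (fun w => by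
        rw [ContinuousMap.norm_le _ (by positivity)]
        intro s
        simp only [LinearMap.coe_mk, AddHom.coe_mk, ContinuousMap.coe_mk, norm_smul, norm_pow]
        gcongr
        refine pow_le_one₀ (norm_nonneg _) ?_
        rw [Real.norm_eq_abs, abs_of_nonneg s.2.1]; exact s.2.2)

theorem rayPow_apply (j : ℕ) (w : W) (s : unitInterval) : rayPow W j w s = (s : ℝ) ^ j • w := rfl

theorem norm_rayPow_le (j : ℕ) : ‖rayPow W j‖ ≤ 1 := LinearMap.mkContinuous_norm_le _ zero_le_one _

/-- Since `g (s • y) = ∑ s ^ j • p_j (y, …, y)`, composing the coefficients of `g` with `rayPow`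
gives a power series for `rayMap g`. Its coefficients have no larger norm, so its radius is no
smaller. The minimum with `ρ` keeps the points where `rayMap g` is the actual restriction and not
the default `0`. -/
theorem analyticAt_rayMap [CompleteSpace W] {g : E → W} {ρ : ℝ} (hρ : 0 < ρ)
    (hc : ContinuousOn g (ball 0 ρ)) (hg : AnalyticAt ℝ g 0) : AnalyticAt ℝ (rayMap g) 0 := by
  obtain ⟨p, r, hp⟩ := hg
  let q : FormalMultilinearSeries ℝ E C(unitInterval, W) := fun j =>
    (rayPow W j).compContinuousMultilinearMap (p j)
  have hq : ∀ j, ‖q j‖ ≤ ‖p j‖ := fun j => by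
    refine ((rayPow W j).norm_compContinuousMultilinearMap_le (p j)).trans ?_
    exact mul_le_of_le_one_left (norm_nonneg _) (norm_rayPow_le j)
  refine ⟨q, min r (ENNReal.ofReal ρ), ?_, lt_min hp.r_pos (by simpa using hρ), ?_⟩
  · refine (min_le_left _ _).trans (hp.r_le.trans ?_)
    exact FormalMultilinearSeries.radius_le_of_le hq
  · intro y hy
    rw [Metric.mem_eball, lt_min_iff] at hy
    have hyr : y ∈ Metric.eball (0 : E) r := hy.1
    have hyρ : y ∈ ball (0 : E) ρ := by
      rw [mem_ball, dist_edist]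
      exact (ENNReal.lt_ofReal_iff_toReal_lt (ne_top_of_lt hy.2)).1 hy.2
    have hsum : Summable fun j => q j fun _ => y := by
      refine Summable.of_norm_bounded (g := fun j => ‖p j‖ * ‖y‖ ^ j) ?_ fun j => ?_
      · have := p.summable_norm_mul_pow (r := ‖y‖₊) (lt_of_lt_of_le (by
          simpa [edist_zero_right, enorm] using hyr) hp.r_le)
        simpa using this
      · refine (ContinuousMultilinearMap.le_opNorm _ _).trans ?_
        simp only [Finset.prod_const, Finset.card_univ, Fintype.card_fin]
        gcongr
        exact hq j
    have hs := hsum.hasSum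
    have : (∑' j, q j fun _ => y) = rayMap g (0 + y) := by
      ext s
      have h1 := (ContinuousMap.evalCLM ℝ s : C(unitInterval, W) →L[ℝ] W).hasSum hs
      have hys : (s : ℝ) • y ∈ Metric.eball (0 : E) r := by
        rw [Metric.mem_eball, edist_zero_right] at hyr ⊢
        refine lt_of_le_of_lt ?_ hyr
        rw [enorm_smul]
        refine mul_le_of_le_one_left (by positivity) ?_
        rw [Real.enorm_eq_ofReal s.2.1]
        exact ENNReal.ofReal_le_one.2 s.2.2
      have h2 := hp.hasSum hys
      rw [zero_add, rayMap_apply hc hyρ]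
      rw [zero_add] at h2
      refine h1.unique ?_
      convert h2 using 2 with j
      simp only [q, ContinuousLinearMap.compContinuousMultilinearMap_coe, Function.comp_apply,
        ContinuousMap.evalCLM_apply, rayPow_apply]
      rw [(p j).map_smul_univ (fun _ => (s : ℝ)) fun _ => y]
      simp
    rwa [← this]

/-- Restriction to rays is a map of class `C^k` near `0` for functions of class `C^k`. -/
theorem exists_contDiffOn_rayMap [CompleteSpace W] {k : WithTop ℕ∞} (hk : k = ∞ ∨ k = ω)
    {g : E → W} {ρ : ℝ} (hρ : 0 < ρ) (hg : ContDiffOn ℝ k g (ball 0 ρ)) :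
    ∃ ε, 0 < ε ∧ ε ≤ ρ ∧ ContDiffOn ℝ k (rayMap g) (ball 0 ε) := by
  rcases hk with rfl | rfl
  · refine ⟨ρ, hρ, le_rfl, contDiffOn_infty.2 fun j => contDiffOn_rayMap_nat j ?_⟩
    exact contDiffOn_infty.1 hg j
  · have h0 : AnalyticAt ℝ g 0 :=
      (hg.contDiffAt (isOpen_ball.mem_nhds (mem_ball_self hρ))).analyticAt
    -- Analyticity is obtained at the origin only and spreads to some smaller ball; this is where `ε
    -- < ρ` may be needed.
    obtain ⟨ε, hε, h⟩ := Metric.eventually_nhds_iff_ball.1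
      (analyticAt_rayMap hρ hg.continuousOn h0).eventually_analyticAt
    exact ⟨min ε ρ, lt_min hε hρ, min_le_right _ _, fun w hw =>
      (h w (ball_subset_ball (min_le_left _ _) hw)).contDiffAt.contDiffWithinAt⟩

/-- The operator `a ↦ (t ↦ ∫ s in 0..t, a(s))`. -/
def rayIntegral (W : Type) [NormedAddCommGroup W] [NormedSpace ℝ W] :
    C(unitInterval, W) →L[ℝ] C(unitInterval, W) :=
  LinearMap.mkContinuous
    { toFun := fun a => ⟨fun t => ∫ s in (0 : ℝ)..t, Set.IccExtend zero_le_one a s,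
        (intervalIntegral.continuous_primitive
          (fun _ _ => (a.continuous.Icc_extend' (h := zero_le_one)).intervalIntegrable _ _)
          0).comp continuous_subtype_val⟩
      map_add' := fun a a' => by
        ext t
        simp only [ContinuousMap.coe_mk, ContinuousMap.add_apply]
        rw [← intervalIntegral.integral_add
          ((a.continuous.Icc_extend' (h := zero_le_one)).intervalIntegrable _ _)
          ((a'.continuous.Icc_extend' (h := zero_le_one)).intervalIntegrable _ _)]
        rfl
      map_smul' := fun c a => by
        ext t
        simp only [ContinuousMap.coe_mk, ContinuousMap.smul_apply, RingHom.id_apply]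
        rw [← intervalIntegral.integral_smul]
        rfl } 1 (fun a => by
        rw [ContinuousMap.norm_le _ (by positivity)]
        intro t
        simp only [LinearMap.coe_mk, AddHom.coe_mk, ContinuousMap.coe_mk]
        refine (intervalIntegral.norm_integral_le_of_norm_le_const (C := ‖a‖)
          fun s _ => a.norm_coe_le_norm _).trans ?_
        rw [sub_zero, abs_of_nonneg t.2.1, one_mul]
        exact mul_le_of_le_one_right (norm_nonneg _) t.2.2)

/-- **Hadamard's lemma** for functions of class `C^k`. -/
theorem exists_hadamard {n : ℕ} {k : WithTop ℕ∞} (hk : k = ∞ ∨ k = ω)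
    {f : EuclideanSpace ℝ (Fin n) → ℝ} {ρ : ℝ} (hρ : 0 < ρ) {a : EuclideanSpace ℝ (Fin n)}
    (hf : ContDiffOn ℝ k f (ball a ρ)) :
    ∃ ε, 0 < ε ∧ ε ≤ ρ ∧ ∃ g : Fin n → EuclideanSpace ℝ (Fin n) → ℝ,
      (∀ i, ContDiffOn ℝ k (g i) (ball a ε)) ∧
      ∀ v ∈ ball a ε, f v = f a + ∑ i, (v i - a i) * g i v := by
  have hk1 : k + 1 ≤ k := by rcases hk with rfl | rfl <;> simp
  have htr : ∀ {r : ℝ} {w : EuclideanSpace ℝ (Fin n)}, w ∈ ball 0 r → a + w ∈ ball a r := by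
    intro r w hw; simpa using hw
  set f₀ : EuclideanSpace ℝ (Fin n) → ℝ := fun w => f (a + w) with hf₀
  have h0 : ContDiffOn ℝ k f₀ (ball 0 ρ) :=
    hf.comp (by fun_prop) fun w hw => htr hw
  have h1 : ContDiffOn ℝ k (fderiv ℝ f₀) (ball 0 ρ) := h0.fderiv_of_isOpen isOpen_ball hk1
  have hne : k ≠ 0 := by rcases hk with rfl | rfl <;> simp
  obtain ⟨ε, hε, hερ, hr⟩ := exists_contDiffOn_rayMap hk hρ h1
  -- `P` integrates over the unit interval, so the witness is the usual `g_i(v) = ∫₀¹ ∂_i f (a + s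
  -- (v - a)) ds`, written as a bounded operator composed with a map of class `C^k`.
  let P : C(unitInterval, EuclideanSpace ℝ (Fin n) →L[ℝ] ℝ) →L[ℝ]
      (EuclideanSpace ℝ (Fin n) →L[ℝ] ℝ) :=
    (ContinuousMap.evalCLM ℝ (1 : unitInterval)).comp (rayIntegral _)
  refine ⟨ε, hε, hερ, fun i v => P (rayMap (fderiv ℝ f₀) (v - a)) (EuclideanSpace.single i 1),
    fun i => ?_, fun v hv => ?_⟩
  · have hsub : ContDiffOn ℝ k (fun v => rayMap (fderiv ℝ f₀) (v - a)) (ball a ε) :=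
      hr.comp (by fun_prop) fun v hv => by simpa [dist_eq_norm] using hv
    exact (P.contDiff.comp_contDiffOn hsub).clm_apply contDiffOn_const
  · set w := v - a with hw
    have hwε : w ∈ ball (0 : EuclideanSpace ℝ (Fin n)) ε := by simpa [hw, dist_eq_norm] using hv
    have hwρ := ball_subset_ball hερ hwε
    have hd : ∀ t ∈ uIcc (0 : ℝ) 1, HasDerivAt (fun t : ℝ => f₀ (t • w))
        (fderiv ℝ f₀ (t • w) w) t := by
      intro t ht
      rw [uIcc_of_le zero_le_one] at ht
      have hm := smul_mem_ball_of_mem_unitInterval hwρ ⟨t, ht⟩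
      have h2 : HasFDerivAt f₀ (fderiv ℝ f₀ (t • w)) (t • w) :=
        ((h0.differentiableOn hne).differentiableAt (isOpen_ball.mem_nhds hm)).hasFDerivAt
      have h3 : HasDerivAt (fun t : ℝ => t • w) w t := by
        simpa using (hasDerivAt_id t).smul_const w
      have h4 := h2.comp_hasDerivAt t h3
      exact h4
    have hI : ∀ t ∈ uIcc (0 : ℝ) 1, (Set.IccExtend zero_le_one (rayMap (fderiv ℝ f₀) w) t) w =
        fderiv ℝ f₀ (t • w) w := by
      intro t ht
      rw [uIcc_of_le zero_le_one] at ht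
      rw [Set.IccExtend_of_mem _ _ ht, rayMap_apply h1.continuousOn hwρ]
    have hcI : Continuous fun t => Set.IccExtend zero_le_one (rayMap (fderiv ℝ f₀) w) t :=
      (rayMap (fderiv ℝ f₀) w).continuous.Icc_extend' (h := zero_le_one)
    have hintegral : ∫ t in (0 : ℝ)..1, (Set.IccExtend zero_le_one (rayMap (fderiv ℝ f₀) w) t) w =
        f₀ w - f₀ 0 := by
      rw [intervalIntegral.integral_eq_sub_of_hasDerivAt (f := fun t : ℝ => f₀ (t • w))
        (fun t ht => by rw [hI t ht]; exact hd t ht)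
        ((hcI.clm_apply continuous_const).intervalIntegrable _ _)]
      simp
    have hP : P (rayMap (fderiv ℝ f₀) w) w = f₀ w - f₀ 0 := by
      rw [← hintegral]
      change (∫ t in (0 : ℝ)..(1 : unitInterval),
        Set.IccExtend zero_le_one (rayMap (fderiv ℝ f₀) w) t) w = _
      rw [ContinuousLinearMap.intervalIntegral_apply (hcI.intervalIntegrable _ _)]
      rfl
    have hsum : w = ∑ i, w i • EuclideanSpace.single i (1 : ℝ) := by
      ext j
      simp [Finset.sum_apply, Pi.single_apply]
    have : P (rayMap (fderiv ℝ f₀) w) w =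
        ∑ i, w i * P (rayMap (fderiv ℝ f₀) w) (EuclideanSpace.single i 1) := by
      conv_lhs => rw [hsum, map_sum]
      rw [← hsum]
      simp
    rw [hP] at this
    have hwi : ∀ i, w i = v i - a i := fun i => by simp [hw]
    simp only [hwi] at this
    rw [← this]
    simp [hf₀, hw]

theorem contDiffOn_eval_one {k : WithTop ℕ∞} {c : E → C(unitInterval, W)} {s : Set E}
    (hc : ContDiffOn ℝ k c s) : ContDiffOn ℝ k (fun w => c w 1) s :=
  (ContinuousMap.evalCLM ℝ (1 : unitInterval) :
    C(unitInterval, W) →L[ℝ] W).contDiff.comp_contDiffOn hc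

theorem contDiffOn_rayEval {k : WithTop ℕ∞} {c : E → C(unitInterval, E →L[ℝ] W)} {s : Set E}
    (hc : ContDiffOn ℝ k c s) {θ : C(unitInterval, ℝ)} :
    ContDiffOn ℝ k (fun w => rayEval E W θ (c w) w) s := by
  have h : ContDiffOn ℝ k (fun w => rayEval E W θ (c w)) s := by
    refine ContDiff.comp_contDiffOn (g := fun a => rayEval E W θ a) ?_ hc
    exact ContinuousLinearMap.contDiff (F := E →L[ℝ] C(unitInterval, W)) _
  exact h.clm_apply contDiffOn_id

/-- The solution of a linear integral equation with small parameter-dependent coefficient. -/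
theorem exists_contDiffOn_solution {A₀ : Type} [NormedRing A₀] [NormedAlgebra ℝ A₀]
    [CompleteSpace A₀] {k : WithTop ℕ∞} (J : A₀ →L[ℝ] A₀) {a : E → A₀} {ρ : ℝ} (hρ : 0 < ρ)
    (ha : ContDiffOn ℝ k a (ball 0 ρ)) (ha0 : a 0 = 0) :
    ∃ ε, 0 < ε ∧ ε ≤ ρ ∧ ∃ c : E → A₀, ContDiffOn ℝ k c (ball 0 ε) ∧ c 0 = 1 ∧
      (∀ w ∈ ball (0 : E) ε, c w + J (c w * a w) = 1) ∧
      ∀ w ∈ ball (0 : E) ε, ∀ b, b + J (b * a w) = 1 → b = c w := by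
  -- `B x` is the operator `c ↦ J (c * x)`, so the equation reads `L w c = 1`. As `L 0 = 1` and the
  -- units are open, `L w` is invertible for small `w`. Inversion is of class `C^k`, which gives the
  -- dependence of the solution on the parameter.
  let B : A₀ →L[ℝ] (A₀ →L[ℝ] A₀) :=
    (ContinuousLinearMap.compL ℝ A₀ A₀ A₀ J).comp (ContinuousLinearMap.mul ℝ A₀).flip
  let L : E → (A₀ →L[ℝ] A₀) := fun w => 1 + B (a w)
  have hLs : ContDiffOn ℝ k L (ball 0 ρ) :=
    contDiffOn_const.add (B.contDiff.comp_contDiffOn ha)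
  have hL0 : L 0 = 1 := by simp [L, ha0]
  have hLc : ContinuousAt L 0 :=
    hLs.continuousOn.continuousAt (isOpen_ball.mem_nhds (mem_ball_self hρ))
  have hLu : ∀ᶠ w in 𝓝 (0 : E), IsUnit (L w) := by
    refine hLc.eventually (Units.isOpen.mem_nhds ?_)
    rw [hL0]; exact isUnit_one
  obtain ⟨ε₂, hε₂, hu⟩ := Metric.eventually_nhds_iff_ball.1 hLu
  have hb1 : ball (0 : E) (min ρ ε₂) ⊆ ball 0 ρ := ball_subset_ball (min_le_left _ _)
  have hb2 : ball (0 : E) (min ρ ε₂) ⊆ ball 0 ε₂ := ball_subset_ball (min_le_right _ _)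
  refine ⟨min ρ ε₂, lt_min hρ hε₂, min_le_left _ _, fun w => Ring.inverse (L w) 1,
    fun w hw => ?_, by simp [hL0], fun w hw => ?_, fun w hw b hb => ?_⟩
  · obtain ⟨T, hT⟩ := hu w (hb2 hw)
    have h1 := hLs.contDiffAt (isOpen_ball.mem_nhds (hb1 hw))
    have h2 : ContDiffAt ℝ k Ring.inverse (L w) := hT ▸ contDiffAt_ringInverse ℝ T
    exact ((h2.comp w h1).clm_apply contDiffAt_const).contDiffWithinAt
  · have := Ring.mul_inverse_cancel _ (hu w (hb2 hw))
    exact congrArg (fun T : A₀ →L[ℝ] A₀ => T 1) this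
  · have := congrArg (fun T : A₀ →L[ℝ] A₀ => T b) (Ring.inverse_mul_cancel _ (hu w (hb2 hw)))
    have hb' : L w b = 1 := hb
    have h3 : Ring.inverse (L w) (L w b) = b := this
    rw [hb'] at h3
    exact h3.symm

/-- A frame of class `C^k` which is parallel along the rays through `0`, for the connection form
`Γ` of class `C^k`. -/
theorem exists_radial_parallel_frame {R : Type} [NormedRing R] [NormedAlgebra ℝ R]
    [CompleteSpace R] {k : WithTop ℕ∞} (hk : k = ∞ ∨ k = ω) {Γ : E → E →L[ℝ] R} {ρ : ℝ}
    (hρ : 0 < ρ) (hΓ : ContDiffOn ℝ k Γ (ball 0 ρ)) :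
    ∃ ε, 0 < ε ∧ ε ≤ ρ ∧ ∃ C : E → R, ContDiffOn ℝ k C (ball 0 ε) ∧ C 0 = 1 ∧
      ∀ w ∈ ball (0 : E) ε, ∀ t ∈ Icc (0 : ℝ) 1,
        fderiv ℝ C (t • w) w = -(C (t • w) * Γ (t • w) w) := by
  have hne : k ≠ 0 := by rcases hk with rfl | rfl <;> simp
  obtain ⟨ε₁, hε₁, hερ, hr⟩ := exists_contDiffOn_rayMap hk hρ hΓ
  -- `A w s = Γ(s w) w` is the coefficient of the parallel transport equation along the ray of `w`.
  -- The frame solves `c' = -c A`, `c(0) = 1`, used here in its integral form.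
  let A : E → C(unitInterval, R) := fun w => rayEval E R 1 (rayMap Γ w) w
  have hA : ∀ w ∈ ball (0 : E) ε₁, ∀ s : unitInterval, A w s = Γ ((s : ℝ) • w) w := by
    intro w hw s
    change (1 : ℝ) • (rayMap Γ w) s w = _
    rw [one_smul, rayMap_apply hΓ.continuousOn (ball_subset_ball hερ hw)]
  have hAs : ContDiffOn ℝ k A (ball 0 ε₁) :=
    contDiffOn_rayEval hr
  obtain ⟨ε, hε, hεε, c, hcs, hc0, hc1', hcu'⟩ :=
    exists_contDiffOn_solution (rayIntegral R) hε₁ hAs (by simp [A])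
  have hb1 : ball (0 : E) ε ⊆ ball 0 ε₁ := ball_subset_ball hεε
  have hc1 : ∀ w ∈ ball (0 : E) ε, ∀ t : unitInterval,
      c w t + ∫ s in (0 : ℝ)..t, Set.IccExtend zero_le_one (c w * A w) s = 1 :=
    fun w hw t => congrArg (fun a : C(unitInterval, R) => a t) (hc1' w hw)
  have hcu : ∀ w ∈ ball (0 : E) ε, ∀ a : C(unitInterval, R), (∀ t : unitInterval,
      a t + ∫ s in (0 : ℝ)..t, Set.IccExtend zero_le_one (a * A w) s = 1) → a = c w :=
    fun w hw a ha => hcu' w hw a (ContinuousMap.ext ha)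
  -- Rescaling time by `t` turns the solution for `w` into a solution for `t • w`, so uniqueness
  -- applies. Thus the single function `w ↦ c w 1` restricts on each ray to the solution along that
  -- ray.
  have hscale : ∀ w ∈ ball (0 : E) ε, ∀ t : unitInterval, c ((t : ℝ) • w) 1 = c w t := by
    intro w hw t
    have htw := smul_mem_ball_of_mem_unitInterval hw t
    let a : C(unitInterval, R) := (c w).comp ⟨fun s => t * s, by fun_prop⟩
    have ha : ∀ s : unitInterval, a s + ∫ u in (0 : ℝ)..s,
        Set.IccExtend zero_le_one (a * A ((t : ℝ) • w)) u = 1 := by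
      intro s
      rw [← hc1 w hw (t * s)]
      change c w (t * s) + _ = _
      congr 1
      have h2 := intervalIntegral.smul_integral_comp_mul_left
        (fun u => Set.IccExtend (zero_le_one (α := ℝ)) (c w * A w) u) (t : ℝ) (a := 0) (b := s)
      rw [mul_zero] at h2
      rw [Set.Icc.coe_mul, ← h2, ← intervalIntegral.integral_smul]
      refine intervalIntegral.integral_congr fun u hu' => ?_
      rw [uIcc_of_le s.2.1] at hu'
      have huI : u ∈ Icc (0 : ℝ) 1 := ⟨hu'.1, hu'.2.trans s.2.2⟩
      have htu : (t : ℝ) * u ∈ Icc (0 : ℝ) 1 := (t * ⟨u, huI⟩ : unitInterval).2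
      rw [Set.IccExtend_of_mem _ _ huI, Set.IccExtend_of_mem _ _ htu, ContinuousMap.mul_apply,
        ContinuousMap.mul_apply, hA _ (hb1 htw), hA _ (hb1 hw), map_smul, mul_smul_comm]
      change (t : ℝ) • (c w (t * ⟨u, huI⟩) * Γ (u • ((t : ℝ) • w)) w) = _
      rw [smul_smul, mul_comm u]
      rfl
    rw [← hcu _ htw a ha]
    change c w (t * 1) = _
    rw [mul_one]
  have hCs : ContDiffOn ℝ k (fun w => c w 1) (ball 0 ε) := contDiffOn_eval_one hcs
  refine ⟨ε, hε, hεε.trans hερ, fun w => c w 1, hCs, ?_, ?_⟩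
  · simp [hc0]
  · intro w hw t ht
    have htw := smul_mem_ball_of_mem_unitInterval hw ⟨t, ht⟩
    have h1 : HasFDerivAt (fun w => c w 1) (fderiv ℝ (fun w => c w 1) (t • w)) (t • w) :=
      ((hCs.differentiableOn hne).differentiableAt (isOpen_ball.mem_nhds htw)).hasFDerivAt
    have h2 : HasDerivAt (fun t : ℝ => t • w) w t := by
      simpa using (hasDerivAt_id t).smul_const w
    have h3 := (h1.comp_hasDerivAt t h2).hasDerivWithinAt (s := Icc 0 1)
    have hcI : Continuous fun u => Set.IccExtend zero_le_one (c w * A w) u :=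
      (c w * A w).continuous.Icc_extend' (h := zero_le_one)
    have h4 : HasDerivWithinAt (fun u => (1 : R) - ∫ s in (0 : ℝ)..u,
        Set.IccExtend zero_le_one (c w * A w) s)
        (-(Set.IccExtend zero_le_one (c w * A w) t)) (Icc 0 1) t :=
      ((hcI.integral_hasStrictDerivAt 0 t).hasDerivAt.const_sub 1).hasDerivWithinAt
    have h5 : HasDerivWithinAt (fun u : ℝ => c (u • w) 1)
        (-(Set.IccExtend zero_le_one (c w * A w) t)) (Icc 0 1) t := by
      refine h4.congr_of_mem (fun u hu' => ?_) ht
      rw [hscale w hw ⟨u, hu'⟩]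
      exact eq_sub_of_add_eq (hc1 w hw ⟨u, hu'⟩)
    have h7 := (uniqueDiffOn_Icc (zero_lt_one (α := ℝ)) t ht).eq_deriv _ h3 h5
    rw [h7, Set.IccExtend_of_mem _ _ ht, ContinuousMap.mul_apply, hA _ (hb1 hw),
      ← hscale w hw ⟨t, ht⟩]

end Ray
end

noncomputable section

theorem zmod_two_eq_zero_or_one (j : ZMod 2) : j = 0 ∨ j = 1 := by revert j; decide

/-! ### The Grassmann algebra -/

namespace Grassmann

variable {m : ℕ}

/-- The generators `ξ^a` of the Grassmann algebra. -/
def gen (a : Fin m) : Grassmann m := ExteriorAlgebra.ι ℝ (Pi.single a 1)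

/-- The odd derivation `∂/∂ξ^a` of the Grassmann algebra. -/
def deriv (a : Fin m) : Grassmann m →ₗ[ℝ] Grassmann m :=
  CliffordAlgebra.contractLeft (Q := (0 : QuadraticForm ℝ (Fin m → ℝ))) (LinearMap.proj a)

theorem gen_mem (a : Fin m) : gen a ∈ Grassmann.par m 1 :=
  CliffordAlgebra.ι_mem_evenOdd_one _ _

theorem deriv_gen (a b : Fin m) :
    deriv a (gen b) = algebraMap ℝ _ (if a = b then (1 : ℝ) else 0) := by
  have := CliffordAlgebra.contractLeft_ι (Q := (0 : QuadraticForm ℝ (Fin m → ℝ)))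
    (d := LinearMap.proj a) (Pi.single b 1)
  rw [LinearMap.proj_apply, Pi.single_apply] at this
  exact this

theorem deriv_algebraMap (a : Fin m) (r : ℝ) : deriv a (algebraMap ℝ _ r) = 0 :=
  CliffordAlgebra.contractLeft_algebraMap (Q := (0 : QuadraticForm ℝ (Fin m → ℝ)))
    (LinearMap.proj a) r

theorem par_mul {i j : ZMod 2} {x y : Grassmann m} (hx : x ∈ par m i) (hy : y ∈ par m j) :
    x * y ∈ par m (i + j) :=
  CliffordAlgebra.evenOdd_mul_le _ i j (Submodule.mul_mem_mul hx hy)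

theorem deriv_mem (a : Fin m) (j : ZMod 2) {x : Grassmann m} (hx : x ∈ par m j) :
    deriv a x ∈ par m (1 + j) := by
  have hι : ∀ (v : Fin m → ℝ) (x : Grassmann m), deriv a (ExteriorAlgebra.ι ℝ v * x) =
      v a • x - ExteriorAlgebra.ι ℝ v * deriv a x := fun v x =>
    CliffordAlgebra.contractLeft_ι_mul (Q := (0 : QuadraticForm ℝ (Fin m → ℝ)))
      (d := LinearMap.proj a) v x
  have hv : ∀ v : Fin m → ℝ, ExteriorAlgebra.ι ℝ v ∈ par m 1 := fun v =>
    CliffordAlgebra.ι_mem_evenOdd_one _ v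
  have h2 : (1 : ZMod 2) + 1 = 0 := rfl
  have hstep : ∀ (j : ZMod 2) (v w : Fin m → ℝ) (x : Grassmann m), x ∈ par m j →
      deriv a x ∈ par m (1 + j) →
      deriv a (ExteriorAlgebra.ι ℝ v * ExteriorAlgebra.ι ℝ w * x) ∈ par m (1 + j) := by
    intro j v w x hx hd
    rw [mul_assoc, hι, hι, mul_sub, mul_smul_comm]
    refine sub_mem (Submodule.smul_mem _ _ (par_mul (hv w) hx))
      (sub_mem (Submodule.smul_mem _ _ (par_mul (hv v) hx)) ?_)
    have := par_mul (hv v) (par_mul (hv w) hd)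
    rwa [← add_assoc, h2, zero_add] at this
  obtain rfl | rfl : j = 0 ∨ j = 1 := zmod_two_eq_zero_or_one j
  · refine CliffordAlgebra.even_induction (0 : QuadraticForm ℝ (Fin m → ℝ))
      (motive := fun x _ => deriv a x ∈ par m (1 + 0)) (fun r => ?_) (fun x y _ _ hx hy => ?_)
      (fun v w x hx hd => ?_) x hx
    · have := deriv_algebraMap a r
      exact this ▸ zero_mem _
    · rw [map_add]; exact add_mem hx hy
    · exact hstep 0 v w x hx hd
  · refine CliffordAlgebra.odd_induction (0 : QuadraticForm ℝ (Fin m → ℝ))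
      (P := fun x _ => deriv a x ∈ par m (1 + 1)) (fun v => ?_) (fun x y _ _ hx hy => ?_)
      (fun v w x hx hd => ?_) x hx
    · have h1 := hι v 1
      rw [mul_one, ← map_one (algebraMap ℝ (Grassmann m)), deriv_algebraMap, mul_zero,
        sub_zero] at h1
      have h3 : deriv a (ExteriorAlgebra.ι ℝ v) ∈ par m 0 := by
        rw [h1]
        refine Submodule.smul_mem _ _ ?_
        rw [map_one]
        exact Submodule.one_le.1 (CliffordAlgebra.one_le_evenOdd_zero _)
      exact h3
    · rw [map_add]; exact add_mem hx hy
    · exact hstep 1 v w x hx hd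

/-- Contraction is a derivation twisted by the grade involution, and on homogeneous elements this
involution is the sign of the parity. -/
theorem deriv_mul (a : Fin m) (j : ZMod 2) {x : Grassmann m} (hx : x ∈ par m j)
    (y : Grassmann m) : deriv a (x * y) = deriv a x * y + superSign (1 * j) • (x * deriv a y) := by
  have hι : ∀ (v : Fin m → ℝ) (x : Grassmann m), deriv a (ExteriorAlgebra.ι ℝ v * x) =
      v a • x - ExteriorAlgebra.ι ℝ v * deriv a x := fun v x =>
    CliffordAlgebra.contractLeft_ι_mul (Q := (0 : QuadraticForm ℝ (Fin m → ℝ)))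
      (d := LinearMap.proj a) v x
  have key : ∀ x : Grassmann m, deriv a (x * y) = deriv a x * y +
      CliffordAlgebra.involute (Q := (0 : QuadraticForm ℝ (Fin m → ℝ))) x * deriv a y := by
    intro x
    induction x using CliffordAlgebra.left_induction with
    | algebraMap r =>
      rw [AlgHom.commutes]
      erw [deriv_algebraMap]
      rw [zero_mul, zero_add, ← Algebra.smul_def, ← Algebra.smul_def, map_smul]
    | add x x' h h' =>
      rw [add_mul, map_add, h, h', map_add, map_add]
      noncomm_ring
    | ι_mul x v h =>
      have h1 := hι v (x * y)
      have h2 := hι v x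
      rw [h] at h1
      have h3 : CliffordAlgebra.involute (Q := (0 : QuadraticForm ℝ (Fin m → ℝ)))
          (CliffordAlgebra.ι _ v * x) = -(CliffordAlgebra.ι _ v * CliffordAlgebra.involute x) := by
        rw [map_mul, CliffordAlgebra.involute_ι, neg_mul]
      change deriv a (ExteriorAlgebra.ι ℝ v * x * y) = deriv a (ExteriorAlgebra.ι ℝ v * x) * y + _
      rw [mul_assoc, h1, h2, h3]
      change _ = _ + -(ExteriorAlgebra.ι ℝ v * _) * _
      rw [sub_mul, smul_mul_assoc, mul_add, neg_mul, mul_assoc, mul_assoc]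
      abel
  rw [key]
  congr 1
  obtain rfl | rfl : j = 0 ∨ j = 1 := zmod_two_eq_zero_or_one j
  · rw [CliffordAlgebra.involute_eq_of_mem_even hx]
    simp [superSign]
  · rw [CliffordAlgebra.involute_eq_of_mem_odd hx]
    simp [superSign]

/-- By the pigeonhole principle a generator is repeated. This nilpotency makes the filtration by
powers of the odd coordinates finite. -/
theorem prod_gen_eq_zero (l : Fin (m + 1) → Fin m) : (List.ofFn fun i => gen (l i)).prod = 0 := by
  have := ExteriorAlgebra.ιMulti_apply (R := ℝ) (fun i => (Pi.single (l i) 1 : Fin m → ℝ))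
  change (List.ofFn fun i => ExteriorAlgebra.ι ℝ (Pi.single (l i) 1)).prod = 0
  rw [← this]
  refine AlternatingMap.map_eq_zero_of_not_injective _ _ fun hinj => ?_
  have hl : Function.Injective l := fun i j hij => hinj (by simp [hij])
  simpa using Fintype.card_le_of_injective l hl

theorem exists_eq_add_sum_gen_mul (x : Grassmann m) : ∃ h : Fin m → Grassmann m,
    x = algebraMap ℝ _ (ExteriorAlgebra.algebraMapInv x) + ∑ a, gen a * h a := by
  have hι : ∀ v : Fin m → ℝ, ExteriorAlgebra.ι ℝ v = ∑ a, v a • gen a := by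
    intro v
    conv_lhs => rw [← Finset.univ_sum_single v]
    rw [map_sum]
    refine Finset.sum_congr rfl fun a _ => ?_
    rw [gen, ← map_smul, ← Pi.single_smul, smul_eq_mul, mul_one]
  induction x using CliffordAlgebra.left_induction with
  | algebraMap r =>
    refine ⟨0, ?_⟩
    have := ExteriorAlgebra.algebraMap_leftInverse (R := ℝ) (Fin m → ℝ) r
    simp only [Pi.zero_apply, mul_zero, Finset.sum_const_zero, add_zero]
    exact congrArg (algebraMap ℝ (Grassmann m)) this.symm
  | add x y hx hy =>
    obtain ⟨h, hh⟩ := hx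
    obtain ⟨h', hh'⟩ := hy
    refine ⟨h + h', ?_⟩
    simp only [Pi.add_apply, mul_add, Finset.sum_add_distrib, map_add]
    conv_lhs => rw [hh, hh']
    abel
  | ι_mul x v _ =>
    refine ⟨fun a => v a • x, ?_⟩
    have h0 : ExteriorAlgebra.algebraMapInv (R := ℝ) (ExteriorAlgebra.ι ℝ v) = 0 := by
      simp [ExteriorAlgebra.algebraMapInv]
    have h1 : ExteriorAlgebra.algebraMapInv (R := ℝ) (ExteriorAlgebra.ι ℝ v * x) = 0 := by
      rw [map_mul, h0, zero_mul]
    erw [h1]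
    rw [map_zero, zero_add]
    change ExteriorAlgebra.ι ℝ v * x = _
    rw [hι, Finset.sum_mul]
    simp

end Grassmann

end

noncomputable section

/-! ### Functions of class `C^k` in a chart -/

namespace CkFun

variable {k : WithTop ℕ∞} {n : ℕ} {M : Type u} [TopologicalSpace M]
  [ChartedSpace (EuclideanSpace ℝ (Fin n)) M]

theorem res_apply {V W : Opens M} (h : V ≤ W) (f : CkFun k n W) (z : V) :
    CkFun.res h f z = f ⟨z.1, h z.2⟩ := rfl

variable (φ : OpenPartialHomeomorph M (EuclideanSpace ℝ (Fin n)))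

/-- The coordinate expression of a function of class `C^k`, extended by `0`. -/
def loc {W : Opens M} (f : CkFun k n W) (v : EuclideanSpace ℝ (Fin n)) : ℝ :=
  open Classical in if h : φ.symm v ∈ W then f ⟨φ.symm v, h⟩ else 0

/-- The image of an open set in a chart. -/
def chartImage (W : Opens M) : Set (EuclideanSpace ℝ (Fin n)) := φ.target ∩ φ.symm ⁻¹' W

theorem isOpen_chartImage (W : Opens M) : IsOpen (chartImage φ W) :=
  φ.isOpen_inter_preimage_symm W.2

variable {φ}

theorem mem_chartImage {W : Opens M} (hW : (W : Set M) ⊆ φ.source) {z : M} (hz : z ∈ W) :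
    φ z ∈ chartImage φ W :=
  ⟨φ.map_source (hW hz), by simpa [φ.left_inv (hW hz)] using hz⟩

theorem loc_apply {W : Opens M} (hW : (W : Set M) ⊆ φ.source) (f : CkFun k n W) (z : W) :
    loc φ f (φ z.1) = f z := by
  have h := φ.left_inv (hW z.2)
  have hz : φ.symm (φ z.1) ∈ W := by rw [h]; exact z.2
  rw [loc, dif_pos hz]
  exact congrArg f (Subtype.ext h)

theorem loc_of_mem {W : Opens M} (f : CkFun k n W) {v : EuclideanSpace ℝ (Fin n)}
    (hv : v ∈ chartImage φ W) : loc φ f v = f ⟨φ.symm v, hv.2⟩ := dif_pos hv.2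

theorem contDiffOn_loc (hφ : φ ∈ IsManifold.maximalAtlas (𝓡 n) k M) {W : Opens M}
    (f : CkFun k n W) : ContDiffOn ℝ k (loc φ f) (chartImage φ W) := by
  rw [← contMDiffOn_iff_contDiffOn]
  let F : M → ℝ := fun z => open Classical in if h : z ∈ W then f ⟨z, h⟩ else 0
  have hF : ContMDiffOn (𝓡 n) 𝓘(ℝ, ℝ) k F W := by
    intro z hz
    have h1 : ContMDiffAt (𝓡 n) 𝓘(ℝ, ℝ) k (fun x : W => F x) ⟨z, hz⟩ := by
      have : (fun x : W => F x) = f := by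
        funext x
        simp [F]
      rw [this]
      exact f.2 _
    exact (contMDiffAt_subtype_iff.1 h1).contMDiffWithinAt
  exact hF.comp ((contMDiffOn_symm_of_mem_maximalAtlas hφ).mono inter_subset_left) fun v hv => hv.2

/-- The function of class `C^k` with a given coordinate expression. -/
def ofLoc (hφ : φ ∈ IsManifold.maximalAtlas (𝓡 n) k M) {W : Opens M}
    (hW : (W : Set M) ⊆ φ.source) (F : EuclideanSpace ℝ (Fin n) → ℝ)
    (hF : ContDiffOn ℝ k F (chartImage φ W)) : CkFun k n W :=
  ⟨fun z => F (φ z.1), by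
    have h1 : ContMDiffOn (𝓡 n) 𝓘(ℝ, ℝ) k (fun z => F (φ z)) W :=
      (contMDiffOn_iff_contDiffOn.2 hF).comp ((contMDiffOn_of_mem_maximalAtlas hφ).mono hW)
        fun z hz => mem_chartImage hW hz
    intro z
    exact contMDiffAt_subtype_iff.2 (h1.contMDiffAt (W.2.mem_nhds z.2))⟩

theorem ofLoc_apply (hφ : φ ∈ IsManifold.maximalAtlas (𝓡 n) k M) {W : Opens M}
    (hW : (W : Set M) ⊆ φ.source) (F : EuclideanSpace ℝ (Fin n) → ℝ)
    (hF : ContDiffOn ℝ k F (chartImage φ W)) (z : W) : ofLoc hφ hW F hF z = F (φ z.1) := rfl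

theorem loc_ofLoc (hφ : φ ∈ IsManifold.maximalAtlas (𝓡 n) k M) {W : Opens M}
    (hW : (W : Set M) ⊆ φ.source) (F : EuclideanSpace ℝ (Fin n) → ℝ)
    (hF : ContDiffOn ℝ k F (chartImage φ W)) {v : EuclideanSpace ℝ (Fin n)}
    (hv : v ∈ chartImage φ W) : loc φ (ofLoc hφ hW F hF) v = F v := by
  rw [loc_of_mem _ hv, ofLoc_apply, φ.right_inv hv.1]

theorem differentiableAt_loc (hk : k = ∞ ∨ k = ω) (hφ : φ ∈ IsManifold.maximalAtlas (𝓡 n) k M)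
    {W : Opens M} (f : CkFun k n W) {v : EuclideanSpace ℝ (Fin n)} (hv : v ∈ chartImage φ W) :
    DifferentiableAt ℝ (loc φ f) v :=
  ((contDiffOn_loc hφ f).differentiableOn (by rcases hk with rfl | rfl <;> simp)).differentiableAt
    ((isOpen_chartImage φ W).mem_nhds hv)

theorem add_one_le_of_eq {k : WithTop ℕ∞} (hk : k = ∞ ∨ k = ω) : k + 1 ≤ k := by
  rcases hk with rfl | rfl <;> simp

variable (hk : k = ∞ ∨ k = ω) (hφ : φ ∈ IsManifold.maximalAtlas (𝓡 n) k M)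

/-- The partial derivative in a chart. -/
def pd {W : Opens M} (hW : (W : Set M) ⊆ φ.source) (i : Fin n) : CkFun k n W →ₗ[ℝ] CkFun k n W where
  toFun f := ofLoc hφ hW (fun v => fderiv ℝ (loc φ f) v (EuclideanSpace.single i 1))
    (((contDiffOn_loc hφ f).fderiv_of_isOpen (isOpen_chartImage φ W)
      (add_one_le_of_eq hk)).clm_apply contDiffOn_const)
  map_add' f g := by
    ext z
    have hz := mem_chartImage hW z.2
    have h : loc φ (f + g) =ᶠ[𝓝 (φ z.1)] loc φ f + loc φ g := by
      filter_upwards [(isOpen_chartImage φ W).mem_nhds hz] with v hv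
      simp [loc_of_mem _ hv]
    change fderiv ℝ (loc φ (f + g)) (φ z.1) _ =
      fderiv ℝ (loc φ f) (φ z.1) _ + fderiv ℝ (loc φ g) (φ z.1) _
    rw [h.fderiv_eq, fderiv_add (differentiableAt_loc hk hφ f hz)
      (differentiableAt_loc hk hφ g hz)]
    rfl
  map_smul' c f := by
    ext z
    have hz := mem_chartImage hW z.2
    have h : loc φ (c • f) =ᶠ[𝓝 (φ z.1)] c • loc φ f := by
      filter_upwards [(isOpen_chartImage φ W).mem_nhds hz] with v hv
      simp [loc_of_mem _ hv]
    change fderiv ℝ (loc φ (c • f)) (φ z.1) _ = c • fderiv ℝ (loc φ f) (φ z.1) _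
    rw [h.fderiv_eq, fderiv_const_smul (differentiableAt_loc hk hφ f hz)]
    rfl

theorem pd_apply {W : Opens M} (hW : (W : Set M) ⊆ φ.source) (i : Fin n) (f : CkFun k n W)
    (z : W) : pd hk hφ hW i f z = fderiv ℝ (loc φ f) (φ z.1) (EuclideanSpace.single i 1) := rfl

theorem pd_mul {W : Opens M} (hW : (W : Set M) ⊆ φ.source) (i : Fin n) (f g : CkFun k n W) :
    pd hk hφ hW i (f * g) = pd hk hφ hW i f * g + f * pd hk hφ hW i g := by
  ext z
  have hz := mem_chartImage hW z.2
  have h : loc φ (f * g) =ᶠ[𝓝 (φ z.1)] loc φ f * loc φ g := by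
    filter_upwards [(isOpen_chartImage φ W).mem_nhds hz] with v hv
    simp [loc_of_mem _ hv]
  change fderiv ℝ (loc φ (f * g)) (φ z.1) _ = fderiv ℝ (loc φ f) (φ z.1) _ * g z +
    f z * fderiv ℝ (loc φ g) (φ z.1) _
  rw [h.fderiv_eq, fderiv_mul (differentiableAt_loc hk hφ f hz)
    (differentiableAt_loc hk hφ g hz), ← loc_apply hW f z, ← loc_apply hW g z]
  simp only [_root_.add_apply, _root_.smul_apply, smul_eq_mul]
  ring

theorem pd_res {V W : Opens M} (hW : (W : Set M) ⊆ φ.source) (h : V ≤ W) (i : Fin n)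
    (f : CkFun k n W) : pd hk hφ (subset_trans h hW) i (CkFun.res h f) =
      CkFun.res h (pd hk hφ hW i f) := by
  ext z
  have hz := mem_chartImage (subset_trans h hW) z.2
  have h : loc φ (CkFun.res h f) =ᶠ[𝓝 (φ z.1)] loc φ f := by
    filter_upwards [(isOpen_chartImage φ V).mem_nhds hz] with v hv
    rw [loc_of_mem _ hv, loc_of_mem _ ⟨hv.1, h hv.2⟩]
    rfl
  rw [res_apply, pd_apply, pd_apply, h.fderiv_eq]

/-- The coordinate functions of a chart. -/
def coord {W : Opens M} (hW : (W : Set M) ⊆ φ.source) (i : Fin n) : CkFun k n W :=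
  ofLoc hφ hW (fun v => v i) (by fun_prop)

theorem coord_res {V W : Opens M} (hW : (W : Set M) ⊆ φ.source) (h : V ≤ W) (i : Fin n) :
    CkFun.res h (coord hφ hW i) = coord hφ (subset_trans h hW) i := rfl

theorem pd_coord {W : Opens M} (hW : (W : Set M) ⊆ φ.source) (i j : Fin n) :
    pd hk hφ hW i (coord hφ hW j) = algebraMap ℝ _ (if i = j then 1 else 0) := by
  ext z
  have hz := mem_chartImage hW z.2
  have h : loc φ (coord hφ hW j) =ᶠ[𝓝 (φ z.1)] fun v => EuclideanSpace.proj (𝕜 := ℝ) j v := by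
    filter_upwards [(isOpen_chartImage φ W).mem_nhds hz] with v hv
    exact loc_ofLoc hφ hW _ _ hv
  rw [pd_apply, h.fderiv_eq, ContinuousLinearMap.fderiv]
  change (EuclideanSpace.single i (1 : ℝ)) j = if i = j then (1 : ℝ) else 0
  simp [eq_comm]

/-- The preimage of a ball in a chart. -/
def chartBall (φ : OpenPartialHomeomorph M (EuclideanSpace ℝ (Fin n)))
    (a : EuclideanSpace ℝ (Fin n)) (ε : ℝ) : Opens M :=
  ⟨φ.source ∩ φ ⁻¹' Metric.ball a ε, φ.isOpen_inter_preimage Metric.isOpen_ball⟩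

theorem chartBall_subset (a : EuclideanSpace ℝ (Fin n)) (ε : ℝ) :
    (chartBall φ a ε : Set M) ⊆ φ.source := inter_subset_left

theorem mem_chartBall {y : M} (hy : y ∈ φ.source) {ε : ℝ} (hε : 0 < ε) :
    y ∈ chartBall φ (φ y) ε := ⟨hy, Metric.mem_ball_self hε⟩

theorem chartImage_chartBall_subset (a : EuclideanSpace ℝ (Fin n)) (ε : ℝ) :
    chartImage φ (chartBall φ a ε) ⊆ Metric.ball a ε := by
  rintro v ⟨hv, hv'⟩
  have := hv'.2
  rwa [mem_preimage, φ.right_inv hv] at this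

/-- Around each point of an open set in the domain of a chart there are balls of this chart. -/
theorem exists_ball_subset {W : Opens M} (hW : (W : Set M) ⊆ φ.source) {y : M} (hy : y ∈ W) :
    ∃ ρ, 0 < ρ ∧ Metric.ball (φ y) ρ ⊆ chartImage φ W ∧ chartBall φ (φ y) ρ ≤ W := by
  obtain ⟨ρ, hρ, hb⟩ := Metric.isOpen_iff.1 (isOpen_chartImage φ W) _ (mem_chartImage hW hy)
  refine ⟨ρ, hρ, hb, fun z hz => ?_⟩
  have := (hb hz.2).2
  rwa [mem_preimage, φ.left_inv hz.1] at this

/-- Hadamard's lemma on a manifold. -/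
theorem exists_hadamard_chart (hk : k = ∞ ∨ k = ω)
    (hφ : φ ∈ IsManifold.maximalAtlas (𝓡 n) k M) {W : Opens M} (hW : (W : Set M) ⊆ φ.source) {y : M} (hy : y ∈ W)
    (f : CkFun k n W) : ∃ (V : Opens M) (h : V ≤ W), y ∈ V ∧ ∃ g : Fin n → CkFun k n V,
      CkFun.res h f = algebraMap ℝ _ (f ⟨y, hy⟩) +
        ∑ i, (coord hφ (subset_trans h hW) i - algebraMap ℝ _ (φ y i)) * g i := by
  obtain ⟨ρ, hρ, hb, hbW⟩ := exists_ball_subset hW hy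
  obtain ⟨ε, hε, hερ, g, hg, hfg⟩ := exists_hadamard hk hρ ((contDiffOn_loc hφ f).mono hb)
  have hV : chartBall φ (φ y) ε ≤ W := by
    refine le_trans (fun z hz => ?_) hbW
    exact ⟨hz.1, Metric.ball_subset_ball hερ hz.2⟩
  refine ⟨chartBall φ (φ y) ε, hV, mem_chartBall (hW hy) hε, fun i =>
    ofLoc hφ (chartBall_subset _ _) (g i) ((hg i).mono (chartImage_chartBall_subset _ _)), ?_⟩
  ext z
  have h1 := hfg (φ z.1) z.2.2
  rw [loc_apply hW f ⟨z.1, hV z.2⟩, loc_apply hW f ⟨y, hy⟩] at h1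
  rw [res_apply, h1]
  change _ = f ⟨y, hy⟩ + (∑ i, _ : CkFun k n (chartBall φ (φ y) ε)) z
  congr 1
  have hsum : ∀ F : Fin n → CkFun k n (chartBall φ (φ y) ε), (∑ i, F i) z = ∑ i, F i z := by
    intro F
    exact map_sum (ContMDiffMap.evalRingHom (I := 𝓡 n) (I' := 𝓘(ℝ, ℝ)) (n := k) (R := ℝ) z) F _
  rw [hsum]
  rfl

end CkFun

end

noncomputable section

/-! ### Coordinates on a supermanifold -/

theorem superSign_zero : superSign 0 = 1 := if_pos rfl

theorem superSign_one : superSign 1 = -1 := if_neg one_ne_zero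

/-- The parity of a coordinate. -/
def coordPar {n m : ℕ} : Fin n ⊕ Fin m → ZMod 2 := Sum.elim (fun _ => 0) (fun _ => 1)

instance ModelFun.instRing {k : WithTop ℕ∞} {n m : ℕ} {M : Type u} [TopologicalSpace M]
    [ChartedSpace (EuclideanSpace ℝ (Fin n)) M] {W : Opens M} : Ring (ModelFun k n m W) :=
  Algebra.TensorProduct.instRing

instance ModelFun.instDistrib {k : WithTop ℕ∞} {n m : ℕ} {M : Type u} [TopologicalSpace M]
    [ChartedSpace (EuclideanSpace ℝ (Fin n)) M] {W : Opens M} : Distrib (ModelFun k n m W) :=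
  ModelFun.instRing.toDistrib

theorem ModelFun.smul_eq_tmul_mul {k : WithTop ℕ∞} {n m : ℕ} {M : Type u} [TopologicalSpace M]
    [ChartedSpace (EuclideanSpace ℝ (Fin n)) M] {W : Opens M} (a : CkFun k n W)
    (x : ModelFun k n m W) : a • x = (a ⊗ₜ 1 : ModelFun k n m W) * x := by
  induction x using TensorProduct.induction_on with
  | zero => exact (smul_zero a).trans (mul_zero (M₀ := ModelFun k n m W) _).symm
  | tmul b y => rw [TensorProduct.smul_tmul']; simp
  | add x y hx hy =>
    rw [smul_add, hx, hy]
    exact (mul_add (R := ModelFun k n m W) _ _ _).symm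

namespace Supermanifold

variable {k : WithTop ℕ∞} {n m : ℕ} {M : Type u} [TopologicalSpace M]
  [ChartedSpace (EuclideanSpace ℝ (Fin n)) M]

/-- A coordinate system on a supermanifold: a chart of the underlying manifold together with an
isomorphism of the structure sheaf with the local model. -/
structure SuperChart (X : Supermanifold k n m M) where
  U : Opens M
  φ : OpenPartialHomeomorph M (EuclideanSpace ℝ (Fin n))
  mem_atlas : φ ∈ IsManifold.maximalAtlas (𝓡 n) k M
  subset_source : (U : Set M) ⊆ φ.source
  smooth_or_analytic : k = ∞ ∨ k = ω
  iso : ∀ W : Opens M, W ≤ U → (X.O W ≃ₐ[ℝ] ModelFun k n m W)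
  iso_res : ∀ (V W : Opens M) (hW : W ≤ U) (h : V ≤ W) (f : X.O W),
    iso V (h.trans hW) (X.res h f) = ModelFun.res h (iso W hW f)
  iso_par : ∀ (W : Opens M) (hW : W ≤ U) (i : ZMod 2) (f : X.O W),
    f ∈ X.par W i ↔ iso W hW f ∈ (Grassmann.par m i).baseChange (CkFun k n W)
  iso_body : ∀ (W : Opens M) (hW : W ≤ U) (f : X.O W),
    X.body W f = ModelFun.body W (iso W hW f)

theorem exists_superChart [IsManifold (𝓡 n) k M] (hk : k = ∞ ∨ k = ω)
    (X : Supermanifold k n m M) (x : M) : ∃ S : X.SuperChart, x ∈ S.U := by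
  obtain ⟨U, hx, φ, h1, h2, h3⟩ := X.local_model x
  exact ⟨{ U := U ⊓ ⟨(chartAt (EuclideanSpace ℝ (Fin n)) x).source,
              (chartAt (EuclideanSpace ℝ (Fin n)) x).open_source⟩
           φ := chartAt (EuclideanSpace ℝ (Fin n)) x
           mem_atlas := IsManifold.chart_mem_maximalAtlas x
           subset_source := inter_subset_right
           smooth_or_analytic := hk
           iso := fun W hW => φ W (hW.trans inf_le_left)
           iso_res := fun V W hW h f => h1 V W (hW.trans inf_le_left) h f
           iso_par := fun W hW => h2 W (hW.trans inf_le_left)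
           iso_body := fun W hW => h3 W (hW.trans inf_le_left) },
    hx, mem_chart_source _ x⟩

namespace SuperChart

variable {X : Supermanifold k n m M} (S : X.SuperChart)

theorem subset_source_of_le {W : Opens M} (hW : W ≤ S.U) : (W : Set M) ⊆ S.φ.source :=
  subset_trans hW S.subset_source

/-- Functions on the underlying manifold as superfunctions. -/
def lift {W : Opens M} (hW : W ≤ S.U) : CkFun k n W →ₐ[ℝ] X.O W :=
  ((S.iso W hW).symm : ModelFun k n m W →ₐ[ℝ] X.O W).comp Algebra.TensorProduct.includeLeft

/-- Elements of the Grassmann algebra as superfunctions. -/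
def gr {W : Opens M} (hW : W ≤ S.U) : Grassmann m →ₐ[ℝ] X.O W :=
  ((S.iso W hW).symm : ModelFun k n m W →ₐ[ℝ] X.O W).comp Algebra.TensorProduct.includeRight

/-- The odd coordinates. -/
def xi {W : Opens M} (hW : W ≤ S.U) (a : Fin m) : X.O W := S.gr hW (Grassmann.gen a)

theorem iso_lift {W : Opens M} (hW : W ≤ S.U) (f : CkFun k n W) :
    S.iso W hW (S.lift hW f) = f ⊗ₜ 1 := by simp [lift]

theorem iso_gr {W : Opens M} (hW : W ≤ S.U) (x : Grassmann m) :
    S.iso W hW (S.gr hW x) = 1 ⊗ₜ x := by simp [gr]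

theorem iso_symm_tmul {W : Opens M} (hW : W ≤ S.U) (f : CkFun k n W) (x : Grassmann m) :
    (S.iso W hW).symm (f ⊗ₜ x) = S.lift hW f * S.gr hW x := by
  apply (S.iso W hW).injective
  rw [map_mul, iso_lift, iso_gr]
  simp

theorem res_lift {V W : Opens M} (hW : W ≤ S.U) (h : V ≤ W) (f : CkFun k n W) :
    X.res h (S.lift hW f) = S.lift (h.trans hW) (CkFun.res h f) := by
  apply (S.iso V (h.trans hW)).injective
  rw [S.iso_res V W hW h, iso_lift, iso_lift]
  simp [ModelFun.res]

theorem res_gr {V W : Opens M} (hW : W ≤ S.U) (h : V ≤ W) (x : Grassmann m) :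
    X.res h (S.gr hW x) = S.gr (h.trans hW) x := by
  apply (S.iso V (h.trans hW)).injective
  rw [S.iso_res V W hW h, iso_gr, iso_gr]
  simp [ModelFun.res]

theorem res_xi {V W : Opens M} (hW : W ≤ S.U) (h : V ≤ W) (a : Fin m) :
    X.res h (S.xi hW a) = S.xi (h.trans hW) a := S.res_gr hW h _

theorem lift_mem {W : Opens M} (hW : W ≤ S.U) (f : CkFun k n W) : S.lift hW f ∈ X.par W 0 := by
  rw [S.iso_par W hW, iso_lift]
  exact Submodule.tmul_mem_baseChange_of_mem _
    (Submodule.one_le.1 (CliffordAlgebra.one_le_evenOdd_zero _))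

theorem xi_mem {W : Opens M} (hW : W ≤ S.U) (a : Fin m) : S.xi hW a ∈ X.par W 1 := by
  rw [S.iso_par W hW, xi, iso_gr]
  exact Submodule.tmul_mem_baseChange_of_mem _ (Grassmann.gen_mem a)

theorem body_lift {W : Opens M} (hW : W ≤ S.U) (f : CkFun k n W) :
    X.body W (S.lift hW f) = f := by
  rw [S.iso_body W hW, iso_lift]
  simp [ModelFun.body]

theorem body_xi {W : Opens M} (hW : W ≤ S.U) (a : Fin m) : X.body W (S.xi hW a) = 0 := by
  rw [S.iso_body W hW, xi, iso_gr]
  simp [ModelFun.body, Grassmann.gen, ExteriorAlgebra.algebraMapInv]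

theorem prod_xi_eq_zero {W : Opens M} (hW : W ≤ S.U) (l : Fin (m + 1) → Fin m) :
    (List.ofFn fun i => S.xi hW (l i)).prod = 0 := by
  have : (List.ofFn fun i => S.xi hW (l i)) =
      (List.ofFn fun i => Grassmann.gen (l i)).map (S.gr hW) := by
    rw [List.map_ofFn]; rfl
  rw [this, ← map_list_prod, Grassmann.prod_gen_eq_zero, map_zero]

theorem induction_on {W : Opens M} (hW : W ≤ S.U) {P : X.O W → Prop} (f : X.O W)
    (hmul : ∀ (g : CkFun k n W) (x : Grassmann m), P (S.lift hW g * S.gr hW x))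
    (hadd : ∀ f g, P f → P g → P (f + g)) : P f := by
  rw [← (S.iso W hW).symm_apply_apply f]
  induction S.iso W hW f using TensorProduct.induction_on with
  | zero => simpa using hmul 0 0
  | tmul g x => rw [iso_symm_tmul]; exact hmul g x
  | add a b ha hb => rw [map_add]; exact hadd _ _ ha hb

/-- Splitting the scalar part off the Grassmann factor shows that the kernel of the projection to
functions is generated by the odd coordinates. -/
theorem exists_eq_lift_add {W : Opens M} (hW : W ≤ S.U) (f : X.O W) :
    ∃ h : Fin m → X.O W, f = S.lift hW (X.body W f) + ∑ a, S.xi hW a * h a := by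
  induction f using S.induction_on hW with
  | hmul g x =>
    obtain ⟨h, hh⟩ := Grassmann.exists_eq_add_sum_gen_mul x
    refine ⟨fun a => S.lift hW g * S.gr hW (h a), ?_⟩
    have hb : X.body W (S.lift hW g * S.gr hW x) =
        ExteriorAlgebra.algebraMapInv x • g := by
      rw [map_mul, body_lift, S.iso_body W hW, iso_gr, mul_comm]
      simp [ModelFun.body]
    rw [hb, map_smul]
    conv_lhs => rw [hh]
    rw [map_add, AlgHom.commutes, map_sum, mul_add, Finset.mul_sum]
    congr 1
    · rw [Algebra.smul_def, Algebra.commutes]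
    · refine Finset.sum_congr rfl fun a _ => ?_
      have hc := X.supercomm W 0 1 _ _ (S.lift_mem hW g) (S.xi_mem hW a)
      rw [zero_mul, superSign_zero, one_smul] at hc
      rw [map_mul, ← mul_assoc, ← mul_assoc]
      exact congrArg (· * _) hc
  | hadd f g hf hg =>
    obtain ⟨h, hh⟩ := hf
    obtain ⟨h', hh'⟩ := hg
    refine ⟨h + h', ?_⟩
    simp only [Pi.add_apply, mul_add, Finset.sum_add_distrib, map_add]
    conv_lhs => rw [hh, hh']
    abel

theorem exists_eq_sum_of_body_eq_zero {W : Opens M} (hW : W ≤ S.U) {f : X.O W}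
    (hf : X.body W f = 0) : ∃ h : Fin m → X.O W, f = ∑ a, S.xi hW a * h a := by
  obtain ⟨h, hh⟩ := S.exists_eq_lift_add hW f
  exact ⟨h, by rw [hf, map_zero, zero_add] at hh; exact hh⟩

/-- An odd element of the Grassmann algebra has no scalar part. For this reason odd coefficients
drop out of every computation in a fibre. -/
theorem body_eq_zero_of_odd {W : Opens M} (hW : W ≤ S.U) {f : X.O W} (hf : f ∈ X.par W 1) :
    X.body W f = 0 := by
  rw [S.iso_par W hW] at hf
  rw [S.iso_body W hW]
  have h0 : ∀ x ∈ Grassmann.par m 1, ExteriorAlgebra.algebraMapInv x = 0 := by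
    intro x hx
    refine CliffordAlgebra.odd_induction (0 : QuadraticForm ℝ (Fin m → ℝ))
      (P := fun x _ => ExteriorAlgebra.algebraMapInv (R := ℝ) x = 0) (fun v => ?_)
      (fun x y _ _ hx hy => ?_) (fun v w x _ hx => ?_) x hx
    · have : ExteriorAlgebra.algebraMapInv (R := ℝ) (ExteriorAlgebra.ι ℝ v) = 0 := by
        simp [ExteriorAlgebra.algebraMapInv]
      exact this
    · exact (map_add _ _ _).trans (by rw [hx, hy, add_zero])
    · exact (map_mul _ _ _).trans (by rw [hx, mul_zero])
  rw [Submodule.baseChange_eq_span] at hf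
  refine Submodule.span_induction (p := fun f _ => ModelFun.body W f = 0) ?_ ?_ ?_ ?_ hf
  · rintro _ ⟨x, hx, rfl⟩
    simp [ModelFun.body, h0 x hx]
  · simp
  · intro x y _ _ hx hy; rw [map_add, hx, hy, add_zero]
  · intro a x _ hx
    rw [ModelFun.smul_eq_tmul_mul, map_mul, hx, mul_zero]

end SuperChart

end Supermanifold

end

/-! ### Coordinate derivations and coordinate vector fields. -/

noncomputable section

namespace Supermanifold

variable {k : WithTop ℕ∞} {n m : ℕ} {M : Type u} [TopologicalSpace M]
  [ChartedSpace (EuclideanSpace ℝ (Fin n)) M]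

theorem exists_even_add_odd (X : Supermanifold k n m M) {W : Opens M} (f : X.O W) :
    ∃ f₀ ∈ X.par W 0, ∃ f₁ ∈ X.par W 1, f = f₀ + f₁ := by
  obtain ⟨f0, hf0, f1, hf1, h⟩ := Submodule.mem_sup.1
    ((X.par_isCompl W).sup_eq_top ▸ Submodule.mem_top : f ∈ X.par W 0 ⊔ X.par W 1)
  exact ⟨f0, hf0, f1, hf1, h.symm⟩

namespace SuperChart

variable {X : Supermanifold k n m M} (S : X.SuperChart)

theorem par_induction {W : Opens M} (hW : W ≤ S.U) {P : X.O W → Prop} {j : ZMod 2} {f : X.O W}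
    (hf : f ∈ X.par W j)
    (hmul : ∀ (g : CkFun k n W), ∀ x ∈ Grassmann.par m j, P (S.lift hW g * S.gr hW x))
    (hadd : ∀ f g, P f → P g → P (f + g)) : P f := by
  rw [S.iso_par W hW, Submodule.baseChange_eq_span] at hf
  -- The base change is a span over functions, while `P` is only assumed to be additive. Carrying an
  -- arbitrary function factor `a` absorbs the scalar multiplications of the span.
  have key : ∀ a : CkFun k n W, P (S.lift hW a * (S.iso W hW).symm (S.iso W hW f)) := by
    refine Submodule.span_induction
      (p := fun z _ => ∀ a : CkFun k n W, P (S.lift hW a * (S.iso W hW).symm z))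
      ?_ ?_ ?_ ?_ hf
    · rintro _ ⟨x, hx, rfl⟩ a
      rw [TensorProduct.mk_apply, iso_symm_tmul, map_one, one_mul]
      exact hmul a x hx
    · intro a
      have := hmul 0 0 (zero_mem _)
      rw [map_zero, zero_mul] at this
      rw [map_zero, mul_zero]
      exact this
    · intro x y _ _ hx hy a
      rw [map_add, mul_add]
      exact hadd _ _ (hx a) (hy a)
    · intro b x _ hx a
      rw [ModelFun.smul_eq_tmul_mul, map_mul, iso_symm_tmul, map_one, mul_one, ← mul_assoc,
        ← map_mul]
      exact hx _
  have := key 1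
  rwa [map_one, one_mul, AlgEquiv.symm_apply_apply] at this

/-- The coordinate derivations in the local model. -/
def modelOp {W : Opens M} (hW : W ≤ S.U) (c : Fin n ⊕ Fin m) :
    ModelFun k n m W →ₗ[ℝ] ModelFun k n m W :=
  Sum.elim
    (fun i => TensorProduct.map
      (CkFun.pd S.smooth_or_analytic S.mem_atlas (S.subset_source_of_le hW) i) LinearMap.id)
    (fun a => TensorProduct.map LinearMap.id (Grassmann.deriv a)) c

/-- The coordinate derivations of the algebra of superfunctions. -/
def op {W : Opens M} (hW : W ≤ S.U) (c : Fin n ⊕ Fin m) : X.O W →ₗ[ℝ] X.O W :=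
  (S.iso W hW).symm.toLinearMap ∘ₗ S.modelOp hW c ∘ₗ (S.iso W hW).toLinearMap

theorem iso_mul {W : Opens M} (hW : W ≤ S.U) (f : CkFun k n W) (x : Grassmann m) :
    S.iso W hW (S.lift hW f * S.gr hW x) = f ⊗ₜ x := by
  rw [← iso_symm_tmul, AlgEquiv.apply_symm_apply]

theorem op_inl_mul {W : Opens M} (hW : W ≤ S.U) (i : Fin n) (f : CkFun k n W) (x : Grassmann m) :
    S.op hW (Sum.inl i) (S.lift hW f * S.gr hW x) =
      S.lift hW (CkFun.pd S.smooth_or_analytic S.mem_atlas (S.subset_source_of_le hW) i f) *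
        S.gr hW x := by
  rw [op, LinearMap.comp_apply, LinearMap.comp_apply, AlgEquiv.toLinearMap_apply,
    AlgEquiv.toLinearMap_apply, iso_mul, ← iso_symm_tmul]
  rfl

theorem op_inr_mul {W : Opens M} (hW : W ≤ S.U) (a : Fin m) (f : CkFun k n W) (x : Grassmann m) :
    S.op hW (Sum.inr a) (S.lift hW f * S.gr hW x) =
      S.lift hW f * S.gr hW (Grassmann.deriv a x) := by
  rw [op, LinearMap.comp_apply, LinearMap.comp_apply, AlgEquiv.toLinearMap_apply,
    AlgEquiv.toLinearMap_apply, iso_mul, ← iso_symm_tmul]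
  rfl

theorem lift_mul_gr_comm {W : Opens M} (hW : W ≤ S.U) (f : CkFun k n W) (g : X.O W) :
    S.lift hW f * g = g * S.lift hW f := by
  obtain ⟨g₀, h0, g₁, h1, rfl⟩ := X.exists_even_add_odd g
  have c0 := X.supercomm W 0 0 _ _ (S.lift_mem hW f) h0
  have c1 := X.supercomm W 0 1 _ _ (S.lift_mem hW f) h1
  simp only [mul_zero, zero_mul, superSign_zero, one_smul] at c0 c1
  rw [mul_add, add_mul, c0, c1]

theorem gr_mem {W : Opens M} (hW : W ≤ S.U) {j : ZMod 2} {x : Grassmann m}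
    (hx : x ∈ Grassmann.par m j) : S.gr hW x ∈ X.par W j := by
  rw [S.iso_par W hW, iso_gr]
  exact Submodule.tmul_mem_baseChange_of_mem _ hx

theorem op_mul {W : Opens M} (hW : W ≤ S.U) (c : Fin n ⊕ Fin m) (j : ZMod 2) {f : X.O W}
    (hf : f ∈ X.par W j) (g : X.O W) : S.op hW c (f * g) =
      S.op hW c f * g + superSign (coordPar c * j) • (f * S.op hW c g) := by
  refine S.par_induction hW hf (P := fun f => S.op hW c (f * g) =
      S.op hW c f * g + superSign (coordPar c * j) • (f * S.op hW c g)) ?_ ?_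
  · intro f x hx
    refine S.induction_on hW (P := fun g => S.op hW c (S.lift hW f * S.gr hW x * g) =
      S.op hW c (S.lift hW f * S.gr hW x) * g + superSign (coordPar c * j) •
        (S.lift hW f * S.gr hW x * S.op hW c g)) g ?_ ?_
    · intro g y
      have e : ∀ (f g : CkFun k n W) (x y : Grassmann m),
          S.lift hW f * S.gr hW x * (S.lift hW g * S.gr hW y) =
            S.lift hW (f * g) * S.gr hW (x * y) := by
        intro f g x y
        rw [map_mul, map_mul, mul_assoc, ← mul_assoc (S.gr hW x),
          ← S.lift_mul_gr_comm hW g (S.gr hW x)]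
        noncomm_ring
      cases c with
      | inl i =>
        rw [e, op_inl_mul, op_inl_mul, op_inl_mul, e, e, CkFun.pd_mul, map_add, add_mul]
        simp [coordPar, superSign_zero]
      | inr a =>
        rw [e, op_inr_mul, op_inr_mul, op_inr_mul, e, e, Grassmann.deriv_mul a j hx, map_add,
          map_smul, mul_add, mul_smul_comm]
        rfl
    · intro g g' h h'
      rw [mul_add, map_add, h, h', map_add, mul_add, mul_add, smul_add]
      abel
  · intro f f' h h'
    rw [add_mul, map_add, h, h', map_add, add_mul, add_mul, smul_add]
    abel

theorem op_mem {W : Opens M} (hW : W ≤ S.U) (c : Fin n ⊕ Fin m) (j : ZMod 2) {f : X.O W}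
    (hf : f ∈ X.par W j) : S.op hW c f ∈ X.par W (coordPar c + j) := by
  refine S.par_induction hW hf (P := fun f => S.op hW c f ∈ X.par W (coordPar c + j)) ?_ ?_
  · intro f x hx
    cases c with
    | inl i =>
      rw [op_inl_mul]
      exact X.mul_mem W 0 j _ _ (S.lift_mem hW _) (S.gr_mem hW hx)
    | inr a =>
      rw [op_inr_mul]
      have := X.mul_mem W 0 (1 + j) _ _ (S.lift_mem hW f)
        (S.gr_mem hW (Grassmann.deriv_mem a j hx))
      rwa [zero_add] at this
  · intro f g h h'
    rw [map_add]
    exact add_mem h h'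

theorem op_res {V W : Opens M} (hW : W ≤ S.U) (h : V ≤ W) (c : Fin n ⊕ Fin m) (f : X.O W) :
    X.res h (S.op hW c f) = S.op (h.trans hW) c (X.res h f) := by
  refine S.induction_on hW (P := fun f => X.res h (S.op hW c f) =
    S.op (h.trans hW) c (X.res h f)) f ?_ ?_
  · intro f x
    cases c with
    | inl i =>
      rw [op_inl_mul, map_mul, map_mul, res_lift, res_gr, res_lift, op_inl_mul,
        ← CkFun.pd_res S.smooth_or_analytic S.mem_atlas (S.subset_source_of_le hW) h i]
    | inr a => rw [op_inr_mul, map_mul, map_mul, res_lift, res_gr, res_gr, op_inr_mul]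
  · intro f g hf hg
    rw [map_add, map_add, hf, hg, map_add, map_add]

theorem op_mem_derPar (c : Fin n ⊕ Fin m) :
    (fun W => S.op W.2 c : X.OpFam S.U) ∈ X.derPar S.U (coordPar c) :=
  ⟨fun _ _ hW h f => S.op_res hW h c f, fun _ hW j _ hf => S.op_mem hW c j hf,
    fun _ hW j _ hf g => S.op_mul hW c j hf g⟩

/-- The coordinate vector fields. -/
def D {V : Opens M} (hV : V ≤ S.U) (c : Fin n ⊕ Fin m) : X.tangent.Sec V :=
  X.tangent.res hV (⟨_, derPar_le_Der _ _ (S.op_mem_derPar c)⟩ : X.Der S.U)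

theorem lieDer_D {V : Opens M} (hV : V ≤ S.U) (c : Fin n ⊕ Fin m) (f : X.O V) :
    lieDer (S.D hV c) f = S.op hV c f := rfl

theorem D_mem {V : Opens M} (hV : V ≤ S.U) (c : Fin n ⊕ Fin m) :
    S.D hV c ∈ X.tangent.par V (coordPar c) :=
  X.tangent.par_res hV _ _ (S.op_mem_derPar c)

/-- The coordinate superfunctions. -/
def x {V : Opens M} (hV : V ≤ S.U) (c : Fin n ⊕ Fin m) : X.O V :=
  Sum.elim (fun i => S.lift hV (CkFun.coord S.mem_atlas (S.subset_source_of_le hV) i))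
    (fun a => S.xi hV a) c

theorem x_mem {V : Opens M} (hV : V ≤ S.U) (c : Fin n ⊕ Fin m) : S.x hV c ∈ X.par V (coordPar c) := by
  cases c with
  | inl i => exact S.lift_mem hV _
  | inr a => exact S.xi_mem hV a

theorem res_x {V W : Opens M} (hW : W ≤ S.U) (h : V ≤ W) (c : Fin n ⊕ Fin m) :
    X.res h (S.x hW c) = S.x (h.trans hW) c := by
  cases c with
  | inl i =>
    exact (S.res_lift hW h _).trans
      (congrArg _ (CkFun.coord_res S.mem_atlas (S.subset_source_of_le hW) h i))
  | inr a => exact S.res_xi hW h a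

theorem op_inl_lift {W : Opens M} (hW : W ≤ S.U) (i : Fin n) (f : CkFun k n W) :
    S.op hW (Sum.inl i) (S.lift hW f) = S.lift hW
      (CkFun.pd S.smooth_or_analytic S.mem_atlas (S.subset_source_of_le hW) i f) := by
  have := S.op_inl_mul hW i f 1
  rwa [map_one, mul_one, mul_one] at this

theorem op_inr_lift {W : Opens M} (hW : W ≤ S.U) (a : Fin m) (f : CkFun k n W) :
    S.op hW (Sum.inr a) (S.lift hW f) = 0 := by
  have := S.op_inr_mul hW a f 1
  rwa [map_one, mul_one, ← map_one (algebraMap ℝ (Grassmann m)), Grassmann.deriv_algebraMap,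
    map_zero, mul_zero] at this

theorem op_inr_gr {W : Opens M} (hW : W ≤ S.U) (a : Fin m) (x : Grassmann m) :
    S.op hW (Sum.inr a) (S.gr hW x) = S.gr hW (Grassmann.deriv a x) := by
  have := S.op_inr_mul hW a 1 x
  rwa [map_one, one_mul, one_mul] at this

theorem op_inl_gr {W : Opens M} (hW : W ≤ S.U) (i : Fin n) (x : Grassmann m) :
    S.op hW (Sum.inl i) (S.gr hW x) = 0 := by
  have := S.op_inl_mul hW i 1 x
  have h1 : CkFun.pd S.smooth_or_analytic S.mem_atlas (S.subset_source_of_le hW) i 1 = 0 := by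
    have h := CkFun.pd_mul S.smooth_or_analytic S.mem_atlas (S.subset_source_of_le hW) i
      (1 : CkFun k n W) 1
    rw [mul_one, mul_one, one_mul] at h
    exact left_eq_add.1 h
  rwa [h1, map_one, one_mul, map_zero, zero_mul] at this

theorem op_x {W : Opens M} (hW : W ≤ S.U) (c d : Fin n ⊕ Fin m) :
    S.op hW c (S.x hW d) = if c = d then 1 else 0 := by
  have e : ∀ (P : Prop) [Decidable P], algebraMap ℝ (X.O W) (if P then 1 else 0) =
      if P then 1 else 0 := by
    intro P _; split_ifs <;> simp
  rcases c with i | a <;> rcases d with j | b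
  · rw [x, Sum.elim_inl, op_inl_lift, CkFun.pd_coord, AlgHom.commutes, e]
    simp
  · rw [x, Sum.elim_inr, xi, op_inl_gr]
    simp
  · rw [x, Sum.elim_inl, op_inr_lift]
    simp
  · rw [x, Sum.elim_inr, xi, op_inr_gr, Grassmann.deriv_gen, AlgHom.commutes, e]
    simp

/-- A superfunction which is locally, at each point `y`, in the ideal generated by the functions
`x^i - x^i(y)`, vanishes. -/
theorem eq_zero_of_forall_exists {W : Opens M} (hW : W ≤ S.U) (f : X.O W)
    (hf : ∀ y ∈ W, ∃ (V : Opens M) (h : V ≤ W), y ∈ V ∧ ∃ g : Fin n → X.O V,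
      X.res h f = ∑ i, S.lift (h.trans hW) (CkFun.coord S.mem_atlas
        (S.subset_source_of_le (h.trans hW)) i - algebraMap ℝ _ (S.φ y i)) * g i) : f = 0 := by
  -- Coefficients are taken in a real basis of the Grassmann algebra. Multiplication by a function
  -- acts on each coefficient separately, so the hypothesis at `y` makes every coefficient function
  -- vanish at `y`.
  let b := Module.Free.chooseBasis ℝ (Grassmann m)
  let co : ∀ W : Opens M, Module.Free.ChooseBasisIndex ℝ (Grassmann m) →
      ModelFun k n m W →ₗ[ℝ] CkFun k n W := fun W I =>
    TensorProduct.lift (LinearMap.flip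
      ((LinearMap.toSpanSingleton ℝ _ (LinearMap.id : CkFun k n W →ₗ[ℝ] CkFun k n W)) ∘ₗ b.coord I))
  have hco : ∀ (W : Opens M) (I) (f : CkFun k n W) (x : Grassmann m),
      co W I (f ⊗ₜ x) = b.coord I x • f := fun W I f x => rfl
  have hmul : ∀ (W : Opens M) (I) (f : CkFun k n W) (g : ModelFun k n m W),
      co W I ((f ⊗ₜ 1) * g) = f * co W I g := by
    intro W I f g
    induction g using TensorProduct.induction_on with
    | zero => rw [mul_zero, map_zero, mul_zero]
    | tmul g x =>
      rw [Algebra.TensorProduct.tmul_mul_tmul, one_mul, hco, hco, mul_smul_comm]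
    | add x y hx hy => rw [mul_add, map_add, hx, hy, map_add, mul_add]
  have hres : ∀ (V W : Opens M) (h : V ≤ W) (I) (g : ModelFun k n m W),
      co V I (ModelFun.res h g) = CkFun.res h (co W I g) := by
    intro V W h I g
    induction g using TensorProduct.induction_on with
    | zero => simp
    | tmul g x =>
      rw [hco, map_smul, ← hco]
      rfl
    | add x y hx hy => rw [map_add, map_add, hx, hy, map_add, map_add]
  have hzero : ∀ I, co W I (S.iso W hW f) = 0 := by
    intro I
    ext y
    obtain ⟨V, h, hy, g, hg⟩ := hf y.1 y.2
    have h1 := congrArg (fun F => co V I (S.iso V (h.trans hW) F)) hg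
    simp only [S.iso_res V W hW h, hres, map_sum, map_mul, iso_lift, hmul] at h1
    have h2 := congrArg (ContMDiffMap.evalRingHom (I := 𝓡 n) (I' := 𝓘(ℝ, ℝ)) (n := k) (R := ℝ)
      (⟨y.1, hy⟩ : V)) h1
    rw [map_sum] at h2
    change co W I (S.iso W hW f) y = _ at h2
    rw [h2]
    refine (Finset.sum_eq_zero fun i _ => ?_)
    rw [map_mul]
    change (S.φ y.1 i - S.φ y.1 i) * _ = 0
    rw [sub_self, zero_mul]
  apply (S.iso W hW).injective
  rw [map_zero]
  have hrepr : ∀ (g : ModelFun k n m W) (I),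
      (Algebra.TensorProduct.basis (CkFun k n W) b).repr g I = co W I g := by
    intro g I
    induction g using TensorProduct.induction_on with
    | zero => simp
    | tmul g x =>
      rw [Algebra.TensorProduct.basis_repr_tmul, hco]
      simp [Algebra.smul_def, mul_comm]
    | add x y hx hy => rw [map_add, map_add, Finsupp.add_apply, hx, hy]
  refine (Algebra.TensorProduct.basis (CkFun k n W) b).ext_elem fun I => ?_
  rw [hrepr, hzero, hrepr, map_zero]

end SuperChart

end Supermanifold

end

noncomputable section

namespace Supermanifold

variable {k : WithTop ℕ∞} {n m : ℕ} {M : Type u} [TopologicalSpace M]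
  [ChartedSpace (EuclideanSpace ℝ (Fin n)) M] {X : Supermanifold k n m M}

/-! ### Vector fields -/

theorem lieDer_smul {V : Opens M} (f : X.O V) (Y : X.tangent.Sec V) (g : X.O V) :
    lieDer (f • Y) g = f * lieDer Y g := by
  change X.res le_rfl f * _ = _
  rw [res_self]
  rfl

theorem lieDer_add {V : Opens M} (Y Z : X.tangent.Sec V) (g : X.O V) :
    lieDer (Y + Z) g = lieDer Y g + lieDer Z g := rfl

theorem lieDer_real_smul {V : Opens M} (c : ℝ) (Y : X.tangent.Sec V) (g : X.O V) :
    lieDer (c • Y) g = c • lieDer Y g := rfl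

theorem lieDer_zero {V : Opens M} (g : X.O V) : lieDer (0 : X.tangent.Sec V) g = 0 := rfl

theorem lieDer_sum {V : Opens M} {ι : Type*} (s : Finset ι) (Y : ι → X.tangent.Sec V) (g : X.O V) :
    lieDer (∑ j ∈ s, Y j) g = ∑ j ∈ s, lieDer (Y j) g := by
  classical
  induction s using Finset.induction_on with
  | empty => simp [lieDer_zero]
  | insert a s ha ih => rw [Finset.sum_insert ha, Finset.sum_insert ha, lieDer_add, ih]

theorem exists_homogeneous_tangent {V : Opens M} (Y : X.tangent.Sec V) :
    ∃ Y₀ ∈ X.tangent.par V 0, ∃ Y₁ ∈ X.tangent.par V 1, Y = Y₀ + Y₁ := by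
  obtain ⟨f0, hf0, f1, hf1, h⟩ := Submodule.mem_sup.1
    ((X.tangent.par_isCompl V).sup_eq_top ▸ Submodule.mem_top :
      Y ∈ X.tangent.par V 0 ⊔ X.tangent.par V 1)
  exact ⟨f0, hf0, f1, hf1, h.symm⟩

theorem res_lieDer {V W : Opens M} (h : V ≤ W) (Y : X.tangent.Sec W) (f : X.O W) :
    X.res h (lieDer Y f) = lieDer (X.tangent.res h Y) (X.res h f) := by
  obtain ⟨Y₀, h0, Y₁, h1, rfl⟩ := exists_homogeneous_tangent Y
  rw [lieDer_add, map_add, map_add, lieDer_add]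
  exact congrArg₂ _ (h0.1 V W le_rfl h f) (h1.1 V W le_rfl h f)

theorem lieDer_mem {V : Opens M} {i j : ZMod 2} {Y : X.tangent.Sec V} (hY : Y ∈ X.tangent.par V i)
    {f : X.O V} (hf : f ∈ X.par V j) : lieDer Y f ∈ X.par V (i + j) :=
  hY.2.1 V le_rfl j f hf

theorem lieDer_mul {V : Opens M} {i j : ZMod 2} {Y : X.tangent.Sec V}
    (hY : Y ∈ X.tangent.par V i) {f : X.O V} (hf : f ∈ X.par V j) (g : X.O V) :
    lieDer Y (f * g) = lieDer Y f * g + superSign (i * j) • (f * lieDer Y g) :=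
  hY.2.2 V le_rfl j f hf g

theorem lieDer_mul_of_even {V : Opens M} {Y : X.tangent.Sec V} (hY : Y ∈ X.tangent.par V 0)
    (f g : X.O V) : lieDer Y (f * g) = lieDer Y f * g + f * lieDer Y g := by
  obtain ⟨f₀, h0, f₁, h1, rfl⟩ := X.exists_even_add_odd f
  have e0 := lieDer_mul hY h0 g
  have e1 := lieDer_mul hY h1 g
  rw [zero_mul, superSign_zero, one_smul] at e0 e1
  rw [add_mul, map_add, e0, e1, map_add, add_mul, add_mul]
  abel

theorem lieDer_one {V : Opens M} {i : ZMod 2} {Y : X.tangent.Sec V}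
    (hY : Y ∈ X.tangent.par V i) : lieDer Y (1 : X.O V) = 0 := by
  have := lieDer_mul hY (X.one_mem V) 1
  rw [mul_zero, superSign_zero, one_smul, mul_one, mul_one, one_mul] at this
  exact left_eq_add.1 this

theorem lieDer_algebraMap {V : Opens M} {i : ZMod 2} {Y : X.tangent.Sec V}
    (hY : Y ∈ X.tangent.par V i) (r : ℝ) : lieDer Y (algebraMap ℝ (X.O V) r) = 0 := by
  rw [Algebra.algebraMap_eq_smul_one, map_smul, lieDer_one hY, smul_zero]

theorem tangent_ext {V : Opens M} {Y Z : X.tangent.Sec V}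
    (h : ∀ (W : Opens M) (hW : W ≤ V) (f : X.O W),
      lieDer (X.tangent.res hW Y) f = lieDer (X.tangent.res hW Z) f) : Y = Z := by
  apply Subtype.ext
  funext W
  exact LinearMap.ext fun f => h W.1 W.2 f

namespace SuperChart

variable (S : X.SuperChart)

/-- A derivation that kills the coordinates kills the Grassmann factor by the Leibniz rule. For a
function, Hadamard's lemma at `y` shows that its derivative lies near `y` in the ideal of the `x^i -
x^i(y)`. This holds at every `y`, so the derivative is zero. -/
theorem eq_zero_of_lieDer_x {V : Opens M} (hV : V ≤ S.U) {i : ZMod 2} {Y : X.tangent.Sec V}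
    (hY : Y ∈ X.tangent.par V i) (h : ∀ c, lieDer Y (S.x hV c) = 0) : Y = 0 := by
  refine tangent_ext fun W hW f => ?_
  set Z := X.tangent.res hW Y with hZ
  have hZi : Z ∈ X.tangent.par W i := X.tangent.par_res hW i _ hY
  have hWU := hW.trans hV
  have hx : ∀ c, lieDer Z (S.x hWU c) = 0 := by
    intro c
    rw [← S.res_x hV hW c, ← res_lieDer, h, map_zero]
  have hlift : ∀ g : CkFun k n W, lieDer Z (S.lift hWU g) = 0 := by
    intro g
    refine S.eq_zero_of_forall_exists hWU _ fun y hy => ?_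
    obtain ⟨V', hV', hyV', G, hG⟩ := CkFun.exists_hadamard_chart S.smooth_or_analytic S.mem_atlas
      (S.subset_source_of_le hWU) hy g
    set Z' := X.tangent.res hV' Z with hZ'
    have hZi' : Z' ∈ X.tangent.par V' i := X.tangent.par_res hV' i _ hZi
    have hx' : ∀ j, lieDer Z' (S.lift (hV'.trans hWU) (CkFun.coord S.mem_atlas
        (S.subset_source_of_le (hV'.trans hWU)) j - algebraMap ℝ _ (S.φ y j))) = 0 := by
      intro j
      have h1 : lieDer Z' (S.x (hV'.trans hWU) (Sum.inl j)) = 0 := by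
        rw [← S.res_x hWU hV', ← res_lieDer, hx, map_zero]
      rw [map_sub, AlgHom.commutes, map_sub, lieDer_algebraMap hZi', sub_zero]
      exact h1
    refine ⟨V', hV', hyV', fun j => lieDer Z' (S.lift (hV'.trans hWU) (G j)), ?_⟩
    rw [res_lieDer, res_lift, hG, map_add, AlgHom.commutes, map_add, lieDer_algebraMap hZi',
      zero_add, map_sum, map_sum]
    refine Finset.sum_congr rfl fun j _ => ?_
    rw [map_mul, lieDer_mul hZi' (S.lift_mem _ _), hx', zero_mul, zero_add, mul_zero,
      superSign_zero, one_smul]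
  have hgr : ∀ x : Grassmann m, lieDer Z (S.gr hWU x) = 0 := by
    intro x
    induction x using CliffordAlgebra.left_induction with
    | algebraMap r =>
      have : S.gr hWU (algebraMap ℝ (Grassmann m) r) = algebraMap ℝ _ r := AlgHom.commutes _ _
      exact (congrArg (lieDer Z) this).trans (lieDer_algebraMap hZi r)
    | add x y hx hy =>
      exact (congrArg (lieDer Z) (map_add (S.gr hWU) x y)).trans
        ((map_add (lieDer Z) _ _).trans (by rw [hx, hy, add_zero]))
    | ι_mul x v hx' =>
      have e : (CliffordAlgebra.ι (0 : QuadraticForm ℝ (Fin m → ℝ)) v : Grassmann m) =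
          ∑ a, v a • Grassmann.gen a := by
        conv_lhs => rw [← Finset.univ_sum_single v]
        rw [map_sum]
        refine Finset.sum_congr rfl fun a _ => ?_
        have : (Pi.single a (v a) : Fin m → ℝ) = v a • Pi.single a 1 := by
          rw [← Pi.single_smul, smul_eq_mul, mul_one]
        rw [this, map_smul]
        rfl
      have e2 : S.gr hWU (CliffordAlgebra.ι (0 : QuadraticForm ℝ (Fin m → ℝ)) v * x) =
          ∑ a, v a • (S.xi hWU a * S.gr hWU x) := by
        rw [e, Finset.sum_mul, map_sum]
        refine Finset.sum_congr rfl fun a _ => ?_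
        rw [smul_mul_assoc, map_smul, map_mul]
        rfl
      refine (congrArg (lieDer Z) e2).trans ?_
      rw [map_sum]
      refine Finset.sum_eq_zero fun a _ => ?_
      have hxa : lieDer Z (S.xi hWU a) = 0 := hx (Sum.inr a)
      rw [map_smul, lieDer_mul hZi (S.xi_mem hWU a), hx', hxa, zero_mul, mul_zero, smul_zero,
        add_zero, smul_zero]
  refine S.induction_on hWU (P := fun f => lieDer Z f = 0) f ?_ ?_
  · intro g x
    rw [lieDer_mul hZi (S.lift_mem hWU g), hlift, hgr, zero_mul, mul_zero (S.lift hWU g),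
      smul_zero, add_zero]
  · intro f g hf hg
    rw [map_add, hf, hg, add_zero]

/-- The coordinate vector fields form a basis of the tangent sheaf. -/
theorem eq_sum_D {V : Opens M} (hV : V ≤ S.U) (Y : X.tangent.Sec V) :
    Y = ∑ c, lieDer Y (S.x hV c) • S.D hV c := by
  have key : ∀ i, ∀ Y ∈ X.tangent.par V i, Y = ∑ c, lieDer Y (S.x hV c) • S.D hV c := by
    intro i Y hY
    rw [← sub_eq_zero]
    refine S.eq_zero_of_lieDer_x hV (i := i) (sub_mem hY (Submodule.sum_mem _ fun c _ => ?_))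
      fun d => ?_
    · have := X.tangent.smul_mem V _ _ _ _ (lieDer_mem hY (S.x_mem hV c)) (S.D_mem hV c)
      rwa [add_assoc, CharTwo.add_self_eq_zero, add_zero] at this
    · rw [sub_eq_add_neg, lieDer_add, ← neg_one_smul ℝ, lieDer_real_smul, lieDer_sum]
      simp only [lieDer_smul, lieDer_D, op_x, mul_ite, mul_one, mul_zero]
      rw [Finset.sum_ite_eq' Finset.univ d]
      simp
  obtain ⟨Y₀, h0, Y₁, h1, rfl⟩ := exists_homogeneous_tangent Y
  have e : ∀ c, lieDer (Y₀ + Y₁) (S.x hV c) • S.D hV c =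
      lieDer Y₀ (S.x hV c) • S.D hV c + lieDer Y₁ (S.x hV c) • S.D hV c := fun c => by
    rw [lieDer_add, add_smul]
  rw [Finset.sum_congr rfl fun c _ => e c, Finset.sum_add_distrib, ← key 0 Y₀ h0, ← key 1 Y₁ h1]

/-- The coordinate vector fields as homogeneous sections. -/
def Dh {V : Opens M} (hV : V ≤ S.U) (c : Fin n ⊕ Fin m) : X.tangent.HomSec V :=
  ⟨coordPar c, S.D hV c, S.D_mem hV c⟩

/-- Coordinate fields send coordinates to constants, and constants to zero, so their bracket is a
derivation that kills the coordinates. -/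
theorem bracket_D {V : Opens M} (hV : V ≤ S.U) (c d : Fin n ⊕ Fin m) :
    (bracket (S.Dh hV c) (S.Dh hV d)).sec = 0 := by
  refine S.eq_zero_of_lieDer_x hV (bracket (S.Dh hV c) (S.Dh hV d)).mem fun e => ?_
  change S.op hV c (S.op hV d (S.x hV e)) -
    superSign (coordPar c * coordPar d) • S.op hV d (S.op hV c (S.x hV e)) = 0
  have h1 : ∀ (c : Fin n ⊕ Fin m) (P : Prop) [Decidable P],
      S.op hV c (if P then (1 : X.O V) else 0) = 0 := by
    intro c P _
    split_ifs
    · exact lieDer_one (S.D_mem hV c)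
    · exact map_zero _
  rw [op_x, op_x, h1, h1, smul_zero, sub_zero]

/-- The flat connection of a coordinate system. -/
def flat : Connection X.tangent S.U where
  nabla V hV := LinearMap.mk₂ ℝ
    (fun Y Z => ∑ c, lieDer Y (lieDer Z (S.x hV c)) • S.D hV c)
    (fun Y Y' Z => by simp only [lieDer_add, add_smul, Finset.sum_add_distrib])
    (fun r Y Z => by simp only [lieDer_real_smul, smul_assoc, Finset.smul_sum])
    (fun Y Z Z' => by simp only [lieDer_add, map_add, add_smul, Finset.sum_add_distrib])
    (fun r Y Z => by simp only [lieDer_real_smul, map_smul, smul_assoc, Finset.smul_sum])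
  nabla_res W V hV h Y Z := by
    simp only [LinearMap.mk₂_apply, map_sum]
    refine Finset.sum_congr rfl fun c _ => ?_
    refine (X.tangent.smul_res h _ _).trans ?_
    rw [res_lieDer, res_lieDer, S.res_x]
    rfl
  even V hV i j Y hY Z hZ := by
    simp only [LinearMap.mk₂_apply]
    refine Submodule.sum_mem _ fun c _ => ?_
    have := X.tangent.smul_mem V _ _ _ _ (lieDer_mem hY (lieDer_mem hZ (S.x_mem hV c)))
      (S.D_mem hV c)
    rwa [add_assoc, add_assoc, CharTwo.add_self_eq_zero, add_zero] at this
  smul_left V hV f Y Z := by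
    simp only [LinearMap.mk₂_apply, lieDer_smul, mul_smul, Finset.smul_sum]
  leibniz V hV i j Y hY f hf Z := by
    simp only [LinearMap.mk₂_apply]
    have e : ∀ c, lieDer Y (lieDer (f • Z) (S.x hV c)) • S.D hV c =
        lieDer Y f • (lieDer Z (S.x hV c) • S.D hV c) +
          superSign (i * j) • (f • (lieDer Y (lieDer Z (S.x hV c)) • S.D hV c)) := fun c => by
      rw [lieDer_smul, lieDer_mul hY hf, add_smul, mul_smul, smul_assoc, mul_smul]
    rw [Finset.sum_congr rfl fun c _ => e c, Finset.sum_add_distrib, ← Finset.smul_sum,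
      ← Finset.smul_sum, ← Finset.smul_sum, ← S.eq_sum_D hV Z]

theorem flat_D {V : Opens M} (hV : V ≤ S.U) (c d : Fin n ⊕ Fin m) :
    (S.flat.nablaHom hV (S.Dh hV c) (S.Dh hV d)).sec = 0 := by
  change ∑ e, lieDer (S.D hV c) (lieDer (S.D hV d) (S.x hV e)) • S.D hV e = 0
  refine Finset.sum_eq_zero fun e _ => ?_
  rw [lieDer_D (c := d), op_x]
  split_ifs
  · rw [lieDer_one (S.D_mem hV c), zero_smul]
  · rw [map_zero, zero_smul]

end SuperChart

end Supermanifold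

end

/-! ### Values of sections, fibres, and the bases which the fibres inherit. -/

noncomputable section

-- This and the next instance allow elements of a stalk to be represented by sections and equality
-- of germs to be tested on a neighbourhood.
open Limits in
instance forget₂_moduleCat_real_preservesFilteredColimits :
    PreservesFilteredColimits (forget₂ (ModuleCat.{u} ℝ) AddCommGrpCat.{u}) where
  preserves_filtered_colimits _ _ _ :=
  { preservesColimit := fun {F} =>
      preservesColimit_of_preserves_colimit_cocone
        (ModuleCat.FilteredColimits.colimitCoconeIsColimit.{u, 0} F)
        (AddCommGrpCat.FilteredColimits.colimitCoconeIsColimit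
          (F ⋙ forget₂ (ModuleCat.{u} ℝ) AddCommGrpCat.{u})) }

open Limits in
instance forget_moduleCat_real_preservesFilteredColimits :
    PreservesFilteredColimits (forget (ModuleCat.{u} ℝ)) :=
  Limits.comp_preservesFilteredColimits (forget₂ (ModuleCat ℝ) AddCommGrpCat)
    (forget AddCommGrpCat)

namespace Supermanifold

variable {k : WithTop ℕ∞} {n m : ℕ} {M : Type u} [TopologicalSpace M]
  [ChartedSpace (EuclideanSpace ℝ (Fin n)) M] {X : Supermanifold k n m M}

/-! ### Values of superfunctions -/

theorem val_of_mem {U : Opens M} (f : X.O U) {x : M} (hx : x ∈ U) :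
    X.val f x = X.body U f ⟨x, hx⟩ := dif_pos hx

/-- The evaluation of superfunctions at a point, as a homomorphism. -/
def valHom {U : Opens M} {x : M} (hx : x ∈ U) : X.O U →ₐ[ℝ] ℝ :=
  AlgHom.comp
    { ContMDiffMap.evalRingHom (I := 𝓡 n) (I' := 𝓘(ℝ, ℝ)) (n := k) (R := ℝ) (⟨x, hx⟩ : U) with
      commutes' := fun _ => rfl } (X.body U)

theorem val_eq {U : Opens M} (f : X.O U) {x : M} (hx : x ∈ U) : X.val f x = valHom hx f :=
  val_of_mem f hx

theorem val_res {V U : Opens M} (h : V ≤ U) (f : X.O U) {x : M} (hx : x ∈ V) :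
    X.val (X.res h f) x = X.val f x := by
  rw [val_of_mem _ hx, val_of_mem _ (h hx)]
  have := X.body_res h f
  exact congrArg (fun g : CkFun k n V => g ⟨x, hx⟩) this

theorem SuperChart.val_eq_zero_of_odd (S : X.SuperChart) {x : M} (hx : x ∈ S.U) {W : Opens M}
    {f : X.O W} (hf : f ∈ X.par W 1) : X.val f x = 0 := by
  by_cases hW : x ∈ W
  · have h1 : x ∈ W ⊓ S.U := ⟨hW, hx⟩
    have h2 : X.res inf_le_left f ∈ X.par (W ⊓ S.U) 1 := X.par_res inf_le_left 1 f hf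
    rw [← val_res inf_le_left f h1, val_of_mem _ h1, S.body_eq_zero_of_odd inf_le_right h2]
    rfl
  · exact dif_neg hW

namespace SuperModulePresheaf

variable (E : X.SuperModulePresheaf)

/-! ### Sections and fibres -/

theorem res_self {U : Opens M} (s : E.Sec U) : E.res le_rfl s = s := by
  have h : (homOfLE (le_refl U)).op = 𝟙 (op U) := rfl
  simp only [res, h, E.presheaf.map_id]
  rfl

theorem res_res {W V U : Opens M} (h' : W ≤ V) (h : V ≤ U) (s : E.Sec U) :
    E.res h' (E.res h s) = E.res (h'.trans h) s := by
  have e : (homOfLE (h'.trans h)).op = (homOfLE h).op ≫ (homOfLE h').op := rfl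
  simp only [res, e, E.presheaf.map_comp]
  rfl

theorem res_smul {V U : Opens M} (h : V ≤ U) (f : X.O U) (s : E.Sec U) :
    E.res h (f • s) = X.res h f • E.res h s := E.smul_res h f s

theorem exists_homogeneous {U : Opens M} (s : E.Sec U) :
    ∃ s₀ ∈ E.par U 0, ∃ s₁ ∈ E.par U 1, s = s₀ + s₁ := by
  obtain ⟨f0, hf0, f1, hf1, h⟩ := Submodule.mem_sup.1
    ((E.par_isCompl U).sup_eq_top ▸ Submodule.mem_top : s ∈ E.par U 0 ⊔ E.par U 1)
  exact ⟨f0, hf0, f1, hf1, h.symm⟩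

theorem ev_res {V U : Opens M} (h : V ≤ U) {x : M} (hx : x ∈ V) (s : E.Sec U) :
    E.ev x hx (E.res h s) = E.ev x (h hx) s := by
  have := TopCat.Presheaf.germ_res_apply E.presheaf (homOfLE h) x hx s
  exact congrArg (E.vanishing x).mkQ this

theorem ev_smul_of_val_eq_zero {U : Opens M} {x : M} (hx : x ∈ U) {f : X.O U}
    (hf : X.val f x = 0) (s : E.Sec U) : E.ev x hx (f • s) = 0 := by
  rw [ev, LinearMap.comp_apply, Submodule.mkQ_apply, Submodule.Quotient.mk_eq_zero]
  exact Submodule.subset_span ⟨U, hx, f, s, hf, rfl⟩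

theorem ev_smul {U : Opens M} {x : M} (hx : x ∈ U) (f : X.O U) (s : E.Sec U) :
    E.ev x hx (f • s) = X.val f x • E.ev x hx s := by
  have h0 : X.val (f - algebraMap ℝ _ (X.val f x)) x = 0 := by
    rw [val_eq _ hx, map_sub, AlgHom.commutes, ← val_eq f hx]
    exact sub_self _
  have h1 := E.ev_smul_of_val_eq_zero hx h0 s
  rwa [sub_smul, algebraMap_smul, map_sub, LinearMap.map_smul, sub_eq_zero] at h1

theorem exists_ev_eq {U : Opens M} {x : M} (hx : x ∈ U) (v : E.Fiber x) :
    ∃ (V : Opens M) (_ : V ≤ U) (hxV : x ∈ V) (s : E.Sec V), E.ev x hxV s = v := by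
  obtain ⟨g, rfl⟩ := Submodule.mkQ_surjective _ v
  obtain ⟨V, hV, s, rfl⟩ := TopCat.Presheaf.exists_germ_eq E.presheaf (x := x) g
  refine ⟨V ⊓ U, inf_le_right, ⟨hV, hx⟩, E.res inf_le_left s, ?_⟩
  rw [E.ev_res inf_le_left ⟨hV, hx⟩ s]
  rfl

variable {E} {ι : Type} [Fintype ι]

namespace IsBasis

variable {U : Opens M} {e : ι → E.Sec U}

theorem restrict (hb : E.IsBasis e) {V : Opens M} (hV : V ≤ U) : E.IsBasis fun A => E.res hV (e A) := by
  intro W h s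
  simpa only [E.res_res] using hb W (h.trans hV) s

/-- The coefficients of a section in a basis. -/
def coef (hb : E.IsBasis e) {W : Opens M} (h : W ≤ U) : E.Sec W →ₗ[X.O W] (ι → X.O W) where
  toFun s := (hb W h s).choose
  map_add' s t := by
    refine ((hb W h (s + t)).choose_spec.2 _ ?_).symm
    simp only [Pi.add_apply, add_smul, Finset.sum_add_distrib]
    rw [← (hb W h s).choose_spec.1, ← (hb W h t).choose_spec.1]
  map_smul' f s := by
    refine ((hb W h (f • s)).choose_spec.2 _ ?_).symm
    simp only [Pi.smul_apply, smul_eq_mul, mul_smul, RingHom.id_apply]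
    rw [← Finset.smul_sum, ← (hb W h s).choose_spec.1]

theorem sum_coef (hb : E.IsBasis e) {W : Opens M} (h : W ≤ U) (s : E.Sec W) :
    ∑ A, hb.coef h s A • E.res h (e A) = s := (hb W h s).choose_spec.1.symm

theorem coef_sum (hb : E.IsBasis e) {W : Opens M} (h : W ≤ U) (c : ι → X.O W) :
    hb.coef h (∑ A, c A • E.res h (e A)) = c :=
  ((hb W h _).choose_spec.2 c rfl).symm

theorem coef_basis (hb : E.IsBasis e) [DecidableEq ι] {W : Opens M} (h : W ≤ U) (A : ι) :
    hb.coef h (E.res h (e A)) = Pi.single A 1 := by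
  rw [← hb.coef_sum h (Pi.single A 1)]
  congr 1
  rw [Finset.sum_eq_single A]
  · simp
  · intro B _ hB
    simp [hB]
  · simp

theorem coef_res (hb : E.IsBasis e) {V W : Opens M} (h : W ≤ U) (h' : V ≤ W) (s : E.Sec W) (A : ι) :
    hb.coef (h'.trans h) (E.res h' s) A = X.res h' (hb.coef h s A) := by
  have : E.res h' s = ∑ A, X.res h' (hb.coef h s A) • E.res (h'.trans h) (e A) := by
    conv_lhs => rw [← hb.sum_coef h s, map_sum]
    refine Finset.sum_congr rfl fun A _ => ?_
    rw [E.res_smul, E.res_res]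
  rw [this, hb.coef_sum]

theorem ev_eq_sum (hb : E.IsBasis e) {W : Opens M} (h : W ≤ U) {x : M} (hx : x ∈ W) (s : E.Sec W) :
    E.ev x hx s = ∑ A, X.val (hb.coef h s A) x • E.ev x (h hx) (e A) := by
  conv_lhs => rw [← hb.sum_coef h s, map_sum]
  refine Finset.sum_congr rfl fun A _ => ?_
  rw [E.ev_smul, E.ev_res]

theorem span_ev (hb : E.IsBasis e) {x : M} (hx : x ∈ U) :
    Submodule.span ℝ (range fun A => E.ev x hx (e A)) = ⊤ := by
  rw [eq_top_iff]
  intro v _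
  obtain ⟨V, hV, hxV, s, rfl⟩ := E.exists_ev_eq hx v
  rw [hb.ev_eq_sum hV hxV]
  exact Submodule.sum_mem _ fun A _ => Submodule.smul_mem _ _ (Submodule.subset_span ⟨A, rfl⟩)

/-- In a basis, the span that defines the kernel of evaluation becomes the condition that all
coefficients vanish at `x`. This gives the independence of the values of the basis. -/
theorem exists_of_mem_vanishing (hb : E.IsBasis e) {x : M} (hx : x ∈ U)
    {g : E.presheaf.stalk (x : TopCat.of M)} (hg : g ∈ E.vanishing x) :
    ∃ (V : Opens M) (_ : V ≤ U) (hxV : x ∈ V) (c : ι → X.O V), (∀ A, X.val (c A) x = 0) ∧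
      g = (E.presheaf.germ V (x : TopCat.of M) hxV).hom (∑ A, c A • E.res ‹V ≤ U› (e A)) := by
  have hgr : ∀ {V W : Opens M} (h : V ≤ W) (hxV : x ∈ V) (s : E.Sec W),
      (E.presheaf.germ V (x : TopCat.of M) hxV).hom (E.res h s) =
        (E.presheaf.germ W (x : TopCat.of M) (h hxV)).hom s := fun h hxV s =>
    TopCat.Presheaf.germ_res_apply E.presheaf (homOfLE h) x hxV s
  refine Submodule.span_induction (p := fun g _ => ∃ (V : Opens M) (_ : V ≤ U) (hxV : x ∈ V)
    (c : ι → X.O V), (∀ A, X.val (c A) x = 0) ∧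
      g = (E.presheaf.germ V (x : TopCat.of M) hxV).hom (∑ A, c A • E.res ‹V ≤ U› (e A)))
    ?_ ?_ ?_ ?_ hg
  · rintro _ ⟨V, hxV, f, s, hf, rfl⟩
    have hxW : x ∈ V ⊓ U := ⟨hxV, hx⟩
    refine ⟨V ⊓ U, inf_le_right, hxW, hb.coef inf_le_right (E.res inf_le_left (f • s)),
      fun A => ?_, ?_⟩
    · rw [E.res_smul, map_smul, Pi.smul_apply, smul_eq_mul, val_eq _ hxW, map_mul, ← val_eq _ hxW,
        val_res inf_le_left f hxW, hf, zero_mul]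
    · rw [hb.sum_coef, hgr]
  · refine ⟨U, le_rfl, hx, 0, fun A => ?_, ?_⟩
    · rw [val_eq _ hx]; simp
    · simp
  · rintro _ _ _ _ ⟨V, hV, hxV, c, hc, rfl⟩ ⟨V', hV', hxV', c', hc', rfl⟩
    have hxW : x ∈ V ⊓ V' := ⟨hxV, hxV'⟩
    refine ⟨V ⊓ V', inf_le_left.trans hV, hxW,
      fun A => X.res inf_le_left (c A) + X.res inf_le_right (c' A), fun A => ?_, ?_⟩
    · rw [val_eq _ hxW, map_add, ← val_eq _ hxW, ← val_eq _ hxW, val_res inf_le_left _ hxW,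
        val_res inf_le_right _ hxW, hc, hc', add_zero]
    · rw [← hgr (inf_le_left : V ⊓ V' ≤ V) hxW, ← hgr (inf_le_right : V ⊓ V' ≤ V') hxW, ← map_add]
      congr 1
      simp only [map_sum, E.res_smul, E.res_res, add_smul, Finset.sum_add_distrib]
  · rintro r _ _ ⟨V, hV, hxV, c, hc, rfl⟩
    refine ⟨V, hV, hxV, fun A => r • c A, fun A => ?_, ?_⟩
    · rw [val_eq _ hxV, map_smul, ← val_eq _ hxV, hc, smul_zero]
    · rw [← map_smul]
      congr 1
      rw [Finset.smul_sum]
      refine Finset.sum_congr rfl fun A _ => ?_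
      rw [smul_assoc]

/-- A linear relation in the fibre identifies, near `x`, a combination with constant coefficients
and one whose coefficients vanish at `x`. Uniqueness of coefficients and evaluation at `x` make the
constants zero. -/
theorem linearIndependent_ev (hb : E.IsBasis e) {x : M} (hx : x ∈ U) :
    LinearIndependent ℝ fun A => E.ev x hx (e A) := by
  rw [Fintype.linearIndependent_iff]
  intro a ha A
  have h1 : E.ev x hx (∑ A, a A • e A) = 0 := by
    rw [map_sum]
    simpa only [map_smul] using ha
  rw [ev, LinearMap.comp_apply, Submodule.mkQ_apply, Submodule.Quotient.mk_eq_zero] at h1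
  obtain ⟨V, hV, hxV, c, hc, hg⟩ := hb.exists_of_mem_vanishing hx h1
  obtain ⟨W, hxW, iU, iV, hW⟩ := TopCat.Presheaf.germ_eq E.presheaf x hx hxV _ _ hg
  have hWU : W ≤ U := leOfHom iU
  have hWV : W ≤ V := leOfHom iV
  have e1 : E.res hWU (∑ A, a A • e A) = E.res hWV (∑ A, c A • E.res hV (e A)) := hW
  have e2 : E.res hWU (∑ A, a A • e A) =
      ∑ A, algebraMap ℝ (X.O W) (a A) • E.res hWU (e A) := by
    rw [map_sum]
    refine Finset.sum_congr rfl fun A _ => ?_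
    rw [map_smul, algebraMap_smul]
  have e3 : E.res hWV (∑ A, c A • E.res hV (e A)) =
      ∑ A, X.res hWV (c A) • E.res hWU (e A) := by
    rw [map_sum]
    refine Finset.sum_congr rfl fun A _ => ?_
    rw [E.res_smul, E.res_res]
  rw [e2, e3] at e1
  have e4 := congrFun ((hb.coef_sum hWU _).symm.trans ((congrArg (hb.coef hWU) e1).trans
    (hb.coef_sum hWU _))) A
  have e5 := congrArg (fun f => X.val f x) e4
  simp only [val_res hWV _ hxW, hc] at e5
  rw [val_eq _ hxW, AlgHom.commutes] at e5
  exact e5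

/-- The basis of the fibre given by a basis of the sheaf. -/
def fiberBasis (hb : E.IsBasis e) {x : M} (hx : x ∈ U) : Module.Basis ι ℝ (E.Fiber x) :=
  Module.Basis.mk (hb.linearIndependent_ev hx) (hb.span_ev hx).ge

theorem fiberBasis_apply (hb : E.IsBasis e) {x : M} (hx : x ∈ U) (A : ι) :
    hb.fiberBasis hx A = E.ev x hx (e A) := by simp [fiberBasis]

theorem fiberBasis_repr (hb : E.IsBasis e) {x : M} {W : Opens M} (h : W ≤ U) (hx : x ∈ W) (s : E.Sec W) (A : ι) :
    (hb.fiberBasis (h hx)).repr (E.ev x hx s) A = X.val (hb.coef h s A) x := by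
  rw [hb.ev_eq_sum h hx]
  simp only [← hb.fiberBasis_apply (h hx)]
  rw [Module.Basis.repr_sum_self]

end IsBasis

/-! ### Parity -/

variable {p q : ℕ}

namespace IsSuperBasis

variable {U : Opens M} {e : Fin p ⊕ Fin q → E.Sec U}

theorem mem_par (hb : E.IsSuperBasis e) (A : Fin p ⊕ Fin q) : e A ∈ E.par U (coordPar A) := by
  cases A with
  | inl I => exact hb.even I
  | inr J => exact hb.odd J

theorem of_mem {e : Fin p ⊕ Fin q → E.Sec U} (h : E.IsBasis e)
    (h' : ∀ A, e A ∈ E.par U (coordPar A)) : E.IsSuperBasis e :=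
  ⟨h, fun I => h' (Sum.inl I), fun J => h' (Sum.inr J)⟩

theorem restrict (hb : E.IsSuperBasis e) {V : Opens M} (hV : V ≤ U) : E.IsSuperBasis fun A => E.res hV (e A) :=
  of_mem (hb.isBasis.restrict hV) fun A => E.par_res hV _ _ (hb.mem_par A)

/-- The parts of the coefficients with the wrong parity add up to a section that is both even and
odd. It is therefore zero, and by uniqueness so are these parts. -/
theorem coef_mem (hb : E.IsSuperBasis e) {W : Opens M} (h : W ≤ U) {j : ZMod 2} {s : E.Sec W} (hs : s ∈ E.par W j)
    (A : Fin p ⊕ Fin q) : hb.isBasis.coef h s A ∈ X.par W (j + coordPar A) := by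
  set c := hb.isBasis.coef h s with hc
  have hdec : ∀ (i : ZMod 2) (f : X.O W), ∃ f₀ ∈ X.par W i, ∃ f₁ ∈ X.par W (i + 1), f = f₀ + f₁ := by
    intro i f
    obtain ⟨f₀, h0, f₁, h1, hf⟩ := X.exists_even_add_odd f
    obtain rfl | rfl := zmod_two_eq_zero_or_one i
    · exact ⟨f₀, h0, f₁, h1, hf⟩
    · exact ⟨f₁, h1, f₀, h0, by rw [hf, add_comm]⟩
  choose c₀ h0 c₁ h1 hsum using fun A => hdec (j + coordPar A) (c A)
  have hpar : ∀ A : Fin p ⊕ Fin q, E.res h (e A) ∈ E.par W (coordPar A) := fun A =>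
    E.par_res h _ _ (hb.mem_par A)
  have m0 : ∑ A, c₀ A • E.res h (e A) ∈ E.par W j := by
    refine Submodule.sum_mem _ fun A _ => ?_
    have := E.smul_mem W _ _ _ _ (h0 A) (hpar A)
    rwa [add_assoc, CharTwo.add_self_eq_zero, add_zero] at this
  have m1 : ∑ A, c₁ A • E.res h (e A) ∈ E.par W (j + 1) := by
    refine Submodule.sum_mem _ fun A _ => ?_
    have := E.smul_mem W _ _ _ _ (h1 A) (hpar A)
    rwa [add_right_comm, add_assoc j, CharTwo.add_self_eq_zero, add_zero] at this
  have hs2 : s = ∑ A, c₀ A • E.res h (e A) + ∑ A, c₁ A • E.res h (e A) := by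
    rw [← Finset.sum_add_distrib]
    conv_lhs => rw [← hb.isBasis.sum_coef h s]
    refine Finset.sum_congr rfl fun A _ => ?_
    rw [← add_smul, ← hsum]
  have m2 : ∑ A, c₁ A • E.res h (e A) ∈ E.par W j := by
    have := sub_mem hs m0
    rwa [hs2, add_sub_cancel_left] at this
  have hz : ∑ A, c₁ A • E.res h (e A) = 0 := by
    have hd := Submodule.disjoint_def.1 (E.par_isCompl W).disjoint
    obtain rfl | rfl := zmod_two_eq_zero_or_one j
    · exact hd _ m2 m1
    · exact hd _ m1 m2
  have hz2 : c₁ = 0 := by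
    rw [← hb.isBasis.coef_sum h c₁, hz, map_zero]
  rw [hsum A, hz2]
  simpa using h0 A

/-- For a homogeneous section, a coefficient at an index of the other parity is an odd
superfunction, so its value is zero. -/
theorem mem_fiberPar_iff (hb : E.IsSuperBasis e) (S : X.SuperChart) {x : M} (hxS : x ∈ S.U) (hx : x ∈ U) (j : ZMod 2)
    (v : E.Fiber x) : v ∈ E.fiberPar x j ↔
      ∀ A, coordPar A ≠ j → (hb.isBasis.fiberBasis hx).repr v A = 0 := by
  constructor
  · intro hv A hA
    let K : Submodule ℝ (E.Fiber x) :=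
      LinearMap.ker ((hb.isBasis.fiberBasis hx).coord A)
    have : E.fiberPar x j ≤ K := by
      refine iSup_le fun V => iSup_le fun hxV => ?_
      rintro _ ⟨s, hs, rfl⟩
      have hxW : x ∈ V ⊓ U := ⟨hxV, hx⟩
      rw [← E.ev_res (inf_le_left : V ⊓ U ≤ V) hxW]
      change (hb.isBasis.fiberBasis hx).repr _ A = 0
      rw [hb.isBasis.fiberBasis_repr inf_le_right hxW]
      refine S.val_eq_zero_of_odd hxS ?_
      have := hb.coef_mem (inf_le_right : V ⊓ U ≤ U)
        (E.par_res (inf_le_left : V ⊓ U ≤ V) j s hs) A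
      have h1 : j + coordPar A = 1 := by
        have : ∀ a b : ZMod 2, a ≠ b → b + a = 1 := by decide
        exact this _ _ hA
      rwa [h1] at this
    exact this hv
  · intro hv
    rw [← (hb.isBasis.fiberBasis hx).sum_repr v]
    refine Submodule.sum_mem _ fun A _ => ?_
    by_cases hA : coordPar A = j
    · refine Submodule.smul_mem _ _ ?_
      rw [hb.isBasis.fiberBasis_apply]
      refine Submodule.mem_iSup_of_mem U (Submodule.mem_iSup_of_mem hx ?_)
      exact ⟨e A, hA ▸ hb.mem_par A, rfl⟩
    · rw [hv A hA, zero_smul]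
      exact zero_mem _

end IsSuperBasis

end SuperModulePresheaf

end Supermanifold

end

noncomputable section

namespace Supermanifold

variable {k : WithTop ℕ∞} {n m : ℕ} {M : Type u} [TopologicalSpace M]
  [ChartedSpace (EuclideanSpace ℝ (Fin n)) M] {X : Supermanifold k n m M}
  {E : X.SuperModulePresheaf}

theorem SuperModulePresheaf.smul_real_smul (E : X.SuperModulePresheaf) {V : Opens M} (r : ℝ)
    (g : X.O V) (t : E.Sec V) : g • r • t = r • g • t := by
  rw [← algebraMap_smul (X.O V) r t, ← algebraMap_smul (X.O V) r (g • t), smul_smul, smul_smul,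
    Algebra.commutes]

namespace Connection

/-! ### Covariant derivatives along coordinate fields -/

variable (N : Connection E ⊤) (S : X.SuperChart)

theorem nabla_smul_of_even {V : Opens M} {Y : X.tangent.Sec V} (hY : Y ∈ X.tangent.par V 0)
    (f : X.O V) (s : E.Sec V) :
    N.nabla V le_top Y (f • s) = lieDer Y f • s + f • N.nabla V le_top Y s := by
  obtain ⟨f₀, h0, f₁, h1, rfl⟩ := X.exists_even_add_odd f
  have e0 := N.leibniz V le_top 0 0 Y hY f₀ h0 s
  have e1 := N.leibniz V le_top 0 1 Y hY f₁ h1 s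
  rw [zero_mul, superSign_zero, one_smul] at e0 e1
  rw [add_smul, map_add, e0, e1, map_add, add_smul, add_smul]
  abel

theorem nabla_sum_smul {V : Opens M} {ι : Type*} (t : Finset ι) (f : ι → X.O V)
    (Y : ι → X.tangent.Sec V) (s : E.Sec V) :
    N.nabla V le_top (∑ j ∈ t, f j • Y j) s = ∑ j ∈ t, f j • N.nabla V le_top (Y j) s := by
  rw [map_sum, LinearMap.sum_apply]
  exact Finset.sum_congr rfl fun j _ => N.smul_left V le_top (f j) (Y j) s

/-- The covariant derivative along a coordinate field. -/
def nab {V : Opens M} (hV : V ≤ S.U) (c : Fin n ⊕ Fin m) : E.Sec V →ₗ[ℝ] E.Sec V :=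
  N.nabla V le_top (S.D hV c)

theorem nabla_eq_sum_nab {V : Opens M} (hV : V ≤ S.U) (Y : X.tangent.Sec V) (s : E.Sec V) :
    N.nabla V le_top Y s = ∑ c, lieDer Y (S.x hV c) • N.nab S hV c s := by
  conv_lhs => rw [S.eq_sum_D hV Y]
  exact N.nabla_sum_smul _ _ _ s

theorem res_nab {V W : Opens M} (hW : W ≤ S.U) (h : V ≤ W) (c : Fin n ⊕ Fin m) (s : E.Sec W) :
    E.res h (N.nab S hW c s) = N.nab S (h.trans hW) c (E.res h s) :=
  N.nabla_res V W le_top h (S.D hW c) s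

theorem nab_mem {V : Opens M} (hV : V ≤ S.U) (c : Fin n ⊕ Fin m) {j : ZMod 2} {s : E.Sec V}
    (hs : s ∈ E.par V j) : N.nab S hV c s ∈ E.par V (coordPar c + j) :=
  N.even V le_top _ _ _ (S.D_mem hV c) _ hs

theorem nab_smul {V : Opens M} (hV : V ≤ S.U) (c : Fin n ⊕ Fin m) {j : ZMod 2} {f : X.O V}
    (hf : f ∈ X.par V j) (s : E.Sec V) : N.nab S hV c (f • s) =
      S.op hV c f • s + superSign (coordPar c * j) • (f • N.nab S hV c s) :=
  N.leibniz V le_top _ j _ (S.D_mem hV c) f hf s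

theorem nab_inl_smul {V : Opens M} (hV : V ≤ S.U) (i : Fin n) (f : X.O V) (s : E.Sec V) :
    N.nab S hV (Sum.inl i) (f • s) =
      S.op hV (Sum.inl i) f • s + f • N.nab S hV (Sum.inl i) s :=
  N.nabla_smul_of_even (S.D_mem hV (Sum.inl i)) f s

theorem nab_xi_smul {V : Opens M} (hV : V ≤ S.U) (c : Fin n ⊕ Fin m) (a : Fin m) (s : E.Sec V) :
    N.nab S hV c (S.xi hV a • s) =
      (if c = Sum.inr a then s else 0) + superSign (coordPar c) • (S.xi hV a • N.nab S hV c s) := by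
  rw [N.nab_smul S hV c (S.xi_mem hV a), mul_one]
  congr 1
  have := S.op_x hV c (Sum.inr a)
  change S.op hV c (S.xi hV a) = _ at this
  rw [this]
  split_ifs <;> simp

end Connection

/-! ### The Euler field -/

namespace SuperChart

variable (S : X.SuperChart)

/-- The Euler field of the odd coordinates. -/
def eulerField {V : Opens M} (hV : V ≤ S.U) : X.tangent.Sec V :=
  ∑ a, S.xi hV a • S.D hV (Sum.inr a)

theorem eulerField_mem {V : Opens M} (hV : V ≤ S.U) :
    S.eulerField hV ∈ X.tangent.par V 0 := by
  refine Submodule.sum_mem _ fun a _ => ?_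
  exact X.tangent.smul_mem V 1 1 _ _ (S.xi_mem hV a) (S.D_mem hV (Sum.inr a))

theorem lieDer_eulerField {V : Opens M} (hV : V ≤ S.U) (f : X.O V) :
    lieDer (S.eulerField hV) f = ∑ a, S.xi hV a * S.op hV (Sum.inr a) f := by
  rw [eulerField, lieDer_sum]
  exact Finset.sum_congr rfl fun a _ => lieDer_smul _ _ _

theorem lieDer_eulerField_xi {V : Opens M} (hV : V ≤ S.U) (a : Fin m) :
    lieDer (S.eulerField hV) (S.xi hV a) = S.xi hV a := by
  rw [lieDer_eulerField, Finset.sum_eq_single a]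
  · have := S.op_x hV (Sum.inr a) (Sum.inr a)
    rw [if_pos rfl] at this
    change S.op hV (Sum.inr a) (S.xi hV a) = 1 at this
    rw [this, mul_one]
  · intro b _ hb
    have := S.op_x hV (Sum.inr b) (Sum.inr a)
    rw [if_neg (by simpa using hb)] at this
    change S.op hV (Sum.inr b) (S.xi hV a) = 0 at this
    rw [this, mul_zero]
  · simp

theorem op_comm {V : Opens M} (hV : V ≤ S.U) (c d : Fin n ⊕ Fin m) (f : X.O V) :
    S.op hV c (S.op hV d f) =
      superSign (coordPar c * coordPar d) • S.op hV d (S.op hV c f) := by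
  have := congrArg (fun Z => lieDer Z f) (S.bracket_D hV c d)
  exact sub_eq_zero.1 this

end SuperChart

namespace Connection

variable (N : Connection E ⊤) (S : X.SuperChart)

/-- The covariant derivative along the Euler field. -/
def euler {V : Opens M} (hV : V ≤ S.U) : E.Sec V →ₗ[ℝ] E.Sec V :=
  N.nabla V le_top (S.eulerField hV)

theorem euler_apply {V : Opens M} (hV : V ≤ S.U) (s : E.Sec V) :
    N.euler S hV s = ∑ a, S.xi hV a • N.nab S hV (Sum.inr a) s :=
  N.nabla_sum_smul _ _ _ s

theorem euler_smul {V : Opens M} (hV : V ≤ S.U) (f : X.O V) (s : E.Sec V) :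
    N.euler S hV (f • s) = lieDer (S.eulerField hV) f • s + f • N.euler S hV s :=
  N.nabla_smul_of_even (S.eulerField_mem hV) f s

theorem euler_mem {V : Opens M} (hV : V ≤ S.U) {j : ZMod 2} {s : E.Sec V}
    (hs : s ∈ E.par V j) : N.euler S hV s ∈ E.par V j := by
  have := N.even V le_top 0 j _ (S.eulerField_mem hV) _ hs
  rwa [zero_add] at this

/-! ### Covariant derivatives of the curvature along coordinate fields -/

/-- This removes the correction terms of the covariant derivative when the auxiliary connection is
flat in the given coordinates. Only the section has to vanish; the parity recorded with it is
arbitrary. -/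
theorem covCurv_eq_zero {U : Opens M} (N' : Connection X.tangent U) {V : Opens M} (hV : V ≤ U)
    (r : ℕ) (Y : Fin r → X.tangent.HomSec V) (A B : X.tangent.HomSec V)
    (h : (∃ l, (Y l).sec = 0) ∨ A.sec = 0 ∨ B.sec = 0) : N.covCurv N' hV r Y A B = 0 := by
  have hn : ∀ Y Z : X.tangent.HomSec V, (Y.sec = 0 ∨ Z.sec = 0) →
      (N'.nablaHom hV Y Z).sec = 0 := by
    rintro Y Z (h | h)
    · change N'.nabla V hV Y.sec Z.sec = 0
      rw [h, map_zero, LinearMap.zero_apply]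
    · change N'.nabla V hV Y.sec Z.sec = 0
      rw [h, map_zero]
  induction r generalizing A B with
  | zero =>
    have hbr : (bracket A B).sec = 0 := by
      apply Subtype.ext
      rcases h with ⟨l, _⟩ | h | h
      · exact l.elim0
      · have h' : (show X.Der V from A.sec).1 = 0 := congrArg Subtype.val h
        change bracketOp A.deg B.deg (show X.Der V from A.sec).1 _ = 0
        rw [h']
        funext W
        simp [bracketOp]
      · have h' : (show X.Der V from B.sec).1 = 0 := congrArg Subtype.val h
        change bracketOp A.deg B.deg _ (show X.Der V from B.sec).1 = 0
        rw [h']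
        funext W
        simp [bracketOp]
    rw [covCurv, curvature, hbr, map_zero]
    rcases h with ⟨l, _⟩ | h | h
    · exact l.elim0
    · rw [h, map_zero]; simp
    · rw [h, map_zero]; simp
  | succ r ih =>
    have hcases : (Y 0).sec = 0 ∨ ((∃ l, (Fin.tail Y l).sec = 0) ∨ A.sec = 0 ∨ B.sec = 0) := by
      rcases h with ⟨l, hl⟩ | h
      · induction l using Fin.cases with
        | zero => exact Or.inl hl
        | succ l => exact Or.inr (Or.inl ⟨l, hl⟩)
      · exact Or.inr (Or.inr h)
    have hu : ∀ l : Fin r, N.covCurv N' hV r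
        (Function.update (Fin.tail Y) l (N'.nablaHom hV (Y 0) (Fin.tail Y l))) A B = 0 := by
      intro l
      apply ih
      rcases hcases with h | ⟨l', h⟩ | h
      · exact Or.inl ⟨l, by rw [Function.update_self]; exact hn _ _ (Or.inl h)⟩
      · refine Or.inl ⟨l', ?_⟩
        by_cases hl : l' = l
        · subst hl
          rw [Function.update_self]; exact hn _ _ (Or.inr h)
        · rw [Function.update_of_ne hl]; exact h
      · exact Or.inr h
    have hA : N.covCurv N' hV r (Fin.tail Y) (N'.nablaHom hV (Y 0) A) B = 0 := by
      apply ih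
      rcases hcases with h | h | h | h
      · exact Or.inr (Or.inl (hn _ _ (Or.inl h)))
      · exact Or.inl h
      · exact Or.inr (Or.inl (hn _ _ (Or.inr h)))
      · exact Or.inr (Or.inr h)
    have hB : N.covCurv N' hV r (Fin.tail Y) A (N'.nablaHom hV (Y 0) B) = 0 := by
      apply ih
      rcases hcases with h | h | h | h
      · exact Or.inr (Or.inr (hn _ _ (Or.inl h)))
      · exact Or.inl h
      · exact Or.inr (Or.inl h)
      · exact Or.inr (Or.inr (hn _ _ (Or.inr h)))
    rw [covCurv]
    simp only [hu, hA, hB, smul_zero, Finset.sum_const_zero, sub_zero]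
    rcases hcases with h | h
    · rw [h, map_zero]; simp
    · rw [ih _ _ _ h]; simp

/-- The covariant derivatives of the curvature along coordinate fields, with respect to the flat
connection of the chart. -/
def coordCurv {V : Opens M} (hV : V ≤ S.U) (r : ℕ) (l : Fin r → Fin n ⊕ Fin m)
    (c d : Fin n ⊕ Fin m) : E.Sec V →ₗ[ℝ] E.Sec V :=
  N.covCurv S.flat hV r (fun j => S.Dh hV (l j)) (S.Dh hV c) (S.Dh hV d)

/-- The parity of `coordCurv`. -/
def coordCurvPar {r : ℕ} (l : Fin r → Fin n ⊕ Fin m) (c d : Fin n ⊕ Fin m) : ZMod 2 :=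
  ∑ j, coordPar (l j) + coordPar c + coordPar d

theorem coordCurv_zero {V : Opens M} (hV : V ≤ S.U) (l : Fin 0 → Fin n ⊕ Fin m)
    (c d : Fin n ⊕ Fin m) (s : E.Sec V) :
    N.coordCurv S hV 0 l c d s = N.nab S hV c (N.nab S hV d s) -
      superSign (coordPar c * coordPar d) • N.nab S hV d (N.nab S hV c s) := by
  rw [coordCurv, covCurv, curvature, S.bracket_D, map_zero, sub_zero]
  rfl

/-- The flat connection annihilates the coordinate fields, so only the supercommutator with the
outermost derivative survives. -/
theorem coordCurv_succ {V : Opens M} (hV : V ≤ S.U) {r : ℕ} (l : Fin (r + 1) → Fin n ⊕ Fin m)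
    (c d : Fin n ⊕ Fin m) (s : E.Sec V) :
    N.coordCurv S hV (r + 1) l c d s = N.nab S hV (l 0) (N.coordCurv S hV r (Fin.tail l) c d s) -
      superSign (coordPar (l 0) * coordCurvPar (Fin.tail l) c d) •
        N.coordCurv S hV r (Fin.tail l) c d (N.nab S hV (l 0) s) := by
  rw [coordCurv, covCurv]
  have hu : ∀ j : Fin r, N.covCurv S.flat hV r
        (Function.update (Fin.tail fun j => S.Dh hV (l j)) j
          (S.flat.nablaHom hV (S.Dh hV (l 0)) (Fin.tail (fun j => S.Dh hV (l j)) j)))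
        (S.Dh hV c) (S.Dh hV d) = 0 := fun j =>
    N.covCurv_eq_zero _ _ _ _ _ _ (Or.inl ⟨j, by
      rw [Function.update_self]; exact S.flat_D hV (l 0) (l j.succ)⟩)
  have hA := N.covCurv_eq_zero S.flat hV r (Fin.tail fun j => S.Dh hV (l j))
    (S.flat.nablaHom hV (S.Dh hV (l 0)) (S.Dh hV c)) (S.Dh hV d)
    (Or.inr (Or.inl (S.flat_D hV (l 0) c)))
  have hB := N.covCurv_eq_zero S.flat hV r (Fin.tail fun j => S.Dh hV (l j))
    (S.Dh hV c) (S.flat.nablaHom hV (S.Dh hV (l 0)) (S.Dh hV d))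
    (Or.inr (Or.inr (S.flat_D hV (l 0) d)))
  simp only [hu, hA, hB, smul_zero, Finset.sum_const_zero, sub_zero]
  rfl

theorem nab_nab {V : Opens M} (hV : V ≤ S.U) (c d : Fin n ⊕ Fin m) (s : E.Sec V) :
    N.nab S hV c (N.nab S hV d s) = N.coordCurv S hV 0 Fin.elim0 c d s +
      superSign (coordPar c * coordPar d) • N.nab S hV d (N.nab S hV c s) := by
  rw [coordCurv_zero, sub_add_cancel]

theorem nab_coordCurv {V : Opens M} (hV : V ≤ S.U) {r : ℕ} (l : Fin r → Fin n ⊕ Fin m)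
    (b c d : Fin n ⊕ Fin m) (s : E.Sec V) :
    N.nab S hV b (N.coordCurv S hV r l c d s) = N.coordCurv S hV (r + 1) (Fin.cons b l) c d s +
      superSign (coordPar b * coordCurvPar l c d) •
        N.coordCurv S hV r l c d (N.nab S hV b s) := by
  rw [coordCurv_succ, Fin.tail_cons, Fin.cons_zero, sub_add_cancel]

theorem res_coordCurv {V W : Opens M} (hW : W ≤ S.U) (h : V ≤ W) {r : ℕ}
    (l : Fin r → Fin n ⊕ Fin m) (c d : Fin n ⊕ Fin m) (s : E.Sec W) :
    E.res h (N.coordCurv S hW r l c d s) =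
      N.coordCurv S (h.trans hW) r l c d (E.res h s) := by
  induction r generalizing s with
  | zero => simp only [coordCurv_zero, map_sub, map_smul, res_nab]
  | succ r ih => simp only [coordCurv_succ, map_sub, map_smul, res_nab, ih]

/-- Tensoriality up to sign: in a supercommutator the terms with first derivatives of `f` cancel,
and those with second derivatives cancel because coordinate derivations supercommute. -/
theorem coordCurv_smul {V : Opens M} (hV : V ≤ S.U) {r : ℕ} (l : Fin r → Fin n ⊕ Fin m)
    (c d : Fin n ⊕ Fin m) {j : ZMod 2} {f : X.O V} (hf : f ∈ X.par V j) (s : E.Sec V) :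
    N.coordCurv S hV r l c d (f • s) =
      superSign (coordCurvPar l c d * j) • (f • N.coordCurv S hV r l c d s) := by
  induction r generalizing s j f with
  | zero =>
    have ed := N.nab_smul S hV d hf s
    have ec := N.nab_smul S hV c hf s
    have hd := S.op_mem hV d j hf
    have hc := S.op_mem hV c j hf
    have e1 := N.nab_smul S hV c hd s
    have e2 := N.nab_smul S hV d hc s
    have e3 := N.nab_smul S hV c hf (N.nab S hV d s)
    have e4 := N.nab_smul S hV d hf (N.nab S hV c s)
    have q := superSign_mul_self (coordPar c * coordPar d)
    rw [coordCurv_zero, coordCurv_zero, ed, ec, map_add, map_add,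
      (N.nab S hV c).map_smul (superSign _), (N.nab S hV d).map_smul (superSign _), e1, e2, e3, e4,
      S.op_comm hV c d f, coordCurvPar]
    simp only [Finset.univ_eq_empty, Finset.sum_empty, zero_add, add_mul, mul_add, superSign_add,
      smul_sub, E.smul_real_smul, smul_add, smul_smul, smul_assoc]
    rw [mul_comm (coordPar d) (coordPar c)]
    -- With the sections named, an identity between real coefficients remains; its only non-formal
    -- input is that a sign squares to `1`.
    generalize S.op hV c f • N.nab S hV d s = u₁
    generalize S.op hV d f • N.nab S hV c s = u₂
    generalize S.op hV d (S.op hV c f) • s = u₃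
    generalize f • N.nab S hV c (N.nab S hV d s) = u₄
    generalize f • N.nab S hV d (N.nab S hV c s) = u₅
    linear_combination (norm := module) (-superSign (coordPar d * j) * q) • u₁
  | succ r ih =>
    have eb := N.nab_smul S hV (l 0) hf s
    have hb := S.op_mem hV (l 0) j hf
    have e1 := N.nab_smul S hV (l 0) hf (N.coordCurv S hV r (Fin.tail l) c d s)
    have hp : coordCurvPar l c d = coordPar (l 0) + coordCurvPar (Fin.tail l) c d := by
      rw [coordCurvPar, Fin.sum_univ_succ, coordCurvPar]
      simp only [Fin.tail, add_assoc]
    rw [coordCurv_succ, coordCurv_succ, ih _ hf, eb, (N.nab S hV (l 0)).map_smul (superSign _),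
      map_add, (N.coordCurv S hV r (Fin.tail l) c d).map_smul (superSign _), ih _ hb, ih _ hf, e1, hp]
    have q := superSign_mul_self (coordPar (l 0) * coordCurvPar (Fin.tail l) c d)
    simp only [add_mul, mul_add, superSign_add, smul_sub, E.smul_real_smul, smul_add, smul_smul]
    rw [mul_comm (coordCurvPar (Fin.tail l) c d) (coordPar (l 0))]
    generalize S.op hV (l 0) f • N.coordCurv S hV r (Fin.tail l) c d s = u₁
    generalize f • N.nab S hV (l 0) (N.coordCurv S hV r (Fin.tail l) c d s) = u₂
    generalize f • N.coordCurv S hV r (Fin.tail l) c d (N.nab S hV (l 0) s) = u₃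
    linear_combination (norm := module)
      (-superSign (coordCurvPar (Fin.tail l) c d * j) * q) • u₁

end Connection

end Supermanifold

end

/-! ### The Euler derivative, the curvature at a point, and the nilpotent filtration. -/

noncomputable section

namespace Supermanifold

variable {k : WithTop ℕ∞} {n m : ℕ} {M : Type u} [TopologicalSpace M]
  [ChartedSpace (EuclideanSpace ℝ (Fin n)) M] {X : Supermanifold k n m M}
  {E : X.SuperModulePresheaf}

namespace Connection

variable (N : Connection E ⊤) (S : X.SuperChart)

/-- This reflects `[∂/∂ξ^b, T] = ∂/∂ξ^b` for the Euler field `T`, with a curvature correction. It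
turns an equation for `∇_T t` into one for `∇_b t` whose eigenvalue is larger by one. -/
theorem nab_inr_euler {V : Opens M} (hV : V ≤ S.U) (b : Fin m) (s : E.Sec V) :
    N.nab S hV (Sum.inr b) (N.euler S hV s) = N.nab S hV (Sum.inr b) s +
      N.euler S hV (N.nab S hV (Sum.inr b) s) -
        ∑ a, S.xi hV a • N.coordCurv S hV 0 Fin.elim0 (Sum.inr b) (Sum.inr a) s := by
  have h1 : superSign (coordPar (Sum.inr b : Fin n ⊕ Fin m)) = -1 := superSign_one
  have h2 : ∀ a : Fin m, superSign (coordPar (Sum.inr b : Fin n ⊕ Fin m) *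
      coordPar (Sum.inr a : Fin n ⊕ Fin m)) = -1 := fun a => superSign_one
  have key : ∀ a, N.nab S hV (Sum.inr b) (S.xi hV a • N.nab S hV (Sum.inr a) s) =
      (if b = a then N.nab S hV (Sum.inr b) s else 0) +
        S.xi hV a • N.nab S hV (Sum.inr a) (N.nab S hV (Sum.inr b) s) -
        S.xi hV a • N.coordCurv S hV 0 Fin.elim0 (Sum.inr b) (Sum.inr a) s := by
    intro a
    rw [nab_xi_smul, N.nab_nab S hV (Sum.inr b) (Sum.inr a), h1, h2, smul_add, E.smul_real_smul]
    have : (if (Sum.inr b : Fin n ⊕ Fin m) = Sum.inr a then N.nab S hV (Sum.inr a) s else 0) =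
        if b = a then N.nab S hV (Sum.inr b) s else 0 := by
      by_cases h : b = a
      · subst h; simp
      · rw [if_neg h, if_neg (by simpa using h)]
    rw [this]
    generalize S.xi hV a • N.coordCurv S hV 0 Fin.elim0 (Sum.inr b) (Sum.inr a) s = u
    generalize S.xi hV a • N.nab S hV (Sum.inr a) (N.nab S hV (Sum.inr b) s) = v
    module
  rw [euler_apply, euler_apply, map_sum, Finset.sum_congr rfl fun a _ => key a,
    Finset.sum_sub_distrib, Finset.sum_add_distrib, Finset.sum_ite_eq, if_pos (Finset.mem_univ _)]

theorem ev_coordCurv_smul {V : Opens M} (hV : V ≤ S.U) {y : M} (hy : y ∈ V) {r : ℕ}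
    (l : Fin r → Fin n ⊕ Fin m) (c d : Fin n ⊕ Fin m) (f : X.O V) (s : E.Sec V) :
    E.ev y hy (N.coordCurv S hV r l c d (f • s)) =
      X.val f y • E.ev y hy (N.coordCurv S hV r l c d s) := by
  obtain ⟨f₀, h0, f₁, h1, rfl⟩ := X.exists_even_add_odd f
  rw [add_smul, map_add, coordCurv_smul _ _ _ _ _ _ h0, coordCurv_smul _ _ _ _ _ _ h1, mul_zero,
    superSign_zero, one_smul, map_add, LinearMap.map_smul _ (superSign _), E.ev_smul, E.ev_smul,
    S.val_eq_zero_of_odd (hV hy) h1, val_eq (f₀ + f₁) hy, map_add, ← val_eq _ hy, ← val_eq _ hy,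
    S.val_eq_zero_of_odd (hV hy) h1]
  simp

/-- By tensoriality, and because odd superfunctions have value zero, the value at `y` of the image
of a section depends linearly on the value of that section. The endomorphism can thus be prescribed
on the basis of the fibre. -/
theorem exists_isCovCurvAt {ι : Type} [Fintype ι] {U : Opens M} {e : ι → E.Sec U}
    (hb : E.IsBasis e) {y : M} (hy : y ∈ U) (hyS : y ∈ S.U) {r : ℕ}
    (l : Fin r → Fin n ⊕ Fin m) (c d : Fin n ⊕ Fin m) :
    ∃ T : Module.End ℝ (E.Fiber y), N.IsCovCurvAt S.flat y r (fun j => S.Dh le_rfl (l j))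
      (S.Dh le_rfl c) (S.Dh le_rfl d) T := by
  have hyW : y ∈ U ⊓ S.U := ⟨hy, hyS⟩
  refine ⟨(hb.fiberBasis hy).constr ℝ fun A => E.ev y hyW
    (N.coordCurv S inf_le_right r l c d (E.res inf_le_left (e A))), ?_⟩
  intro V hV hyV s
  change _ = E.ev y hyV (N.coordCurv S hV r l c d s)
  have hyV' : y ∈ V ⊓ U := ⟨hyV, hy⟩
  rw [← E.ev_res inf_le_left hyV' s, ← E.ev_res inf_le_left hyV' (N.coordCurv S hV r l c d s),
    res_coordCurv]
  generalize E.res (inf_le_left : V ⊓ U ≤ V) s = t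
  conv_lhs => rw [hb.ev_eq_sum inf_le_right hyV', map_sum]
  conv_rhs => rw [← hb.sum_coef inf_le_right t, map_sum, map_sum]
  refine Finset.sum_congr rfl fun A _ => ?_
  rw [ev_coordCurv_smul, map_smul, ← hb.fiberBasis_apply hy, Module.Basis.constr_basis]
  congr 1
  have hle : V ⊓ U ≤ U ⊓ S.U := le_inf inf_le_right (inf_le_left.trans hV)
  rw [← E.ev_res hle hyV', res_coordCurv, E.res_res]

end Connection

/-! ### The filtration by powers of the odd coordinates -/

namespace SuperChart

variable (S : X.SuperChart)

section Filtration

variable {W : Opens M} (hW : W ≤ S.U) (A : Type*) [AddCommGroup A] [Module ℝ A] [Module (X.O W) A]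
  [IsScalarTower ℝ (X.O W) A]

/-- The submodule of the sums of products of `r` odd coordinates with elements of a module. -/
def J : ℕ → Submodule ℝ A
  | 0 => ⊤
  | r + 1 => ⨆ a, (J r).map (Algebra.lsmul ℝ ℝ A (S.xi hW a))

variable {A}

theorem xi_smul_mem_J {r : ℕ} (a : Fin m) {t : A} (ht : t ∈ S.J hW A r) :
    S.xi hW a • t ∈ S.J hW A (r + 1) :=
  Submodule.mem_iSup_of_mem a ⟨t, ht, rfl⟩

theorem J_succ_le {r : ℕ} {Q : Submodule ℝ A}
    (h : ∀ a, ∀ t ∈ S.J hW A r, S.xi hW a • t ∈ Q) : S.J hW A (r + 1) ≤ Q := by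
  refine iSup_le fun a => ?_
  rintro _ ⟨t, ht, rfl⟩
  exact h a t ht

theorem smul_mem_J {r : ℕ} (f : X.O W) {t : A} (ht : t ∈ S.J hW A r) : f • t ∈ S.J hW A r := by
  induction r generalizing f t with
  | zero => trivial
  | succ r ih =>
    have : S.J hW A (r + 1) ≤ (S.J hW A (r + 1)).comap (Algebra.lsmul ℝ ℝ A f) := by
      refine S.J_succ_le hW fun a t ht => ?_
      change f • S.xi hW a • t ∈ S.J hW A (r + 1)
      obtain ⟨f₀, h0, f₁, h1, rfl⟩ := X.exists_even_add_odd f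
      rw [add_smul, smul_smul, smul_smul, X.supercomm W 0 1 _ _ h0 (S.xi_mem hW a),
        X.supercomm W 1 1 _ _ h1 (S.xi_mem hW a), smul_assoc, smul_assoc, mul_smul, mul_smul]
      exact add_mem (Submodule.smul_mem _ _ (S.xi_smul_mem_J hW a (ih f₀ ht)))
        (Submodule.smul_mem _ _ (S.xi_smul_mem_J hW a (ih f₁ ht)))
    exact this ht

theorem J_eq_bot : S.J hW A (m + 1) = ⊥ := by
  have key : ∀ r, S.J hW A r ≤ Submodule.span ℝ
      {t | ∃ (l : Fin r → Fin m) (u : A), t = (List.ofFn fun i => S.xi hW (l i)).prod • u} := by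
    intro r
    induction r with
    | zero => exact fun t _ => Submodule.subset_span ⟨Fin.elim0, t, by simp⟩
    | succ r ih =>
      refine S.J_succ_le hW fun a t ht => ?_
      have : Submodule.span ℝ {t | ∃ (l : Fin r → Fin m) (u : A),
          t = (List.ofFn fun i => S.xi hW (l i)).prod • u} ≤ (Submodule.span ℝ
          {t | ∃ (l : Fin (r + 1) → Fin m) (u : A),
            t = (List.ofFn fun i => S.xi hW (l i)).prod • u}).comap
            (Algebra.lsmul ℝ ℝ A (S.xi hW a)) := by
        rw [Submodule.span_le]
        rintro _ ⟨l, u, rfl⟩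
        refine Submodule.subset_span ⟨Fin.cons a l, u, ?_⟩
        simp [List.ofFn_succ, mul_smul]
      exact this (ih ht)
  rw [eq_bot_iff]
  refine (key (m + 1)).trans ?_
  rw [Submodule.span_le]
  rintro _ ⟨l, u, rfl⟩
  rw [S.prod_xi_eq_zero hW, zero_smul]
  exact zero_mem _

/-- `L` stands for the Euler field acting on superfunctions or on sections. Each odd coordinate
contributes `1`, so `L` is multiplication by `r` on the quotient of step `r` of the filtration by
step `r + 1`. -/
theorem sub_smul_mem_J {L : A →ₗ[ℝ] A}
    (hL : ∀ a t, L (S.xi hW a • t) = S.xi hW a • t + S.xi hW a • L t)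
    (h1 : ∀ t, L t ∈ S.J hW A 1) {r : ℕ} {t : A} (ht : t ∈ S.J hW A r) :
    L t - (r : ℝ) • t ∈ S.J hW A (r + 1) := by
  induction r generalizing t with
  | zero => simpa using h1 t
  | succ r ih =>
    have : S.J hW A (r + 1) ≤ (S.J hW A (r + 1 + 1)).comap
        (L - ((r + 1 : ℕ) : ℝ) • (LinearMap.id : A →ₗ[ℝ] A)) := by
      refine S.J_succ_le hW fun a t ht => ?_
      have e : (L - ((r + 1 : ℕ) : ℝ) • (LinearMap.id : A →ₗ[ℝ] A)) (S.xi hW a • t) =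
          S.xi hW a • (L t - (r : ℝ) • t) := by
        rw [LinearMap.sub_apply, LinearMap.smul_apply, LinearMap.id_apply, hL, smul_sub,
          smul_comm (S.xi hW a) (r : ℝ) t]
        push_cast
        generalize S.xi hW a • t = u
        generalize S.xi hW a • L t = v
        module
      rw [Submodule.mem_comap, e]
      exact S.xi_smul_mem_J hW a (ih ht)
    exact this ht

/-- On this graded piece `L` is multiplication by `r + 1`, which is invertible; hence the shift of
the index. -/
theorem mem_J_of_apply {L : A →ₗ[ℝ] A}
    (hL : ∀ a t, L (S.xi hW a • t) = S.xi hW a • t + S.xi hW a • L t)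
    (h1 : ∀ t, L t ∈ S.J hW A 1) {r : ℕ} {t : A} (ht : t ∈ S.J hW A (r + 1))
    (hLt : L t ∈ S.J hW A (r + 2)) : t ∈ S.J hW A (r + 2) := by
  have h2 := sub_mem hLt (S.sub_smul_mem_J hW hL h1 ht)
  rw [sub_sub_cancel] at h2
  have h3 := Submodule.smul_mem _ (((r + 1 : ℕ) : ℝ)⁻¹) h2
  rwa [smul_smul, inv_mul_cancel₀ (Nat.cast_ne_zero.2 (Nat.succ_ne_zero r)), one_smul] at h3

/-- Replacing `f` by `f - (r + 1)⁻¹ • L f` pushes `L f` one step further down the filtration, so `m`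
corrections suffice. They all lie in `P` and in the first step of the filtration, so for sections
neither the parity nor the values in the fibres change. -/
theorem exists_apply_eq_zero {L : A →ₗ[ℝ] A}
    (hL : ∀ a t, L (S.xi hW a • t) = S.xi hW a • t + S.xi hW a • L t)
    (h1 : ∀ t, L t ∈ S.J hW A 1) {P : Submodule ℝ A} (hP : ∀ t ∈ P, L t ∈ P) {s : A}
    (hs : s ∈ P) : ∃ f ∈ P, L f = 0 ∧ f - s ∈ S.J hW A 1 := by
  have key : ∀ r : ℕ, ∃ f ∈ P, L f ∈ S.J hW A (r + 1) ∧ f - s ∈ S.J hW A 1 := by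
    intro r
    induction r with
    | zero => exact ⟨s, hs, h1 s, by simp⟩
    | succ r ih =>
      obtain ⟨f, hf, hLf, hfs⟩ := ih
      refine ⟨f - ((r + 1 : ℕ) : ℝ)⁻¹ • L f, sub_mem hf (P.smul_mem _ (hP f hf)), ?_, ?_⟩
      · have h2 := S.sub_smul_mem_J hW hL h1 hLf
        have h3 := Submodule.smul_mem _ (-((r + 1 : ℕ) : ℝ)⁻¹) h2
        have e : -((r + 1 : ℕ) : ℝ)⁻¹ • (L (L f) - ((r + 1 : ℕ) : ℝ) • L f) =
            L (f - ((r + 1 : ℕ) : ℝ)⁻¹ • L f) := by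
          rw [map_sub, L.map_smul, smul_sub, smul_smul, neg_mul,
            inv_mul_cancel₀ (Nat.cast_ne_zero.2 (Nat.succ_ne_zero r))]
          module
        rwa [e] at h3
      · rw [sub_right_comm]
        exact sub_mem hfs (Submodule.smul_mem _ _ (h1 f))
  obtain ⟨f, hf, hLf, hfs⟩ := key m
  rw [J_eq_bot] at hLf
  exact ⟨f, hf, hLf, hfs⟩

end Filtration

variable {W : Opens M} (hW : W ≤ S.U)

theorem mem_J_one_of_body_eq_zero {f : X.O W} (hf : X.body W f = 0) : f ∈ S.J hW (X.O W) 1 := by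
  obtain ⟨h, rfl⟩ := S.exists_eq_sum_of_body_eq_zero hW hf
  exact Submodule.sum_mem _ fun a _ => S.xi_smul_mem_J hW a trivial

theorem mem_J_one_of_val_eq_zero {f : X.O W} (hf : ∀ z ∈ W, X.val f z = 0) :
    f ∈ S.J hW (X.O W) 1 := by
  refine S.mem_J_one_of_body_eq_zero hW ?_
  ext z
  rw [← val_of_mem f z.2, hf z z.2]
  rfl

theorem mul_mem_J_succ {r : ℕ} {f g : X.O W} (hf : f ∈ S.J hW (X.O W) 1)
    (hg : g ∈ S.J hW (X.O W) r) : f * g ∈ S.J hW (X.O W) (r + 1) := by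
  have : S.J hW (X.O W) 1 ≤ (S.J hW (X.O W) (r + 1)).comap (LinearMap.mulRight ℝ g) := by
    refine S.J_succ_le hW fun a t _ => ?_
    rw [Submodule.mem_comap, LinearMap.mulRight_apply, smul_mul_assoc]
    exact S.xi_smul_mem_J hW a (S.smul_mem_J hW t hg)
  exact this hf

theorem val_xi (a : Fin m) (z : M) : X.val (S.xi hW a) z = 0 := by
  by_cases hz : z ∈ W
  · rw [val_of_mem _ hz, body_xi]; rfl
  · exact dif_neg hz

theorem ev_eq_zero_of_mem_J_one {t : E.Sec W} (ht : t ∈ S.J hW (E.Sec W) 1) {z : M} (hz : z ∈ W) :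
    E.ev z hz t = 0 := by
  have : S.J hW (E.Sec W) 1 ≤ LinearMap.ker (E.ev z hz) := by
    refine S.J_succ_le hW fun a t _ => ?_
    rw [LinearMap.mem_ker, E.ev_smul, val_xi, zero_smul]
  exact this ht

/-- An even coordinate derivative leaves the factor `ξ^a` in place. Changing a section by such terms
therefore alters neither its values nor those of its even derivatives. -/
theorem ev_nab_inl_eq_zero_of_mem_J_one (N : Connection E ⊤) (i : Fin n) {t : E.Sec W}
    (ht : t ∈ S.J hW (E.Sec W) 1) {z : M} (hz : z ∈ W) :
    E.ev z hz (N.nab S hW (Sum.inl i) t) = 0 := by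
  have : S.J hW (E.Sec W) 1 ≤ LinearMap.ker (E.ev z hz ∘ₗ N.nab S hW (Sum.inl i)) := by
    refine S.J_succ_le hW fun a t _ => ?_
    rw [LinearMap.mem_ker, LinearMap.comp_apply, N.nab_xi_smul, if_neg Sum.inl_ne_inr, zero_add,
      LinearMap.map_smul, E.ev_smul, val_xi, zero_smul, smul_zero]
  exact this ht

theorem euler_mem_J_one (N : Connection E ⊤) (t : E.Sec W) :
    N.euler S hW t ∈ S.J hW (E.Sec W) 1 := by
  rw [N.euler_apply]
  exact Submodule.sum_mem _ fun a _ => S.xi_smul_mem_J hW a trivial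

theorem lieDer_eulerField_mem_J_one (f : X.O W) :
    lieDer (S.eulerField hW) f ∈ S.J hW (X.O W) 1 := by
  rw [S.lieDer_eulerField]
  exact Submodule.sum_mem _ fun a _ => S.xi_smul_mem_J hW a trivial

/-! ### Invertible matrices of superfunctions -/

theorem isUnit_of_val_ne_zero {f : CkFun k n W} (hf : ∀ z, f z ≠ 0) : IsUnit f := by
  refine IsUnit.of_mul_eq_one (⟨fun z => (f z)⁻¹, f.contMDiff.inv₀ hf⟩ : CkFun k n W) ?_
  ext z
  exact mul_inv_cancel₀ (hf z)

/-- The matrix of underlying functions is invertible. After multiplication by a lift of its inverse,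
the matrix differs from `1` by entries in the ideal of the odd coordinates, and this difference is
nilpotent. -/
theorem isUnit_matrix (S : X.SuperChart) (hW : W ≤ S.U) {ι : Type} [Fintype ι] [DecidableEq ι] (P : Matrix ι ι (X.O W))
    (hP : ∀ z ∈ W, (P.map fun f => X.val f z).det ≠ 0) : IsUnit P := by
  have hB : IsUnit (P.map (X.body W)) := by
    rw [Matrix.isUnit_iff_isUnit_det]
    refine isUnit_of_val_ne_zero fun z => ?_
    have h1 := hP z z.2
    have h2 := (ContMDiffMap.evalRingHom (I := 𝓡 n) (I' := 𝓘(ℝ, ℝ)) (n := k) (R := ℝ) z).map_det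
      (P.map (X.body W))
    change (P.map (X.body W)).det z = _ at h2
    rw [h2]
    convert h1 using 2
    ext A B
    exact (val_of_mem (P A B) z.2).symm
  obtain ⟨⟨B, C, hBC, hCB⟩, hB' : B = _⟩ := hB
  have key : ∀ Q : Matrix ι ι (X.O W), Q.map (X.body W) = 1 → IsUnit Q := by
    intro Q hQ
    have hN : ∀ A B, (1 - Q) A B ∈ S.J hW (X.O W) 1 := by
      intro A B
      refine S.mem_J_one_of_body_eq_zero hW ?_
      have h1 : X.body W (Q A B) = (1 : Matrix ι ι (CkFun k n W)) A B := congrFun (congrFun hQ A) B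
      rw [Matrix.sub_apply, map_sub, h1, Matrix.one_apply, Matrix.one_apply]
      split_ifs <;> simp
    have hpow : ∀ r A B, ((1 - Q) ^ r) A B ∈ S.J hW (X.O W) r := by
      intro r
      induction r with
      | zero => exact fun _ _ => trivial
      | succ r ih =>
        intro A B
        rw [pow_succ', Matrix.mul_apply]
        exact Submodule.sum_mem _ fun D _ => S.mul_mem_J_succ hW (hN A D) (ih D B)
    have hnil : IsNilpotent (1 - Q) := by
      refine ⟨m + 1, ?_⟩
      ext A B
      have := hpow (m + 1) A B
      rw [J_eq_bot] at this
      exact this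
    have := hnil.isUnit_one_sub
    rwa [sub_sub_cancel] at this
  have hl : (C.map (S.lift hW)).map (X.body W) = C := by
    ext1 A B
    exact S.body_lift hW (C A B)
  -- The entries need not commute, so a right and a left inverse of `P` are produced separately and
  -- then identified.
  have h1 : IsUnit (P * C.map (S.lift hW)) := by
    apply key
    rw [Matrix.map_mul, hl, ← hB', hBC]
  have h2 : IsUnit (C.map (S.lift hW) * P) := by
    apply key
    rw [Matrix.map_mul, hl, ← hB', hCB]
  obtain ⟨u, hu⟩ := h1
  obtain ⟨v, hv⟩ := h2
  refine ⟨⟨P, C.map (S.lift hW) * (u⁻¹).1, ?_, ?_⟩, rfl⟩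
  · rw [← mul_assoc, ← hu, Units.mul_inv]
  · have hr : P * (C.map (S.lift hW) * (u⁻¹).1) = 1 := by
      rw [← mul_assoc, ← hu, Units.mul_inv]
    have hl' : ((v⁻¹).1 * C.map (S.lift hW)) * P = 1 := by
      rw [mul_assoc, ← hv, Units.inv_mul]
    rw [← left_inv_eq_right_inv hl' hr, hl']

/-- A form of Nakayama's lemma: the transition matrix from a known basis is invertible because it is
invertible at every point. -/
theorem isBasis_of_linearIndependent_ev (S : X.SuperChart) (hW : W ≤ S.U) {ι : Type} [Fintype ι] {e : ι → E.Sec W}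
    (hb : E.IsBasis e) {f : ι → E.Sec W}
    (hf : ∀ z (hz : z ∈ W), LinearIndependent ℝ fun A => E.ev z hz (f A)) : E.IsBasis f := by
  classical
  let P : Matrix ι ι (X.O W) := fun A B => hb.coef le_rfl (f A) B
  have hP : IsUnit P := by
    refine S.isUnit_matrix hW P fun z hz => ?_
    have h1 := (hf z hz).map' (hb.fiberBasis hz).equivFun.toLinearMap
      (LinearEquiv.ker _)
    have h2 : (P.map fun f => X.val f z) =
        (hb.fiberBasis hz).equivFun.toLinearMap ∘ fun A => E.ev z hz (f A) := by
      funext A B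
      exact (hb.fiberBasis_repr le_rfl hz (f A) B).symm
    have h3 : IsUnit (P.map fun f => X.val f z) := by
      rw [← Matrix.linearIndependent_rows_iff_isUnit]
      change LinearIndependent ℝ (P.map fun f => X.val f z)
      rw [h2]
      exact h1
    exact ((Matrix.isUnit_iff_isUnit_det _).1 h3).ne_zero
  obtain ⟨⟨P', Q, hPQ, hQP⟩, hP' : P' = P⟩ := hP
  subst hP'
  intro V hV s
  have hfe : ∀ A, E.res hV (f A) = ∑ B, X.res hV (P A B) • E.res hV (e B) := by
    intro A
    conv_lhs => rw [← hb.sum_coef le_rfl (f A), map_sum]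
    refine Finset.sum_congr rfl fun B _ => ?_
    rw [E.res_smul, E.res_res]
  have hmul : ∀ (P Q : Matrix ι ι (X.O W)), P * Q = 1 → ∀ c : ι → X.O V,
      Matrix.vecMul (Matrix.vecMul c (P.map (X.res hV))) (Q.map (X.res hV)) = c := by
    intro P Q h c
    rw [Matrix.vecMul_vecMul, ← Matrix.map_mul, h, Matrix.map_one _ (map_zero _) (map_one _),
      Matrix.vecMul_one]
  have hsum : ∀ c : ι → X.O V, ∑ A, c A • E.res hV (f A) =
      ∑ B, Matrix.vecMul c (P.map (X.res hV)) B • E.res hV (e B) := by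
    intro c
    simp only [hfe, Finset.smul_sum, smul_smul, Matrix.vecMul, dotProduct, Finset.sum_smul,
      Matrix.map_apply]
    exact Finset.sum_comm
  refine ⟨Matrix.vecMul (hb.coef hV s) (Q.map (X.res hV)), ?_, ?_⟩
  · change s = ∑ A, _ • E.res hV (f A)
    rw [hsum, hmul Q P hQP, hb.sum_coef]
  · intro c hc
    change s = ∑ A, c A • E.res hV (f A) at hc
    rw [hc, hsum, hb.coef_sum, hmul P Q hPQ]

end SuperChart

end Supermanifold

end

/-! ### Frames that are parallel along the rays of a chart and along the Euler field. -/

noncomputable section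

theorem contDiffOn_smul_vec {F G : Type*} [NormedAddCommGroup F] [NormedSpace ℝ F]
    [NormedAddCommGroup G] [NormedSpace ℝ G] {k : WithTop ℕ∞} {s : Set F} {g : F → ℝ}
    (hg : ContDiffOn ℝ k g s) (u : G) : ContDiffOn ℝ k (fun v => g v • u) s :=
  hg.smul contDiffOn_const

open Metric in
theorem exists_radial_matrix {n : ℕ} {ι : Type} [Fintype ι] [DecidableEq ι] {k : WithTop ℕ∞}
    (hk : k = ∞ ∨ k = ω) (par : ι → ZMod 2) (g : Fin n → ι → ι → EuclideanSpace ℝ (Fin n) → ℝ)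
    (a : EuclideanSpace ℝ (Fin n)) {ρ : ℝ} (hρ : 0 < ρ)
    (hg : ∀ i B D, ContDiffOn ℝ k (g i B D) (ball a ρ))
    (hpar : ∀ i B D, par B ≠ par D → ∀ v ∈ ball a ρ, g i B D v = 0) :
    ∃ ε, 0 < ε ∧ ε ≤ ρ ∧ ∃ C : ι → ι → EuclideanSpace ℝ (Fin n) → ℝ,
      (∀ A B, ContDiffOn ℝ k (C A B) (ball a ε)) ∧
      (∀ A B, par A ≠ par B → C A B = 0) ∧
      (∀ A B, C A B a = if A = B then 1 else 0) ∧
      (∀ v ∈ ball a ε, (Matrix.of fun A B => C A B v).det ≠ 0) ∧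
      ∀ w ∈ ball (0 : EuclideanSpace ℝ (Fin n)) ε, ∀ t ∈ Icc (0 : ℝ) 1, ∀ A D,
        fderiv ℝ (C A D) (a + t • w) w +
          ∑ B, C A B (a + t • w) * ∑ i, w i * g i B D (a + t • w) = 0 := by
  have hkn : k ≠ 0 := by rcases hk with rfl | rfl <;> simp
  -- The radial equation is solved in the Banach algebra of endomorphisms of `ι → ℝ`; `en A B` reads
  -- off a matrix entry.
  let en : ι → ι → (((ι → ℝ) →L[ℝ] ι → ℝ) →L[ℝ] ℝ) := fun A B =>
    (ContinuousLinearMap.proj (R := ℝ) (φ := fun _ : ι => ℝ) A).comp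
      (ContinuousLinearMap.apply ℝ (ι → ℝ) (Pi.single B 1))
  have hen : ∀ A B (T : ((ι → ℝ) →L[ℝ] ι → ℝ)), en A B T = T (Pi.single B 1) A := fun _ _ _ => rfl
  have hmul : ∀ A D (T T' : ((ι → ℝ) →L[ℝ] ι → ℝ)), en A D (T * T') = ∑ B, en A B T * en B D T' := by
    intro A D T T'
    have h1 : T' (Pi.single D 1) = ∑ B, T' (Pi.single D 1) B • (Pi.single B (1 : ℝ) : ι → ℝ) := by
      ext B
      simp [Finset.sum_apply, Pi.single_apply]
    change T (T' (Pi.single D 1)) A = _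
    rw [h1, map_sum, Finset.sum_apply]
    refine Finset.sum_congr rfl fun B _ => ?_
    rw [map_smul, Pi.smul_apply, smul_eq_mul, mul_comm]
    rfl
  let u : Fin n → ι → ι → (EuclideanSpace ℝ (Fin n) →L[ℝ] ((ι → ℝ) →L[ℝ] ι → ℝ)) := fun i B D =>
    (EuclideanSpace.proj (𝕜 := ℝ) i).smulRight
      ((ContinuousLinearMap.proj (R := ℝ) (φ := fun _ : ι => ℝ) D).smulRight (Pi.single B (1 : ℝ)))
  let Γ : EuclideanSpace ℝ (Fin n) → EuclideanSpace ℝ (Fin n) →L[ℝ] ((ι → ℝ) →L[ℝ] ι → ℝ) := fun v =>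
    ∑ i, ∑ B, ∑ D, g i B D (a + v) • u i B D
  have hshift : ∀ {r : ℝ} {v : EuclideanSpace ℝ (Fin n)}, v ∈ ball 0 r → a + v ∈ ball a r := by
    intro r v hv
    rw [mem_ball_iff_norm] at hv ⊢
    simpa using hv
  have hΓ : ContDiffOn ℝ k Γ (ball 0 ρ) := by
    refine ContDiffOn.sum fun i _ => ?_
    refine ContDiffOn.sum fun B _ => ?_
    refine ContDiffOn.sum fun D _ => ?_
    have h1 : ContDiffOn ℝ k (fun v => g i B D (a + v)) (ball 0 ρ) :=
      (hg i B D).comp (contDiff_const.add contDiff_id).contDiffOn fun v hv => hshift hv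
    exact contDiffOn_smul_vec h1 (u i B D)
  have hu : ∀ i B' D' w B D, en B D (u i B' D' w) = if B' = B ∧ D' = D then w i else 0 := by
    intro i B' D' w B D
    change (w i • (Pi.single D (1 : ℝ) : ι → ℝ) D' • (Pi.single B' (1 : ℝ) : ι → ℝ)) B = _
    simp only [Pi.smul_apply, Pi.single_apply, smul_eq_mul, ite_and, eq_comm (a := B)]
    split_ifs <;> simp
  have hΓe : ∀ v w B D, en B D (Γ v w) = ∑ i, w i * g i B D (a + v) := by
    intro v w B D
    have h1 : Γ v w = ∑ i, ∑ B', ∑ D', g i B' D' (a + v) • u i B' D' w := by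
      simp only [Γ, sum_apply, smul_apply]
    rw [h1]
    simp only [map_sum, map_smul, hu, smul_eq_mul, ite_and, mul_ite, mul_zero]
    simp [mul_comm]
  obtain ⟨ε₁, hε₁, hε₁ρ, C₀, hC₀, hC₀0, hC₀'⟩ := exists_radial_parallel_frame hk hρ hΓ
  -- Entries between indices of different parity are replaced by zero, so that the frame becomes
  -- homogeneous. The equation survives the truncation because the coefficients `g` do not mix
  -- parities.
  let C : ι → ι → EuclideanSpace ℝ (Fin n) → ℝ := fun A B v =>
    if par A = par B then en A B (C₀ (v - a)) else 0
  have hCa : ∀ A B, C A B a = if A = B then 1 else 0 := by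
    intro A B
    have h1 : en A B 1 = if A = B then 1 else 0 := Pi.single_apply B (1 : ℝ) A
    simp only [C, sub_self, hC₀0, h1]
    split_ifs with h1 h2 h2
    · rfl
    · rfl
    · exact absurd (congrArg par h2) h1
    · rfl
  have hCs : ∀ A B, ContDiffOn ℝ k (C A B) (ball a ε₁) := by
    intro A B
    by_cases h : par A = par B
    · have h1 : ContDiffOn ℝ k (fun v => en A B (C₀ (v - a))) (ball a ε₁) := by
        refine (en A B).contDiff.comp_contDiffOn (hC₀.comp (by fun_prop) fun v hv => ?_)
        rw [mem_ball_iff_norm] at hv ⊢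
        simpa using hv
      refine h1.congr fun v _ => ?_
      simp only [C, if_pos h]
    · simp only [C, if_neg h]
      exact contDiffOn_const
  have hdet : ContinuousAt (fun v => (Matrix.of fun A B => C A B v).det) a := by
    have h1 : ∀ A B, ContinuousAt (C A B) a := fun A B =>
      (hCs A B).continuousOn.continuousAt (ball_mem_nhds a hε₁)
    simp only [Matrix.det_apply, Matrix.of_apply]
    fun_prop
  have hdeta : (Matrix.of fun A B => C A B a).det = 1 := by
    have : (Matrix.of fun A B => C A B a) = 1 := by
      ext A B
      rw [Matrix.of_apply, hCa, Matrix.one_apply]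
    rw [this, Matrix.det_one]
  obtain ⟨ε₂, hε₂, hd⟩ := Metric.eventually_nhds_iff_ball.1
    (hdet.eventually_ne (by rw [hdeta]; exact one_ne_zero : _ ≠ (0 : ℝ)))
  refine ⟨min ε₁ ε₂, lt_min hε₁ hε₂, (min_le_left _ _).trans hε₁ρ, C,
    fun A B => (hCs A B).mono (ball_subset_ball (min_le_left _ _)), fun A B h => ?_, hCa,
    fun v hv => hd v (ball_subset_ball (min_le_right _ _) hv), fun w hw t ht A D => ?_⟩
  · funext v
    exact if_neg h
  · have hw₁ := ball_subset_ball (min_le_left _ _) hw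
    have htw : t • w ∈ ball (0 : EuclideanSpace ℝ (Fin n)) ε₁ := by
      rw [mem_ball_zero_iff] at hw₁ ⊢
      rw [norm_smul, Real.norm_of_nonneg ht.1]
      exact lt_of_le_of_lt (mul_le_of_le_one_left (norm_nonneg _) ht.2) hw₁
    by_cases h : par A = par D
    · have h1 : HasFDerivAt C₀ (fderiv ℝ C₀ (t • w)) (a + t • w - a) := by
        rw [add_sub_cancel_left]
        exact ((hC₀.contDiffAt (isOpen_ball.mem_nhds htw)).differentiableAt hkn).hasFDerivAt
      have h2 := h1.comp (a + t • w) ((hasFDerivAt_id (a + t • w)).sub_const a)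
      have h3 := (en A D).hasFDerivAt.comp (a + t • w) h2
      have h4 : C A D = fun v => en A D (C₀ (v - a)) := by
        funext v
        exact if_pos h
      have h5 : fderiv ℝ (C A D) (a + t • w) w = en A D (fderiv ℝ C₀ (t • w) w) := by
        rw [h4]
        exact congrArg (fun L => L w) h3.fderiv
      rw [h5, hC₀' w hw₁ t ht]
      rw [map_neg, hmul, neg_add_eq_zero]
      refine Finset.sum_congr rfl fun B _ => ?_
      rw [hΓe]
      by_cases hBD : par B = par D
      · simp only [C, if_pos (h.trans hBD.symm), add_sub_cancel_left]
      · have : ∑ i, w i * g i B D (a + t • w) = 0 := Finset.sum_eq_zero fun i _ => by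
          rw [hpar i B D hBD _ (ball_subset_ball hε₁ρ (hshift htw)), mul_zero]
        rw [this, mul_zero, mul_zero]
    · have h4 : C A D = fun _ => 0 := by
        funext v
        exact if_neg h
      rw [h4]
      simp only [fderiv_fun_const, Pi.zero_apply, zero_apply, zero_add]
      refine Finset.sum_eq_zero fun B _ => ?_
      by_cases hBD : par B = par D
      · simp only [C, if_neg (fun hAB : par A = par B => h (hAB.trans hBD)), zero_mul]
      · refine mul_eq_zero_of_right _ (Finset.sum_eq_zero fun i _ => ?_)
        rw [hpar i B D hBD _ (ball_subset_ball hε₁ρ (hshift htw)), mul_zero]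

namespace Supermanifold

variable {k : WithTop ℕ∞} {n m : ℕ} {M : Type u} [TopologicalSpace M]
  [ChartedSpace (EuclideanSpace ℝ (Fin n)) M] {X : Supermanifold k n m M}
  {E : X.SuperModulePresheaf}

namespace SuperChart

/-! ### Lines in a chart -/

variable (S : X.SuperChart)

theorem body_op_inl {W : Opens M} (hW : W ≤ S.U) (i : Fin n) (f : X.O W) :
    X.body W (S.op hW (Sum.inl i) f) =
      CkFun.pd S.smooth_or_analytic S.mem_atlas (S.subset_source_of_le hW) i (X.body W f) := by
  refine S.induction_on hW (P := fun f => X.body W (S.op hW (Sum.inl i) f) =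
    CkFun.pd S.smooth_or_analytic S.mem_atlas (S.subset_source_of_le hW) i (X.body W f)) f ?_ ?_
  · intro g x
    have h1 : X.body W (S.gr hW x) = algebraMap ℝ _ (ExteriorAlgebra.algebraMapInv x) := by
      rw [S.iso_body W hW, iso_gr]
      simp [ModelFun.body, Algebra.algebraMap_eq_smul_one]
    rw [op_inl_mul, map_mul, map_mul, body_lift, body_lift, h1, mul_comm, ← Algebra.smul_def,
      mul_comm, ← Algebra.smul_def, map_smul]
  · intro f g hf hg
    rw [map_add, map_add, map_add, map_add, hf, hg]

theorem val_op_inl {W : Opens M} (hW : W ≤ S.U) (i : Fin n) (f : X.O W) {z : M} (hz : z ∈ W) :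
    X.val (S.op hW (Sum.inl i) f) z =
      fderiv ℝ (CkFun.loc S.φ (X.body W f)) (S.φ z) (EuclideanSpace.single i 1) := by
  rw [val_of_mem _ hz, body_op_inl, CkFun.pd_apply]

theorem sum_val_op_inl {W : Opens M} (hW : W ≤ S.U) (w : EuclideanSpace ℝ (Fin n)) (f : X.O W)
    {z : M} (hz : z ∈ W) : ∑ i, w i * X.val (S.op hW (Sum.inl i) f) z =
      fderiv ℝ (CkFun.loc S.φ (X.body W f)) (S.φ z) w := by
  have hw : w = ∑ i, w i • EuclideanSpace.single i (1 : ℝ) := by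
    ext j
    simp [Finset.sum_apply, Pi.single_apply]
  conv_rhs => rw [hw, map_sum]
  refine Finset.sum_congr rfl fun i _ => ?_
  rw [S.val_op_inl hW i f hz, map_smul, smul_eq_mul]

/-- The vector field with constant coefficients in the even coordinates. -/
def constField {V : Opens M} (hV : V ≤ S.U) (w : EuclideanSpace ℝ (Fin n)) : X.tangent.Sec V :=
  ∑ i, w i • S.D hV (Sum.inl i)

theorem constField_mem {V : Opens M} (hV : V ≤ S.U) (w : EuclideanSpace ℝ (Fin n)) :
    S.constField hV w ∈ X.tangent.par V 0 :=
  Submodule.sum_mem _ fun i _ => Submodule.smul_mem _ _ (S.D_mem hV (Sum.inl i))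

theorem isVelocity_line {V : Opens M} (hV : V ≤ S.U) (v w : EuclideanSpace ℝ (Fin n)) {a b t : ℝ}
    (ht : v + t • w ∈ S.φ.target) :
    Connection.IsVelocity (fun s => S.φ.symm (v + s • w)) a b t (S.constField hV w) := by
  intro W h hW f
  have hz : v + t • w ∈ CkFun.chartImage S.φ W := ⟨ht, hW⟩
  have h1 : HasDerivAt (fun s => CkFun.loc S.φ (X.body W f) (v + s • w))
      (fderiv ℝ (CkFun.loc S.φ (X.body W f)) (v + t • w) w) t := by
    have h2 := (CkFun.differentiableAt_loc S.smooth_or_analytic S.mem_atlas (X.body W f)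
      hz).hasFDerivAt
    have h3 : HasDerivAt (fun s : ℝ => v + s • w) w t := by
      simpa using ((hasDerivAt_id t).smul_const w).const_add v
    exact h2.comp_hasDerivAt t h3
  have h4 : (fun s => X.val f (S.φ.symm (v + s • w))) =ᶠ[𝓝 t]
      fun s => CkFun.loc S.φ (X.body W f) (v + s • w) := by
    have hc : ContinuousAt (fun s : ℝ => v + s • w) t := by fun_prop
    filter_upwards [hc.eventually ((CkFun.isOpen_chartImage S.φ W).mem_nhds hz)] with s hs
    rw [CkFun.loc_of_mem _ hs, val_of_mem]
  have h5 := (h1.congr_of_eventuallyEq h4).hasDerivWithinAt (s := Icc a b)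
  have h6 : lieDer (X.tangent.res h (S.constField hV w)) f =
      ∑ i, w i • S.op (h.trans hV) (Sum.inl i) f := by
    rw [constField, map_sum, lieDer_sum]
    exact Finset.sum_congr rfl fun i _ => rfl
  have h7 := S.sum_val_op_inl (h.trans hV) w f hW
  have h8 : X.val (lieDer (X.tangent.res h (S.constField hV w)) f) (S.φ.symm (v + t • w)) =
      fderiv ℝ (CkFun.loc S.φ (X.body W f)) (v + t • w) w := by
    rw [S.φ.right_inv ht] at h7
    rw [h6, val_eq _ hW, map_sum, ← h7]
    refine Finset.sum_congr rfl fun i _ => ?_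
    rw [map_smul, ← val_eq _ hW, smul_eq_mul]
  rw [← h8] at h5
  exact h5

end SuperChart

namespace SuperModulePresheaf

theorem IsBasis.reindex {ι κ : Type} [Fintype ι] [Fintype κ] {U : Opens M} {e : ι → E.Sec U}
    (hb : E.IsBasis e) (σ : κ ≃ ι) : E.IsBasis fun A => e (σ A) := by
  intro W h s
  obtain ⟨c, hc, hu⟩ := hb W h s
  refine ⟨fun A => c (σ A), ?_, fun c' hc' => ?_⟩
  · rw [hc]
    exact (σ.sum_comp fun A => c A • E.res h (e A)).symm
  · have := hu (fun A => c' (σ.symm A)) (by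
      change s = ∑ A, c' (σ.symm A) • E.res h (e A)
      rw [← σ.sum_comp]
      simpa using hc')
    funext A
    rw [← this]
    simp

/-- The isomorphism of the fibres at two points that preserves the coordinates in a basis. -/
def IsBasis.frameIso {ι : Type} [Fintype ι] {U : Opens M} {e : ι → E.Sec U} (hb : E.IsBasis e)
    {y z : M} (hy : y ∈ U) (hz : z ∈ U) : E.Fiber y ≃ₗ[ℝ] E.Fiber z :=
  (hb.fiberBasis hy).equiv (hb.fiberBasis hz) (Equiv.refl ι)

theorem IsBasis.repr_frameIso {ι : Type} [Fintype ι] {U : Opens M} {e : ι → E.Sec U}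
    (hb : E.IsBasis e) {y z : M} (hy : y ∈ U) (hz : z ∈ U) (v : E.Fiber y) (A : ι) :
    (hb.fiberBasis hz).repr (hb.frameIso hy hz v) A = (hb.fiberBasis hy).repr v A := by
  simp [frameIso, Module.Basis.equiv]

theorem IsBasis.frameIso_apply {ι : Type} [Fintype ι] {U : Opens M} {e : ι → E.Sec U}
    (hb : E.IsBasis e) {y z : M} (hy : y ∈ U) (hz : z ∈ U) (v : E.Fiber y) :
    hb.frameIso hy hz v = ∑ A, (hb.fiberBasis hy).repr v A • E.ev z hz (e A) := by
  rw [← (hb.fiberBasis hz).sum_repr (hb.frameIso hy hz v)]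
  refine Finset.sum_congr rfl fun A _ => ?_
  rw [hb.repr_frameIso, hb.fiberBasis_apply]

end SuperModulePresheaf

namespace Connection

variable (N : Connection E ⊤) (S : X.SuperChart)

/-- Along a segment on which the frame is parallel, the combinations with constant coordinates are
the parallel sections, so the displacement keeps coordinates. -/
theorem isTransport_line {ι : Type} [Fintype ι] {V : Opens M} (hV : V ≤ S.U) {f : ι → E.Sec V}
    (hb : E.IsBasis f) (v w : EuclideanSpace ℝ (Fin n))
    (hvw : ∀ t ∈ Icc (0 : ℝ) 1, v + t • w ∈ CkFun.chartImage S.φ V)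
    (hpar : ∀ t ∈ Icc (0 : ℝ) 1, ∀ (ht : S.φ.symm (v + t • w) ∈ V) (A : ι),
      E.ev (S.φ.symm (v + t • w)) ht (N.nabla V le_top (S.constField hV w) (f A)) = 0)
    {y z : M} (hy : y ∈ V) (hz : z ∈ V) (hvy : v = S.φ y) (hvz : v + w = S.φ z) :
    N.IsTransport y z (hb.frameIso hy hz) := by
  have hinf : (∞ : WithTop ℕ∞) ≤ k := by
    rcases S.smooth_or_analytic with h | h <;> rw [h]
    exact le_top
  let γ : ℝ → M := fun s => S.φ.symm (v + s • w)
  have h0 : γ 0 = y := by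
    simp only [γ, zero_smul, add_zero, hvy]
    exact S.φ.left_inv (S.subset_source_of_le hV hy)
  have h1 : γ 1 = z := by
    simp only [γ, one_smul, hvz]
    exact S.φ.left_inv (S.subset_source_of_le hV hz)
  have hγ : ContMDiffOn 𝓘(ℝ, ℝ) (𝓡 n) ∞ γ (Icc 0 1) := by
    have h2 := (contMDiffOn_symm_of_mem_maximalAtlas S.mem_atlas).of_le hinf
    have h3 : ContMDiffOn 𝓘(ℝ, ℝ) 𝓘(ℝ, EuclideanSpace ℝ (Fin n)) ∞ (fun s : ℝ => v + s • w)
        (Icc 0 1) := by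
      rw [contMDiffOn_iff_contDiffOn]
      fun_prop
    exact h2.comp h3 fun t ht => (hvw t ht).1
  -- The endpoints are generalized so that substitution makes the types of the fibres agree with
  -- those at `γ 0` and `γ 1`.
  have key : ∀ y z (hy : y ∈ V) (hz : z ∈ V), γ 0 = y → γ 1 = z →
      N.IsTransport y z (hb.frameIso hy hz) := by
    rintro _ _ hy hz rfl rfl
    refine IsTransport.smooth γ 0 1 one_pos hγ _ fun u => ?_
    classical
    let x := (hb.fiberBasis hy).repr u
    let s : ∀ t, E.Fiber (γ t) := fun t =>
      if ht : γ t ∈ V then ∑ A, x A • E.ev (γ t) ht (f A) else 0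
    refine ⟨s, ?_, ?_, ?_⟩
    · intro t₀ _
      let σ := (Fintype.equivFin ι).symm
      refine ⟨V, Fintype.card ι, fun A => f (σ A), fun A _ => x (σ A), hb.reindex σ, ?_⟩
      filter_upwards [self_mem_nhdsWithin] with t ht
      have htV : γ t ∈ V := (hvw t ht).2
      refine ⟨htV, ?_, 0, fun A => hasDerivWithinAt_const _ _ _, V, le_rfl, htV,
        S.constField hV w, S.constField_mem hV w, S.isVelocity_line hV v w (hvw t ht).1, ?_⟩
      · simp only [s, dif_pos htV]
        exact (σ.sum_comp fun A => x A • E.ev (γ t) htV (f A)).symm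
      · refine Finset.sum_eq_zero fun A _ => ?_
        rw [Pi.zero_apply, zero_smul, zero_add, E.res_self, hpar t ht htV, smul_zero]
    · simp only [s, dif_pos hy]
      conv_rhs => rw [← (hb.fiberBasis hy).sum_repr u]
      exact Finset.sum_congr rfl fun A _ => by rw [hb.fiberBasis_apply]
    · simp only [s, dif_pos hz]
      rw [hb.frameIso_apply]
  exact key y z hy hz h0 h1

end Connection

end Supermanifold

end

noncomputable section

namespace Supermanifold

variable {k : WithTop ℕ∞} {n m : ℕ} {M : Type u} [TopologicalSpace M]
  [ChartedSpace (EuclideanSpace ℝ (Fin n)) M] {X : Supermanifold k n m M}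
  {E : X.SuperModulePresheaf}

namespace Connection

variable (N : Connection E ⊤) (S : X.SuperChart)

theorem nabla_constField {V : Opens M} (hV : V ≤ S.U) (w : EuclideanSpace ℝ (Fin n))
    (s : E.Sec V) : N.nabla V le_top (S.constField hV w) s =
      ∑ i, w i • N.nab S hV (Sum.inl i) s := by
  rw [SuperChart.constField, map_sum, LinearMap.sum_apply]
  refine Finset.sum_congr rfl fun i _ => ?_
  rw [map_smul, LinearMap.smul_apply]
  rfl

open Metric in
/-- Around each point there are frames that are parallel along the rays of a chart and along the
Euler field. -/
theorem exists_radial_frame {p q : ℕ} {y : M} (hyS : y ∈ S.U) {U : Opens M} (hyU : y ∈ U)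
    {e : Fin p ⊕ Fin q → E.Sec U} (he : E.IsSuperBasis e) :
    ∃ (V : Opens M) (hV : V ≤ S.U) (hyV : y ∈ V) (f : Fin p ⊕ Fin q → E.Sec V)
      (hf : E.IsSuperBasis f), (∀ A, E.ev y hyV (f A) = E.ev y hyU (e A)) ∧
      (∀ A, N.euler S hV (f A) = 0) ∧
      (∀ i A, E.ev y hyV (N.nab S hV (Sum.inl i) (f A)) = 0) ∧
      ∀ (z : M) (hz : z ∈ V), N.IsTransport y z (hf.isBasis.frameIso hyV hz) ∧
        N.IsTransport z y (hf.isBasis.frameIso hz hyV) := by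
  classical
  have hyW : y ∈ U ⊓ S.U := ⟨hyU, hyS⟩
  have hWS : U ⊓ S.U ≤ S.U := inf_le_right
  have hW := S.subset_source_of_le hWS
  have hb := he.isBasis
  obtain ⟨ρ, hρ, hρW, hρb⟩ := CkFun.exists_ball_subset hW hyW
  -- These are the Christoffel coefficients of the even directions. Between indices of different
  -- parity they are odd superfunctions, so their underlying functions vanish.
  let h : Fin n → Fin p ⊕ Fin q → Fin p ⊕ Fin q → X.O (U ⊓ S.U) := fun i B D =>
    hb.coef inf_le_left (N.nab S hWS (Sum.inl i) (E.res inf_le_left (e B))) D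
  have hh : ∀ i B D, coordPar B ≠ coordPar D → X.body _ (h i B D) = 0 := by
    intro i B D hBD
    have h1 := he.coef_mem (inf_le_left : U ⊓ S.U ≤ U) (N.nab_mem S hWS (Sum.inl i)
      (E.par_res (inf_le_left : U ⊓ S.U ≤ U) _ _ (he.mem_par B))) D
    have h2 : coordPar (Sum.inl i : Fin n ⊕ Fin m) + coordPar B + coordPar D = 1 := by
      have : ∀ a b : ZMod 2, a ≠ b → 0 + a + b = 1 := by decide
      exact this _ _ hBD
    rw [h2] at h1
    exact S.body_eq_zero_of_odd hWS h1
  obtain ⟨ε, hε, hερ, C, hCs, hCp, hCy, hCdet, hC⟩ := exists_radial_matrix S.smooth_or_analytic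
    (coordPar : Fin p ⊕ Fin q → ZMod 2) (fun i B D => CkFun.loc S.φ (X.body _ (h i B D))) (S.φ y)
    hρ (fun i B D => (CkFun.contDiffOn_loc S.mem_atlas _).mono hρW) (fun i B D hBD v hv => by
      rw [hh i B D hBD, CkFun.loc_of_mem _ (hρW hv)]
      rfl)
  let V := CkFun.chartBall S.φ (S.φ y) ε
  have hVs : (V : Set M) ⊆ S.φ.source := CkFun.chartBall_subset _ _
  have hVW : V ≤ U ⊓ S.U := fun z hz => hρb ⟨hz.1, ball_subset_ball hερ hz.2⟩
  have hV : V ≤ S.U := hVW.trans hWS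
  have hVU : V ≤ U := hVW.trans inf_le_left
  have hyV : y ∈ V := CkFun.mem_chartBall (S.subset_source hyS) hε
  have hball : ball (S.φ y) ε ⊆ CkFun.chartImage S.φ V := by
    intro v hv
    have h1 := hρW (ball_subset_ball hερ hv)
    refine ⟨h1.1, S.φ.map_target h1.1, ?_⟩
    rw [mem_preimage, S.φ.right_inv h1.1]
    exact hv
  have hVball : ∀ z ∈ V, S.φ z ∈ ball (S.φ y) ε := fun z hz => hz.2
  have hCs' : ∀ A B, ContDiffOn ℝ k (C A B) (CkFun.chartImage S.φ V) := fun A B =>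
    (hCs A B).mono (CkFun.chartImage_chartBall_subset _ _)
  let Cf : Fin p ⊕ Fin q → Fin p ⊕ Fin q → CkFun k n V := fun A B =>
    CkFun.ofLoc S.mem_atlas hVs (C A B) (hCs' A B)
  have hCfp : ∀ A B, coordPar A ≠ coordPar B → Cf A B = 0 := by
    intro A B hAB
    ext z
    change C A B (S.φ z) = 0
    rw [hCp A B hAB]
    rfl
  let s₀ : Fin p ⊕ Fin q → E.Sec V := fun A => ∑ B, S.lift hV (Cf A B) • E.res hVU (e B)
  have hs₀ : ∀ A, s₀ A ∈ E.par V (coordPar A) := by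
    intro A
    refine Submodule.sum_mem _ fun B _ => ?_
    by_cases hAB : coordPar A = coordPar B
    · have := E.smul_mem V 0 _ _ _ (S.lift_mem hV (Cf A B)) (E.par_res hVU _ _ (he.mem_par B))
      rwa [zero_add, ← hAB] at this
    · rw [hCfp A B hAB, map_zero, zero_smul]
      exact zero_mem _
  -- `s₀` already solves the radial equation in the fibres. Its correction to a solution of the
  -- Euler equation lies in the ideal of the odd coordinates and does not disturb this.
  have hf : ∀ A, ∃ f ∈ E.par V (coordPar A), N.euler S hV f = 0 ∧ f - s₀ A ∈ S.J hV (E.Sec V) 1 :=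
    fun A => S.exists_apply_eq_zero hV (L := N.euler S hV)
      (fun a t => by rw [N.euler_smul, S.lieDer_eulerField_xi]) (S.euler_mem_J_one hV N)
      (P := E.par V (coordPar A)) (fun t ht => N.euler_mem S hV ht) (hs₀ A)
  choose f hfp hfe hfs using hf
  have hevf : ∀ A z (hz : z ∈ V), E.ev z hz (f A) = ∑ B, C A B (S.φ z) • E.ev z (hVU hz) (e B) := by
    intro A z hz
    have h1 := S.ev_eq_zero_of_mem_J_one hV (hfs A) hz
    rw [map_sub, sub_eq_zero] at h1
    rw [h1, map_sum]
    refine Finset.sum_congr rfl fun B _ => ?_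
    rw [E.ev_smul, E.ev_res, val_of_mem _ hz, S.body_lift, CkFun.ofLoc_apply]
  have hli : ∀ z (hz : z ∈ V), LinearIndependent ℝ fun A => E.ev z hz (f A) := by
    intro z hz
    have h1 : LinearIndependent ℝ (Matrix.of fun A B => C A B (S.φ z)).row := by
      rw [Matrix.linearIndependent_rows_iff_isUnit, Matrix.isUnit_iff_isUnit_det]
      exact (hCdet _ (hVball z hz)).isUnit
    have h2 := h1.map' (hb.fiberBasis (hVU hz)).equivFun.symm.toLinearMap (LinearEquiv.ker _)
    have h3 : (fun A => E.ev z hz (f A)) = (hb.fiberBasis (hVU hz)).equivFun.symm.toLinearMap ∘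
        (Matrix.of fun A B => C A B (S.φ z)).row := by
      funext A
      rw [hevf, Function.comp_apply, LinearEquiv.coe_coe, Module.Basis.equivFun_symm_apply]
      exact Finset.sum_congr rfl fun B _ => by rw [hb.fiberBasis_apply]; rfl
    rw [h3]
    exact h2
  have hfb : E.IsSuperBasis f := SuperModulePresheaf.IsSuperBasis.of_mem
    (S.isBasis_of_linearIndependent_ev hV (hb.restrict hVU) hli) hfp
  have hnab : ∀ i A z (hz : z ∈ V), E.ev z hz (N.nab S hV (Sum.inl i) (f A)) =
      ∑ D, (fderiv ℝ (C A D) (S.φ z) (EuclideanSpace.single i 1) +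
        ∑ B, C A B (S.φ z) * CkFun.loc S.φ (X.body _ (h i B D)) (S.φ z)) •
          E.ev z (hVU hz) (e D) := by
    intro i A z hz
    have h1 := S.ev_nab_inl_eq_zero_of_mem_J_one hV N i (hfs A) hz
    rw [map_sub, map_sub, sub_eq_zero] at h1
    have h2 : ∀ B, E.ev z hz (N.nab S hV (Sum.inl i) (S.lift hV (Cf A B) • E.res hVU (e B))) =
        fderiv ℝ (C A B) (S.φ z) (EuclideanSpace.single i 1) • E.ev z (hVU hz) (e B) +
        ∑ D, (C A B (S.φ z) * CkFun.loc S.φ (X.body _ (h i B D)) (S.φ z)) •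
          E.ev z (hVU hz) (e D) := by
      intro B
      rw [N.nab_inl_smul, map_add, E.ev_smul, E.ev_smul, E.ev_res, S.val_op_inl hV i _ hz,
        val_of_mem _ hz, S.body_lift, CkFun.ofLoc_apply]
      congr 1
      · congr 2
        refine Filter.EventuallyEq.fderiv_eq ?_
        filter_upwards [(CkFun.isOpen_chartImage S.φ V).mem_nhds (CkFun.mem_chartImage hVs hz)]
          with v hv
        exact CkFun.loc_ofLoc S.mem_atlas hVs _ _ hv
      · have h3 : N.nab S hV (Sum.inl i) (E.res hVU (e B)) =
            E.res hVW (N.nab S hWS (Sum.inl i) (E.res inf_le_left (e B))) := by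
          rw [N.res_nab, E.res_res]
        rw [h3, E.ev_res, hb.ev_eq_sum inf_le_left (hVW hz), Finset.smul_sum]
        refine Finset.sum_congr rfl fun D _ => ?_
        rw [smul_smul, val_of_mem _ (hVW hz)]
        congr 2
        exact (CkFun.loc_apply hW (X.body _ (h i B D)) ⟨z, hVW hz⟩).symm
    rw [h1, map_sum, map_sum, Finset.sum_congr rfl fun B _ => h2 B, Finset.sum_add_distrib,
      Finset.sum_comm]
    simp only [add_smul, Finset.sum_smul, Finset.sum_add_distrib]
  have hrad : ∀ w ∈ ball (0 : EuclideanSpace ℝ (Fin n)) ε, ∀ t ∈ Icc (0 : ℝ) 1, ∀ z (hz : z ∈ V),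
      S.φ z = S.φ y + t • w → ∀ A, ∑ i, w i • E.ev z hz (N.nab S hV (Sum.inl i) (f A)) = 0 := by
    intro w hw t ht z hz hzw A
    simp only [hnab, Finset.smul_sum, smul_smul]
    rw [Finset.sum_comm]
    refine Finset.sum_eq_zero fun D _ => ?_
    rw [← Finset.sum_smul]
    have h1 := hC w hw t ht A D
    rw [← hzw] at h1
    have hwe : w = ∑ i, w i • EuclideanSpace.single i (1 : ℝ) := by
      ext j
      simp [Finset.sum_apply, Pi.single_apply]
    have h2 : fderiv ℝ (C A D) (S.φ z) w =
        ∑ i, w i * fderiv ℝ (C A D) (S.φ z) (EuclideanSpace.single i 1) := by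
      conv_lhs => rw [hwe, map_sum]
      exact Finset.sum_congr rfl fun i _ => by rw [map_smul, smul_eq_mul]
    have h3 : ∑ B, C A B (S.φ z) * ∑ i, w i * CkFun.loc S.φ (X.body _ (h i B D)) (S.φ z) =
        ∑ i, w i * ∑ B, C A B (S.φ z) * CkFun.loc S.φ (X.body _ (h i B D)) (S.φ z) := by
      simp only [Finset.mul_sum]
      rw [Finset.sum_comm]
      exact Finset.sum_congr rfl fun i _ => Finset.sum_congr rfl fun B _ => by ring
    simp only [mul_add, Finset.sum_add_distrib]
    rw [← h2, ← h3, h1, zero_smul]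
  refine ⟨V, hV, hyV, f, hfb, fun A => ?_, hfe, fun i A => ?_, fun z hz => ⟨?_, ?_⟩⟩
  · rw [hevf, Finset.sum_eq_single A]
    · rw [hCy, if_pos rfl, one_smul]
    · intro B _ hB
      rw [hCy, if_neg (Ne.symm hB), zero_smul]
    · simp
  · have h1 := hrad (EuclideanSpace.single i (ε / 2)) (by
      rw [mem_ball_zero_iff, PiLp.norm_single, Real.norm_of_nonneg (by positivity)]
      linarith) 0 (by simp) y hyV (by simp) A
    rw [Finset.sum_eq_single i (fun j _ hj => by simp [hj]) (by simp)] at h1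
    have h2 : (ε / 2) • E.ev y hyV (N.nab S hV (Sum.inl i) (f A)) = 0 := by simpa using h1
    exact (smul_eq_zero.1 h2).resolve_left (by positivity)
  · have hw : S.φ z - S.φ y ∈ ball (0 : EuclideanSpace ℝ (Fin n)) ε := by
      have := hVball z hz
      rwa [mem_ball_iff_norm, ← mem_ball_zero_iff] at this
    have hin : ∀ t ∈ Icc (0 : ℝ) 1, S.φ y + t • (S.φ z - S.φ y) ∈ CkFun.chartImage S.φ V := by
      intro t ht
      refine hball ?_
      rw [mem_ball_iff_norm, add_sub_cancel_left, norm_smul, Real.norm_of_nonneg ht.1]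
      exact lt_of_le_of_lt (mul_le_of_le_one_left (norm_nonneg _) ht.2) (mem_ball_zero_iff.1 hw)
    refine N.isTransport_line S hV hfb.isBasis (S.φ y) (S.φ z - S.φ y) hin
      (fun t ht htV A => ?_) hyV hz rfl (by abel)
    rw [N.nabla_constField, map_sum]
    simp only [LinearMap.map_smul]
    exact hrad _ hw t ht _ htV (S.φ.right_inv (hin t ht).1) A
  · have hw : S.φ z - S.φ y ∈ ball (0 : EuclideanSpace ℝ (Fin n)) ε := by
      have := hVball z hz
      rwa [mem_ball_iff_norm, ← mem_ball_zero_iff] at this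
    -- The ray traversed backwards is the same segment at time `1 - t` with opposite velocity, so
    -- the same radial equation applies.
    have hflip : ∀ t : ℝ, S.φ z + t • (S.φ y - S.φ z) =
        S.φ y + (1 - t) • (S.φ z - S.φ y) := fun t => by module
    have hin : ∀ t ∈ Icc (0 : ℝ) 1, S.φ z + t • (S.φ y - S.φ z) ∈ CkFun.chartImage S.φ V := by
      intro t ht
      refine hball ?_
      rw [hflip, mem_ball_iff_norm, add_sub_cancel_left, norm_smul,
        Real.norm_of_nonneg (by linarith [ht.2])]
      exact lt_of_le_of_lt (mul_le_of_le_one_left (norm_nonneg _) (by linarith [ht.1]))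
        (mem_ball_zero_iff.1 hw)
    refine N.isTransport_line S hV hfb.isBasis (S.φ z) (S.φ y - S.φ z) hin
      (fun t ht htV A => ?_) hz hyV rfl (by abel)
    rw [N.nabla_constField, map_sum]
    simp only [LinearMap.map_smul]
    have h1 := hrad _ hw (1 - t) ⟨by linarith [ht.2], by linarith [ht.1]⟩ _ htV
      ((S.φ.right_inv (hin t ht).1).trans (hflip t)) A
    have h2 : ∀ i, (S.φ y - S.φ z) i = -((S.φ z - S.φ y) i) := fun i => by simp
    simp only [h2, neg_smul, Finset.sum_neg_distrib, h1, neg_zero]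

end Connection

end Supermanifold

end

/-! ### Adapted bases of fibres and parallel fields of subspaces. -/

noncomputable section

/-! ### Linear algebra -/

section LinearAlgebra

variable {V : Type*} [AddCommGroup V] [Module ℝ V]

theorem finrank_eq_card_of_mem_iff_repr {ι : Type*} [Fintype ι] (b : Module.Basis ι ℝ V)
    (P : ι → Prop) [DecidablePred P] {G : Submodule ℝ V}
    (hG : ∀ v, v ∈ G ↔ ∀ A, ¬ P A → b.repr v A = 0) :
    Module.finrank ℝ G = Fintype.card {A // P A} := by
  have h1 : G = Submodule.span ℝ (range fun A : {A // P A} => b A.1) := by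
    have h2 : (range fun A : {A // P A} => b A.1) = b '' {A | P A} := by
      rw [image_eq_range]
      rfl
    ext v
    rw [h2, Module.Basis.mem_span_image, hG]
    constructor
    · intro h A hA
      by_contra hPA
      exact (Finsupp.mem_support_iff.1 hA) (h A hPA)
    · intro h A hA
      by_contra h0
      exact hA (h (Finsupp.mem_support_iff.2 h0))
  rw [h1]
  exact finrank_span_eq_card (b.linearIndependent.comp _ Subtype.val_injective)

theorem exists_basis_adapted [FiniteDimensional ℝ V] (G : Submodule ℝ V) {p p₁ : ℕ}
    (hp : Module.finrank ℝ V = p) (hp₁ : Module.finrank ℝ G = p₁) :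
    ∃ b : Module.Basis (Fin p) ℝ V,
      ∀ v, v ∈ G ↔ ∀ I : Fin p, ¬ (I : ℕ) < p₁ → b.repr v I = 0 := by
  obtain ⟨H, hH⟩ := G.exists_isCompl
  have hdim : p₁ + Module.finrank ℝ H = p := by
    rw [← hp, ← hp₁]
    exact Submodule.finrank_add_eq_of_isCompl hH
  let bG := Module.finBasisOfFinrankEq ℝ G hp₁
  let bH := Module.finBasis ℝ H
  let b := ((bG.prod bH).map (G.prodEquivOfIsCompl H hH)).reindex
    (finSumFinEquiv.trans (finCongr hdim))
  refine ⟨b, fun v => ?_⟩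
  have hv : v ∈ G ↔ ((G.prodEquivOfIsCompl H hH).symm v).2 = 0 :=
    (Submodule.prodEquivOfIsCompl_symm_apply_snd_eq_zero G H hH).symm
  have hrepr : ∀ j, b.repr v j = (bG.prod bH).repr ((G.prodEquivOfIsCompl H hH).symm v)
      ((finSumFinEquiv.trans (finCongr hdim)).symm j) := fun j => by
    rw [Module.Basis.repr_reindex_apply]
    rfl
  rw [hv]
  constructor
  · intro h I hI
    rw [hrepr]
    obtain ⟨c, rfl⟩ := (finSumFinEquiv.trans (finCongr hdim)).surjective I
    rw [Equiv.symm_apply_apply]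
    cases c with
    | inl i => simp at hI
    | inr j => rw [Module.Basis.prod_repr_inr, h, map_zero]; rfl
  · intro h
    apply bH.repr.injective
    ext j
    have := h ((finSumFinEquiv.trans (finCongr hdim)) (Sum.inr j)) (by simp)
    rw [hrepr, Equiv.symm_apply_apply, Module.Basis.prod_repr_inr] at this
    rw [this]
    simp

end LinearAlgebra

/-- The first `p₁` even and the first `q₁` odd indices. -/
def IsFirst {p q : ℕ} (p₁ q₁ : ℕ) (A : Fin p ⊕ Fin q) : Prop :=
  Sum.elim (fun I : Fin p => (I : ℕ) < p₁) (fun J : Fin q => (J : ℕ) < q₁) A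

instance {p q : ℕ} (p₁ q₁ : ℕ) : DecidablePred (IsFirst (p := p) (q := q) p₁ q₁) := fun A => by
  cases A <;> (simp only [IsFirst, Sum.elim_inl, Sum.elim_inr]; infer_instance)

theorem card_isFirst_even {p q p₁ q₁ : ℕ} (hp : p₁ ≤ p) :
    Fintype.card {A : Fin p ⊕ Fin q // IsFirst p₁ q₁ A ∧ coordPar A = 0} = p₁ := by
  refine Eq.trans ?_ (Fintype.card_fin_lt_of_le hp)
  refine Fintype.card_congr ⟨fun A => ?_, fun I => ⟨Sum.inl I.1, I.2, rfl⟩, ?_, ?_⟩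
  · exact match A with
      | ⟨Sum.inl I, h⟩ => ⟨I, h.1⟩
      | ⟨Sum.inr _, h⟩ => absurd h.2 one_ne_zero
  · rintro ⟨I | J, h⟩
    · rfl
    · exact absurd h.2 one_ne_zero
  · intro I
    rfl

theorem card_isFirst_odd {p q p₁ q₁ : ℕ} (hq : q₁ ≤ q) :
    Fintype.card {A : Fin p ⊕ Fin q // IsFirst p₁ q₁ A ∧ coordPar A = 1} = q₁ := by
  refine Eq.trans ?_ (Fintype.card_fin_lt_of_le hq)
  refine Fintype.card_congr ⟨fun A => ?_, fun I => ⟨Sum.inr I.1, I.2, rfl⟩, ?_, ?_⟩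
  · exact match A with
      | ⟨Sum.inr I, h⟩ => ⟨I, h.1⟩
      | ⟨Sum.inl _, h⟩ => absurd h.2 zero_ne_one
  · rintro ⟨I | J, h⟩
    · exact absurd h.2 zero_ne_one
    · rfl
  · intro I
    rfl

namespace Supermanifold

variable {k : WithTop ℕ∞} {n m : ℕ} {M : Type u} [TopologicalSpace M]
  [ChartedSpace (EuclideanSpace ℝ (Fin n)) M] {X : Supermanifold k n m M}
  {E : X.SuperModulePresheaf} {p q : ℕ}

namespace SuperModulePresheaf

section Fiber

variable {U : Opens M} {e : Fin p ⊕ Fin q → E.Sec U}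

theorem IsSuperBasis.fiberPar_isCompl (he : E.IsSuperBasis e) (S : X.SuperChart) {y : M}
    (hyS : y ∈ S.U) (hy : y ∈ U) : IsCompl (E.fiberPar y 0) (E.fiberPar y 1) := by
  have hor : ∀ a : ZMod 2, a ≠ 0 ∨ a ≠ 1 := by decide
  have hor' : ∀ a : ZMod 2, a = 0 ∨ a = 1 := by decide
  constructor
  · rw [Submodule.disjoint_def]
    intro v h0 h1
    rw [he.mem_fiberPar_iff S hyS hy] at h0 h1
    apply (he.isBasis.fiberBasis hy).repr.injective
    ext A
    rw [map_zero]
    rcases hor (coordPar A) with h | h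
    · exact h0 A h
    · exact h1 A h
  · rw [codisjoint_iff, eq_top_iff]
    intro v _
    rw [← (he.isBasis.fiberBasis hy).sum_repr v]
    refine Submodule.sum_mem _ fun A _ => Submodule.smul_mem _ _ ?_
    have hA : he.isBasis.fiberBasis hy A ∈ E.fiberPar y (coordPar A) := by
      rw [he.mem_fiberPar_iff S hyS hy]
      intro B hB
      rw [Module.Basis.repr_self, Finsupp.single_eq_of_ne]
      rintro rfl
      exact hB rfl
    rcases hor' (coordPar A) with h | h <;> rw [h] at hA
    · exact Submodule.mem_sup_left hA
    · exact Submodule.mem_sup_right hA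

theorem IsSuperBasis.finrank_fiberPar (he : E.IsSuperBasis e) (S : X.SuperChart) {y : M}
    (hyS : y ∈ S.U) (hy : y ∈ U) : Module.finrank ℝ (E.fiberPar y 0) = p ∧
      Module.finrank ℝ (E.fiberPar y 1) = q := by
  have hall : ∀ A : Fin p ⊕ Fin q, IsFirst p q A := by
    rintro (I | J)
    · exact I.2
    · exact J.2
  constructor
  · refine (finrank_eq_card_of_mem_iff_repr (he.isBasis.fiberBasis hy)
      (fun A => IsFirst p q A ∧ coordPar A = 0) fun v => ?_).trans (card_isFirst_even le_rfl)
    rw [he.mem_fiberPar_iff S hyS hy]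
    simp [hall]
  · refine (finrank_eq_card_of_mem_iff_repr (he.isBasis.fiberBasis hy)
      (fun A => IsFirst p q A ∧ coordPar A = 1) fun v => ?_).trans (card_isFirst_odd le_rfl)
    rw [he.mem_fiberPar_iff S hyS hy]
    simp [hall]

/-- Since `F` is graded, membership can be tested on the even and the odd component separately, and
each parity gets its own adapted basis. -/
theorem exists_basis_fiber (he : E.IsSuperBasis e) (S : X.SuperChart) {y : M}
    (hyS : y ∈ S.U) (hy : y ∈ U) {p₁ q₁ : ℕ} {F : Submodule ℝ (E.Fiber y)}
    (hF : IsSuperSubspace F p₁ q₁) : ∃ b : Module.Basis (Fin p ⊕ Fin q) ℝ (E.Fiber y),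
      (∀ A, b A ∈ E.fiberPar y (coordPar A)) ∧
      ∀ v, v ∈ F ↔ ∀ A, ¬ IsFirst p₁ q₁ A → b.repr v A = 0 := by
  have : FiniteDimensional ℝ (E.Fiber y) := (he.isBasis.fiberBasis hy).finiteDimensional_of_finite
  have hc := he.fiberPar_isCompl S hyS hy
  obtain ⟨hd0, hd1⟩ := he.finrank_fiberPar S hyS hy
  have hr : ∀ P : Submodule ℝ (E.Fiber y),
      Module.finrank ℝ (F.comap P.subtype) = Module.finrank ℝ ↥(F ⊓ P) := by
    intro P
    rw [← Submodule.finrank_map_subtype_eq, Submodule.map_comap_subtype, inf_comm]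
  obtain ⟨b0, hb0⟩ := exists_basis_adapted (F.comap (E.fiberPar y 0).subtype) hd0
    ((hr _).trans hF.dim_even)
  obtain ⟨b1, hb1⟩ := exists_basis_adapted (F.comap (E.fiberPar y 1).subtype) hd1
    ((hr _).trans hF.dim_odd)
  let T := (E.fiberPar y 0).prodEquivOfIsCompl (E.fiberPar y 1) hc
  let b := (b0.prod b1).map T
  have hsplit : ∀ v, v ∈ F ↔ ((T.symm v).1 : E.Fiber y) ∈ F ∧ ((T.symm v).2 : E.Fiber y) ∈ F := by
    intro v
    have hv : ((T.symm v).1 : E.Fiber y) + (T.symm v).2 = v := T.apply_symm_apply v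
    constructor
    · intro h
      rw [hF.graded] at h
      obtain ⟨v0, h0, v1, h1, rfl⟩ := Submodule.mem_sup.1 h
      have : T.symm (v0 + v1) = (⟨v0, h0.2⟩, ⟨v1, h1.2⟩) := by
        rw [LinearEquiv.symm_apply_eq]
        rfl
      rw [this]
      exact ⟨h0.1, h1.1⟩
    · rintro ⟨h0, h1⟩
      rw [← hv]
      exact add_mem h0 h1
  refine ⟨b, ?_, fun v => ?_⟩
  · rintro (I | J)
    · have : b (Sum.inl I) = (b0 I : E.Fiber y) := by
        change (((b0.prod b1) (Sum.inl I)).1 : E.Fiber y) + ((b0.prod b1) (Sum.inl I)).2 = _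
        simp
      rw [this]
      exact (b0 I).2
    · have : b (Sum.inr J) = (b1 J : E.Fiber y) := by
        change (((b0.prod b1) (Sum.inr J)).1 : E.Fiber y) + ((b0.prod b1) (Sum.inr J)).2 = _
        simp
      rw [this]
      exact (b1 J).2
  · have h0 := hb0 (T.symm v).1
    have h1 := hb1 (T.symm v).2
    rw [Submodule.mem_comap, Submodule.subtype_apply] at h0 h1
    rw [hsplit, h0, h1]
    have e0 : ∀ I, b.repr v (Sum.inl I) = b0.repr (T.symm v).1 I := fun I => by simp [b]
    have e1 : ∀ J, b.repr v (Sum.inr J) = b1.repr (T.symm v).2 J := fun J => by simp [b]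
    constructor
    · rintro ⟨h2, h3⟩ (I | J) hA
      · rw [e0]; exact h2 I hA
      · rw [e1]; exact h3 J hA
    · intro h
      exact ⟨fun I hI => by rw [← e0]; exact h _ hI, fun J hJ => by rw [← e1]; exact h _ hJ⟩

theorem IsBasis.fiberBasis_eq {ι : Type} [Fintype ι] {V : Opens M} {f : ι → E.Sec V}
    (hf : E.IsBasis f) {y : M} (hy : y ∈ V) {b : Module.Basis ι ℝ (E.Fiber y)}
    (h : ∀ A, E.ev y hy (f A) = b A) : hf.fiberBasis hy = b :=
  Module.Basis.eq_of_apply_eq fun A => by rw [hf.fiberBasis_apply, h]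

/-- The basis of the fibre is extended with constant coefficients in `e`. Its values at any point
are then the image of `b` under the isomorphism `frameIso`, hence independent. -/
theorem exists_superBasis_of_fiber (he : E.IsSuperBasis e) (S : X.SuperChart) (hU : U ≤ S.U) {y : M}
    (hy : y ∈ U) (b : Module.Basis (Fin p ⊕ Fin q) ℝ (E.Fiber y))
    (hb : ∀ A, b A ∈ E.fiberPar y (coordPar A)) :
    ∃ f : Fin p ⊕ Fin q → E.Sec U, E.IsSuperBasis f ∧ ∀ A, E.ev y hy (f A) = b A := by
  let f : Fin p ⊕ Fin q → E.Sec U := fun A =>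
    ∑ B, (he.isBasis.fiberBasis hy).repr (b A) B • e B
  have hev : ∀ A z (hz : z ∈ U), E.ev z hz (f A) = he.isBasis.frameIso hy hz (b A) := by
    intro A z hz
    rw [he.isBasis.frameIso_apply, map_sum]
    exact Finset.sum_congr rfl fun B _ => LinearMap.map_smul _ _ _
  refine ⟨f, IsSuperBasis.of_mem
    (S.isBasis_of_linearIndependent_ev hU he.isBasis fun z hz => ?_) fun A => ?_, fun A => ?_⟩
  · simp only [hev]
    exact b.linearIndependent.map' (he.isBasis.frameIso hy hz).toLinearMap (LinearEquiv.ker _)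
  · refine Submodule.sum_mem _ fun B _ => ?_
    by_cases hAB : coordPar B = coordPar A
    · exact Submodule.smul_mem _ _ (hAB ▸ he.mem_par B)
    · rw [(he.mem_fiberPar_iff S (hU hy) hy _ _).1 (hb A) B hAB, zero_smul]
      exact zero_mem _
  · rw [hev, he.isBasis.frameIso_apply]
    conv_rhs => rw [← (he.isBasis.fiberBasis hy).sum_repr (b A)]
    exact Finset.sum_congr rfl fun B _ => by rw [he.isBasis.fiberBasis_apply]

/-- An isomorphism of fibres that preserves the parity. -/
def IsEvenIso {y z : M} (τ : E.Fiber y ≃ₗ[ℝ] E.Fiber z) : Prop :=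
  ∀ j v, v ∈ E.fiberPar y j ↔ τ v ∈ E.fiberPar z j

theorem IsSuperBasis.isEvenIso_frameIso (he : E.IsSuperBasis e) (S : X.SuperChart) (hU : U ≤ S.U)
    {y z : M} (hy : y ∈ U) (hz : z ∈ U) : IsEvenIso (he.isBasis.frameIso hy hz) := by
  intro j v
  rw [he.mem_fiberPar_iff S (hU hy) hy, he.mem_fiberPar_iff S (hU hz) hz]
  simp only [he.isBasis.repr_frameIso]

end Fiber

end SuperModulePresheaf

namespace Connection

open SuperModulePresheaf

variable (N : Connection E ⊤)

/-- A field of supersubspaces of the fibres that is preserved by the parallel displacements and by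
the covariant derivatives of the curvature. -/
structure IsParallelField (p₁ q₁ : ℕ) (F : ∀ y : M, Submodule ℝ (E.Fiber y)) : Prop where
  superSubspace : ∀ y, IsSuperSubspace (F y) p₁ q₁
  -- The displacements allowed here are exactly those that make `y` and `z` `Linked`, so that both
  -- subspaces come from the same base point.
  transport : ∀ (y z : M) (τ : E.Fiber y ≃ₗ[ℝ] E.Fiber z), N.IsTransport y z τ →
    N.IsTransport z y τ.symm → IsEvenIso τ → ∀ v ∈ F y, τ v ∈ F z
  covCurv : ∀ (y : M) (U : Opens M) (_ : y ∈ U) (N' : Connection X.tangent U) (r : ℕ)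
    (Y : Fin r → X.tangent.HomSec U) (A B : X.tangent.HomSec U) (T : Module.End ℝ (E.Fiber y)),
    N.IsCovCurvAt N' y r Y A B T → ∀ v ∈ F y, T v ∈ F y

/-- A radial frame adapted to `F` at the centre stays adapted, because the displacement along a ray
keeps coordinates and maps the subspaces into each other in both directions. -/
theorem IsParallelField.exists_frame {N : Connection E ⊤} {p₁ q₁ : ℕ}
    {F : ∀ y : M, Submodule ℝ (E.Fiber y)} (hF : N.IsParallelField p₁ q₁ F)
    (hE : E.IsLocallyFreeSheaf p q) (S : X.SuperChart) {y : M} (hy : y ∈ S.U) :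
    ∃ (V : Opens M) (hV : V ≤ S.U) (hyV : y ∈ V) (f : Fin p ⊕ Fin q → E.Sec V)
      (hf : E.IsSuperBasis f), (∀ A, N.euler S hV (f A) = 0) ∧
      (∀ i A, E.ev y hyV (N.nab S hV (Sum.inl i) (f A)) = 0) ∧
      ∀ (z : M) (hz : z ∈ V) (v : E.Fiber z), v ∈ F z ↔
        ∀ A, ¬ IsFirst p₁ q₁ A → (hf.isBasis.fiberBasis hz).repr v A = 0 := by
  obtain ⟨U, hyU, e₀, he₀⟩ := hE.locallyFree y
  have hyW : y ∈ U ⊓ S.U := ⟨hyU, hy⟩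
  have he := he₀.restrict (inf_le_left : U ⊓ S.U ≤ U)
  obtain ⟨b, hb, hbF⟩ := exists_basis_fiber he S hy hyW (hF.superSubspace y)
  obtain ⟨e, he', heb⟩ := exists_superBasis_of_fiber he S inf_le_right hyW b hb
  obtain ⟨V, hV, hyV, f, hf, hfe, hfT, hfn, hft⟩ := N.exists_radial_frame S hy hyW he'
  refine ⟨V, hV, hyV, f, hf, hfT, hfn, fun z hz v => ?_⟩
  have hby : hf.isBasis.fiberBasis hyV = b :=
    hf.isBasis.fiberBasis_eq hyV fun A => (hfe A).trans (heb A)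
  have hsymm : ∀ {y z : M} (hy : y ∈ V) (hz : z ∈ V), (hf.isBasis.frameIso hy hz).symm =
      hf.isBasis.frameIso hz hy := fun hy hz => by
    simp [IsBasis.frameIso]
  have h1 : v ∈ F z ↔ hf.isBasis.frameIso hz hyV v ∈ F y := by
    constructor
    · exact hF.transport z y _ (hft z hz).2 (by rw [hsymm]; exact (hft z hz).1)
        (hf.isEvenIso_frameIso S hV hz hyV) v
    · intro h
      have := hF.transport y z _ (hft z hz).1 (by rw [hsymm]; exact (hft z hz).2)
        (hf.isEvenIso_frameIso S hV hyV hz) _ h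
      rwa [← hsymm hyV hz, LinearEquiv.apply_symm_apply] at this
  rw [h1, hbF, ← hby]
  simp only [hf.isBasis.repr_frameIso]

end Connection

end Supermanifold

end

/-! ### The parallel subsheaf defined by a parallel field. -/

noncomputable section

namespace Supermanifold

variable {k : WithTop ℕ∞} {n m : ℕ} {M : Type u} [TopologicalSpace M]
  [ChartedSpace (EuclideanSpace ℝ (Fin n)) M] {X : Supermanifold k n m M}
  {E : X.SuperModulePresheaf} {p q : ℕ}

open SuperModulePresheaf

/-! ### Sections whose iterated derivatives have values in a field of subspaces -/

/-- The sections with values in a field of subspaces. -/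
def valuedIn (F : ∀ y : M, Submodule ℝ (E.Fiber y)) (W : Opens M) : Submodule ℝ (E.Sec W) :=
  ⨅ z : W, (F z.1).comap (E.ev z.1 z.2)

theorem mem_valuedIn {F : ∀ y : M, Submodule ℝ (E.Fiber y)} {W : Opens M} {s : E.Sec W} :
    s ∈ valuedIn F W ↔ ∀ z (hz : z ∈ W), E.ev z hz s ∈ F z := by
  simp [valuedIn, Submodule.mem_iInf]

namespace Connection

variable (N : Connection E ⊤) (F : ∀ y : M, Submodule ℝ (E.Fiber y)) (S : X.SuperChart)

/-- The sections with values in `F` whose iterated covariant derivatives along at most `r`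
coordinate fields have values in `F`. -/
def derivIn {W : Opens M} (hW : W ≤ S.U) : ℕ → Submodule ℝ (E.Sec W)
  | 0 => valuedIn F W
  | r + 1 => valuedIn F W ⊓ ⨅ c, (derivIn hW r).comap (N.nab S hW c)

variable {N F S} {W : Opens M} {hW : W ≤ S.U}

theorem mem_derivIn_succ {r : ℕ} {s : E.Sec W} : s ∈ N.derivIn F S hW (r + 1) ↔
    s ∈ valuedIn F W ∧ ∀ c, N.nab S hW c s ∈ N.derivIn F S hW r := by
  simp [derivIn, Submodule.mem_iInf]

theorem derivIn_le (r : ℕ) : N.derivIn F S hW r ≤ valuedIn F W := by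
  cases r with
  | zero => exact le_rfl
  | succ r => exact inf_le_left

theorem derivIn_succ_le (r : ℕ) : N.derivIn F S hW (r + 1) ≤ N.derivIn F S hW r := by
  induction r with
  | zero => exact derivIn_le 1
  | succ r ih =>
    intro s hs
    rw [mem_derivIn_succ] at hs ⊢
    exact ⟨hs.1, fun c => ih (hs.2 c)⟩

theorem smul_mem_valuedIn (f : X.O W) {s : E.Sec W} (hs : s ∈ valuedIn F W) :
    f • s ∈ valuedIn F W := by
  rw [mem_valuedIn] at hs ⊢
  intro z hz
  rw [E.ev_smul]
  exact Submodule.smul_mem _ _ (hs z hz)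

theorem smul_mem_derivIn {r : ℕ} (f : X.O W) {s : E.Sec W} (hs : s ∈ N.derivIn F S hW r) :
    f • s ∈ N.derivIn F S hW r := by
  induction r generalizing f s with
  | zero => exact smul_mem_valuedIn f hs
  | succ r ih =>
    have key : ∀ j, ∀ f ∈ X.par W j, f • s ∈ N.derivIn F S hW (r + 1) := by
      intro j f hf
      rw [mem_derivIn_succ] at hs ⊢
      refine ⟨smul_mem_valuedIn f hs.1, fun c => ?_⟩
      rw [N.nab_smul S hW c hf]
      exact add_mem (ih _ (derivIn_succ_le r (mem_derivIn_succ.2 hs)))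
        (Submodule.smul_mem _ _ (ih _ (hs.2 c)))
    obtain ⟨f₀, h0, f₁, h1, rfl⟩ := X.exists_even_add_odd f
    rw [add_smul]
    exact add_mem (key 0 f₀ h0) (key 1 f₁ h1)

theorem nabla_mem_derivIn {r : ℕ} {s : E.Sec W} (hs : s ∈ N.derivIn F S hW (r + 1))
    (Y : X.tangent.Sec W) : N.nabla W le_top Y s ∈ N.derivIn F S hW r := by
  rw [N.nabla_eq_sum_nab S hW]
  exact Submodule.sum_mem _ fun c _ => smul_mem_derivIn _ ((mem_derivIn_succ.1 hs).2 c)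

theorem res_mem_valuedIn {V : Opens M} (h : V ≤ W) {s : E.Sec W} (hs : s ∈ valuedIn F W) :
    E.res h s ∈ valuedIn F V := by
  rw [mem_valuedIn] at hs ⊢
  intro z hz
  rw [E.ev_res]
  exact hs z (h hz)

theorem res_mem_derivIn {V : Opens M} (h : V ≤ W) {r : ℕ} {s : E.Sec W}
    (hs : s ∈ N.derivIn F S hW r) : E.res h s ∈ N.derivIn F S (h.trans hW) r := by
  induction r generalizing s with
  | zero => exact res_mem_valuedIn h hs
  | succ r ih =>
    rw [mem_derivIn_succ] at hs ⊢
    refine ⟨res_mem_valuedIn h hs.1, fun c => ?_⟩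
    rw [← N.res_nab S hW h]
    exact ih (hs.2 c)

theorem mem_derivIn_of_local {r : ℕ} {s : E.Sec W} (hs : ∀ x ∈ W, ∃ (V : Opens M) (h : V ≤ W),
    x ∈ V ∧ E.res h s ∈ N.derivIn F S (h.trans hW) r) : s ∈ N.derivIn F S hW r := by
  have hv : ∀ s : E.Sec W, (∀ x ∈ W, ∃ (V : Opens M) (h : V ≤ W),
      x ∈ V ∧ E.res h s ∈ valuedIn F V) → s ∈ valuedIn F W := by
    intro s hs
    rw [mem_valuedIn]
    intro z hz
    obtain ⟨V, h, hzV, hV⟩ := hs z hz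
    rw [← E.ev_res h hzV]
    exact mem_valuedIn.1 hV z hzV
  induction r generalizing s with
  | zero => exact hv s hs
  | succ r ih =>
    rw [mem_derivIn_succ]
    refine ⟨hv s fun x hx => ?_, fun c => ih fun x hx => ?_⟩
    · obtain ⟨V, h, hxV, hV⟩ := hs x hx
      exact ⟨V, h, hxV, derivIn_le _ hV⟩
    · obtain ⟨V, h, hxV, hV⟩ := hs x hx
      refine ⟨V, h, hxV, ?_⟩
      rw [N.res_nab S hW h]
      exact (mem_derivIn_succ.1 hV).2 c

/-- The coordinate fields of one chart are combinations of those of another with superfunction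
coefficients, and `derivIn` is closed under multiplication by superfunctions. -/
theorem mem_derivIn_of_chart {S' : X.SuperChart} (hW' : W ≤ S'.U) {r : ℕ} {s : E.Sec W}
    (hs : s ∈ N.derivIn F S hW r) : s ∈ N.derivIn F S' hW' r := by
  induction r generalizing s with
  | zero => exact hs
  | succ r ih =>
    rw [mem_derivIn_succ]
    exact ⟨derivIn_le _ hs, fun c => ih (nabla_mem_derivIn hs _)⟩

theorem graded_derivIn (hF : ∀ z ∈ W, ∀ v₀ ∈ E.fiberPar z 0, ∀ v₁ ∈ E.fiberPar z 1,
    v₀ + v₁ ∈ F z → v₀ ∈ F z ∧ v₁ ∈ F z) {r : ℕ} {s₀ s₁ : E.Sec W} (h0 : s₀ ∈ E.par W 0)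
    (h1 : s₁ ∈ E.par W 1) (hs : s₀ + s₁ ∈ N.derivIn F S hW r) :
    s₀ ∈ N.derivIn F S hW r ∧ s₁ ∈ N.derivIn F S hW r := by
  have hev : ∀ j, ∀ s ∈ E.par W j, ∀ z (hz : z ∈ W), E.ev z hz s ∈ E.fiberPar z j :=
    fun j s hs z hz => Submodule.mem_iSup_of_mem W (Submodule.mem_iSup_of_mem hz ⟨s, hs, rfl⟩)
  have hv : ∀ s₀ ∈ E.par W 0, ∀ s₁ ∈ E.par W 1, s₀ + s₁ ∈ valuedIn F W →
      s₀ ∈ valuedIn F W ∧ s₁ ∈ valuedIn F W := by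
    intro s₀ h0 s₁ h1 hs
    rw [mem_valuedIn] at hs
    have := fun z hz => hF z hz _ (hev 0 s₀ h0 z hz) _ (hev 1 s₁ h1 z hz) (by
      rw [← map_add]; exact hs z hz)
    exact ⟨mem_valuedIn.2 fun z hz => (this z hz).1, mem_valuedIn.2 fun z hz => (this z hz).2⟩
  induction r generalizing s₀ s₁ with
  | zero => exact hv s₀ h0 s₁ h1 hs
  | succ r ih =>
    simp only [mem_derivIn_succ] at hs ⊢
    obtain ⟨hs, hn⟩ := hs
    obtain ⟨hv0, hv1⟩ := hv s₀ h0 s₁ h1 hs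
    have key : ∀ c, N.nab S hW c s₀ ∈ N.derivIn F S hW r ∧
        N.nab S hW c s₁ ∈ N.derivIn F S hW r := by
      intro c
      have e0 := N.nab_mem S hW c h0
      have e1 := N.nab_mem S hW c h1
      have e2 := hn c
      rw [map_add] at e2
      cases c with
      | inl i => exact ih e0 e1 e2
      | inr a =>
        -- An odd derivative interchanges the even and the odd component, so the induction
        -- hypothesis is used with the roles reversed.
        rw [add_comm] at e2
        exact (ih e1 e0 e2).symm
    exact ⟨⟨hv0, fun c => (key c).1⟩, ⟨hv1, fun c => (key c).2⟩⟩

section Parallel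

variable {p₁ q₁ : ℕ} (hF : N.IsParallelField p₁ q₁ F) (hE : E.IsLocallyFreeSheaf p q)

theorem IsParallelField.graded (hF : N.IsParallelField p₁ q₁ F) (hE : E.IsLocallyFreeSheaf p q)
    (S : X.SuperChart) {z : M} (hz : z ∈ S.U) :
    ∀ v₀ ∈ E.fiberPar z 0, ∀ v₁ ∈ E.fiberPar z 1, v₀ + v₁ ∈ F z → v₀ ∈ F z ∧ v₁ ∈ F z := by
  intro v₀ h0 v₁ h1 hv
  obtain ⟨U, hzU, e, he⟩ := hE.locallyFree z
  have hc := he.fiberPar_isCompl S hz hzU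
  rw [(hF.superSubspace z).graded] at hv
  obtain ⟨w₀, hw0, w₁, hw1, hw⟩ := Submodule.mem_sup.1 hv
  have h2 : v₀ - w₀ = 0 := by
    refine Submodule.disjoint_def.1 hc.disjoint _ (sub_mem h0 hw0.2) ?_
    have : v₀ - w₀ = w₁ - v₁ := by
      rw [sub_eq_sub_iff_add_eq_add, ← hw, add_comm]
    rw [this]
    exact sub_mem hw1.2 h1
  have h3 : v₀ = w₀ := sub_eq_zero.1 h2
  have h4 : v₁ = w₁ := by
    rw [h3] at hw
    exact (add_left_cancel hw).symm
  exact ⟨h3 ▸ hw0.1, h4 ▸ hw1.1⟩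

/-- At `z` take an adapted frame centred at `z`, whose even derivatives vanish there. Then only the
coefficients are differentiated, and those outside `F` have underlying function zero on a whole
neighbourhood. -/
theorem IsParallelField.nab_inl_mem_valuedIn (hF : N.IsParallelField p₁ q₁ F)
    (hE : E.IsLocallyFreeSheaf p q) (i : Fin n) {s : E.Sec W} (hs : s ∈ valuedIn F W) :
    N.nab S hW (Sum.inl i) s ∈ valuedIn F W := by
  rw [mem_valuedIn]
  intro z hz
  obtain ⟨V, hV, hzV, f, hf, _, hfn, hfF⟩ := hF.exists_frame hE S (hW hz)
  have hzW : z ∈ V ⊓ W := ⟨hzV, hz⟩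
  have hle : V ⊓ W ≤ S.U := inf_le_left.trans hV
  rw [← E.ev_res inf_le_right hzW, N.res_nab]
  have ht := res_mem_valuedIn (inf_le_right : V ⊓ W ≤ W) hs
  generalize E.res (inf_le_right : V ⊓ W ≤ W) s = t at ht
  have hb := hf.isBasis
  rw [← hb.sum_coef inf_le_left t, map_sum, map_sum]
  refine Submodule.sum_mem _ fun B _ => ?_
  rw [N.nab_inl_smul, map_add, E.ev_smul, E.ev_smul, ← N.res_nab S hV inf_le_left, E.ev_res,
    E.ev_res, hfn, smul_zero, add_zero]
  by_cases hB : IsFirst p₁ q₁ B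
  · refine Submodule.smul_mem _ _ ((hfF z hzV _).2 fun A hA => ?_)
    rw [← hb.fiberBasis_apply, Module.Basis.repr_self, Finsupp.single_eq_of_ne]
    rintro rfl
    exact hA hB
  · have h0 : X.body _ (hb.coef inf_le_left t B) = 0 := by
      ext x
      rw [← val_of_mem _ x.2, ← hb.fiberBasis_repr inf_le_left x.2]
      exact (hfF x.1 x.2.1 _).1 (mem_valuedIn.1 ht x.1 x.2) B hB
    rw [val_of_mem _ hzW, S.body_op_inl, h0, map_zero]
    change (0 : ℝ) • _ ∈ _
    rw [zero_smul]
    exact zero_mem _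

theorem IsParallelField.coordCurv_mem_valuedIn (hF : N.IsParallelField p₁ q₁ F)
    (hE : E.IsLocallyFreeSheaf p q) {r : ℕ} (l : Fin r → Fin n ⊕ Fin m) (c d : Fin n ⊕ Fin m)
    {s : E.Sec W} (hs : s ∈ valuedIn F W) : N.coordCurv S hW r l c d s ∈ valuedIn F W := by
  rw [mem_valuedIn] at hs ⊢
  intro z hz
  obtain ⟨U, hzU, e, he⟩ := hE.locallyFree z
  obtain ⟨T, hT⟩ := N.exists_isCovCurvAt S he.isBasis hzU (hW hz) l c d
  have := hF.covCurv z S.U (hW hz) _ _ _ _ _ T hT _ (hs z hz)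
  rw [hT W hW hz s] at this
  exact this

/-- Moving an outer derivative through the operator costs one further covariant derivative of the
curvature. For this reason all orders `r` are treated in the same induction. -/
theorem IsParallelField.coordCurv_mem_derivIn (hF : N.IsParallelField p₁ q₁ F)
    (hE : E.IsLocallyFreeSheaf p q) {r r' : ℕ} (l : Fin r → Fin n ⊕ Fin m) (c d : Fin n ⊕ Fin m)
    {s : E.Sec W} (hs : s ∈ N.derivIn F S hW r') :
    N.coordCurv S hW r l c d s ∈ N.derivIn F S hW r' := by
  induction r' generalizing r l s with
  | zero => exact hF.coordCurv_mem_valuedIn hE l c d hs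
  | succ r' ih =>
    rw [mem_derivIn_succ]
    refine ⟨hF.coordCurv_mem_valuedIn hE l c d (derivIn_le _ hs), fun b => ?_⟩
    rw [N.nab_coordCurv]
    exact add_mem (ih _ (derivIn_succ_le r' hs))
      (Submodule.smul_mem _ _ (ih _ ((mem_derivIn_succ.1 hs).2 b)))

/-- An even derivative does not lower the order: it can be moved past the other derivatives, with
curvature terms that are already under control, until it acts on values. -/
theorem IsParallelField.nab_inl_mem_derivIn (hF : N.IsParallelField p₁ q₁ F)
    (hE : E.IsLocallyFreeSheaf p q) {r : ℕ} (i : Fin n) {s : E.Sec W}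
    (hs : s ∈ N.derivIn F S hW r) : N.nab S hW (Sum.inl i) s ∈ N.derivIn F S hW r := by
  induction r generalizing s with
  | zero => exact hF.nab_inl_mem_valuedIn hE i hs
  | succ r ih =>
    rw [mem_derivIn_succ]
    refine ⟨hF.nab_inl_mem_valuedIn hE i (derivIn_le _ hs), fun c => ?_⟩
    rw [N.nab_nab]
    exact add_mem (hF.coordCurv_mem_derivIn hE _ _ _ (derivIn_succ_le r hs))
      (Submodule.smul_mem _ _ (ih ((mem_derivIn_succ.1 hs).2 c)))

/-- On values the Euler derivative vanishes and `lam` can be divided out. Even derivatives cost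
nothing, and an odd derivative satisfies an equation of the same shape modulo curvature. -/
theorem IsParallelField.mem_derivIn_of_euler_add (hF : N.IsParallelField p₁ q₁ F)
    (hE : E.IsLocallyFreeSheaf p q) {r : ℕ} {lam : ℝ} (hlam : 0 < lam) {t : E.Sec W}
    (ht : N.euler S hW t + lam • t ∈ N.derivIn F S hW r) : t ∈ N.derivIn F S hW r := by
  induction r generalizing lam t with
  | zero =>
    have h1 : ∀ z (hz : z ∈ W), E.ev z hz (N.euler S hW t + lam • t) ∈ F z := mem_valuedIn.1 ht
    refine mem_valuedIn.2 fun z hz => ?_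
    have h2 := h1 z hz
    rw [map_add, S.ev_eq_zero_of_mem_J_one hW (S.euler_mem_J_one hW N t) hz, zero_add,
      LinearMap.map_smul] at h2
    have h3 := Submodule.smul_mem _ lam⁻¹ h2
    rwa [smul_smul, inv_mul_cancel₀ hlam.ne', one_smul] at h3
  | succ r ih =>
    have htr := ih hlam (derivIn_succ_le r ht)
    rw [mem_derivIn_succ]
    refine ⟨derivIn_le _ htr, fun c => ?_⟩
    cases c with
    | inl i => exact hF.nab_inl_mem_derivIn hE i htr
    | inr a =>
      -- The commutator of an odd derivative with the Euler derivative raises the eigenvalue by one,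
      -- so it stays positive throughout the induction.
      refine ih (lam := 1 + lam) (by positivity) ?_
      have h1 := (mem_derivIn_succ.1 ht).2 (Sum.inr a)
      have h2 : ∑ b, S.xi hW b • N.coordCurv S hW 0 Fin.elim0 (Sum.inr a) (Sum.inr b) t ∈
          N.derivIn F S hW r := Submodule.sum_mem _ fun b _ =>
        smul_mem_derivIn _ (hF.coordCurv_mem_derivIn hE _ _ _ htr)
      have h3 := add_mem h1 h2
      rw [map_add, N.nab_inr_euler, (N.nab S hW (Sum.inr a)).map_smul lam] at h3
      convert h3 using 1
      module

/-- This puts the adapted members of the radial frame into the subsheaf. An odd derivative `u` of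
`t` satisfies `∇_T u + u = ∑ ξ^a R t`, whose right-hand side is known by induction. -/
theorem IsParallelField.mem_derivIn_of_euler_eq_zero (hF : N.IsParallelField p₁ q₁ F)
    (hE : E.IsLocallyFreeSheaf p q) {t : E.Sec W} (ht : t ∈ valuedIn F W)
    (hTt : N.euler S hW t = 0) (r : ℕ) : t ∈ N.derivIn F S hW r := by
  induction r with
  | zero => exact ht
  | succ r ih =>
    rw [mem_derivIn_succ]
    refine ⟨ht, fun c => ?_⟩
    cases c with
    | inl i => exact hF.nab_inl_mem_derivIn hE i ih
    | inr a =>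
      refine hF.mem_derivIn_of_euler_add hE one_pos ?_
      have h2 : ∑ b, S.xi hW b • N.coordCurv S hW 0 Fin.elim0 (Sum.inr a) (Sum.inr b) t ∈
          N.derivIn F S hW r := Submodule.sum_mem _ fun b _ =>
        smul_mem_derivIn _ (hF.coordCurv_mem_derivIn hE _ _ _ ih)
      have h3 := N.nab_inr_euler S hW a t
      rw [hTt, map_zero] at h3
      convert h2 using 1
      rw [eq_comm, sub_eq_zero] at h3
      rw [← h3]
      module

theorem res_euler {V : Opens M} (h : V ≤ W) (s : E.Sec W) :
    E.res h (N.euler S hW s) = N.euler S (h.trans hW) (E.res h s) := by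
  simp only [euler_apply, map_sum, E.res_smul, S.res_xi, N.res_nab]

/-- As the frame is annihilated by `∇_T`, applying `T` to a coefficient of `t` gives the same
coefficient of `∑ ξ^a ∇_a t`. By induction this lies one step deeper in the filtration, and the
invertible action of `T` on the graded piece carries the conclusion back to the coefficient. -/
theorem coef_mem_J {V : Opens M} {hV : V ≤ S.U} {f : Fin p ⊕ Fin q → E.Sec V}
    (hf : E.IsBasis f) (hfT : ∀ A, N.euler S hV (f A) = 0)
    (hfF : ∀ (z : M) (hz : z ∈ V) (v : E.Fiber z), v ∈ F z ↔
      ∀ A, ¬ IsFirst p₁ q₁ A → (hf.fiberBasis hz).repr v A = 0) (hWV : W ≤ V) {r : ℕ}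
    {t : E.Sec W} (ht : t ∈ N.derivIn F S (hWV.trans hV) r) {B : Fin p ⊕ Fin q}
    (hB : ¬ IsFirst p₁ q₁ B) :
    hf.coef hWV t B ∈ S.J (hWV.trans hV) (X.O W) (r + 1) := by
  have hWS := hWV.trans hV
  induction r generalizing t with
  | zero =>
    refine S.mem_J_one_of_val_eq_zero hWS fun z hz => ?_
    rw [← hf.fiberBasis_repr hWV hz]
    exact (hfF z (hWV hz) _).1 (mem_valuedIn.1 ht z hz) B hB
  | succ r ih =>
    have h1 : hf.coef hWV (N.euler S hWS t) B =
        lieDer (S.eulerField hWS) (hf.coef hWV t B) := by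
      have h2 : N.euler S hWS t =
          ∑ A, lieDer (S.eulerField hWS) (hf.coef hWV t A) • E.res hWV (f A) := by
        conv_lhs => rw [← hf.sum_coef hWV t, map_sum]
        refine Finset.sum_congr rfl fun A _ => ?_
        rw [N.euler_smul, ← res_euler (hW := hV) hWV, hfT, map_zero, smul_zero, add_zero]
      rw [h2, hf.coef_sum]
    refine S.mem_J_of_apply hWS (L := lieDer (S.eulerField hWS)) (fun a f => ?_)
      (S.lieDer_eulerField_mem_J_one hWS) (ih (derivIn_succ_le r ht)) ?_
    · rw [smul_eq_mul, smul_eq_mul, lieDer_mul_of_even (S.eulerField_mem hWS),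
        S.lieDer_eulerField_xi]
    · rw [← h1, N.euler_apply, map_sum, Finset.sum_apply]
      refine Submodule.sum_mem _ fun a _ => ?_
      rw [map_smul, Pi.smul_apply]
      exact S.xi_smul_mem_J hWS a (ih ((mem_derivIn_succ.1 ht).2 _))

/-- The parallel subsheaf given by a parallel field of subspaces. -/
theorem IsParallelField.exists_subsheaf [IsManifold (𝓡 n) k M] (hk : k = ∞ ∨ k = ω)
    (hF : N.IsParallelField p₁ q₁ F) (hE : E.IsLocallyFreeSheaf p q) :
    ∃ G : LocallyDirectSubsheaf E p q p₁ q₁, G.IsParallel N := by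
  -- All charts and all orders are required at once, so restriction, gluing and parallelism are
  -- formal; only local directness uses the frame.
  let sec : ∀ U : Opens M, Submodule (X.O U) (E.Sec U) := fun U =>
    { carrier := {s | ∀ (S : X.SuperChart) (V : Opens M) (h : V ≤ U) (hV : V ≤ S.U) (r : ℕ),
        E.res h s ∈ N.derivIn F S hV r}
      add_mem' := fun ha hb S V h hV r => by
        rw [map_add]; exact add_mem (ha S V h hV r) (hb S V h hV r)
      zero_mem' := fun S V h hV r => by rw [map_zero]; exact zero_mem _
      smul_mem' := fun f s hs S V h hV r => by
        rw [E.res_smul]; exact smul_mem_derivIn _ (hs S V h hV r) }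
  have hsec : ∀ {U : Opens M} {s : E.Sec U}, s ∈ sec U ↔ ∀ (S : X.SuperChart) (V : Opens M)
      (h : V ≤ U) (hV : V ≤ S.U) (r : ℕ), E.res h s ∈ N.derivIn F S hV r := Iff.rfl
  have hres : ∀ {V U : Opens M} (h : V ≤ U), ∀ s ∈ sec U, E.res h s ∈ sec V := by
    intro V U h s hs S V' h' hV' r
    rw [E.res_res]
    exact hs S V' _ hV' r
  refine ⟨⟨sec, ?_, hres, ?_, ?_⟩, ?_⟩
  · intro U s hs
    obtain ⟨s₀, h0, s₁, h1, rfl⟩ := E.exists_homogeneous s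
    have key : ∀ (S : X.SuperChart) (V : Opens M) (h : V ≤ U) (hV : V ≤ S.U) (r : ℕ),
        E.res h s₀ ∈ N.derivIn F S hV r ∧ E.res h s₁ ∈ N.derivIn F S hV r := by
      intro S V h hV r
      have := hs S V h hV r
      rw [map_add] at this
      exact graded_derivIn (fun z hz => hF.graded hE S (hV hz)) (E.par_res h 0 _ h0)
        (E.par_res h 1 _ h1) this
    exact ⟨s₀, fun S V h hV r => (key S V h hV r).1, s₁, fun S V h hV r => (key S V h hV r).2,
      h0, h1, rfl⟩
  · intro U s hs S V h hV r
    refine mem_derivIn_of_local fun x hx => ?_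
    obtain ⟨V', h', hxV', hV'⟩ := hs x (h hx)
    refine ⟨V ⊓ V', inf_le_left, ⟨hx, hxV'⟩, ?_⟩
    have := hV' S (V ⊓ V') inf_le_right (inf_le_left.trans hV) r
    rw [E.res_res] at this ⊢
    exact this
  · intro x
    obtain ⟨S, hxS⟩ := exists_superChart hk X x
    obtain ⟨V, hV, hxV, f, hf, hfT, _, hfF⟩ := hF.exists_frame hE S hxS
    refine ⟨V, hxV, f, hf, fun W hWV => le_antisymm ?_ ?_⟩
    · intro t ht
      have hc : ∀ B, ¬ IsFirst p₁ q₁ B → hf.isBasis.coef hWV t B = 0 := by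
        intro B hB
        -- Order `m` is enough: the coefficients outside `F` then lie in step `m + 1` of the
        -- filtration, which is zero.
        have h1 : t ∈ N.derivIn F S (hWV.trans hV) m := by
          have := ht S W le_rfl (hWV.trans hV) m
          rwa [E.res_self] at this
        have h2 := coef_mem_J hf.isBasis hfT hfF hWV h1 hB
        rw [S.J_eq_bot] at h2
        exact h2
      rw [← hf.isBasis.sum_coef hWV t]
      refine Submodule.sum_mem _ fun B _ => ?_
      by_cases hB : IsFirst p₁ q₁ B
      · exact Submodule.smul_mem _ _ (Submodule.subset_span ⟨⟨B, hB⟩, rfl⟩)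
      · rw [hc B hB, zero_smul]
        exact zero_mem _
    · rw [Submodule.span_le]
      rintro _ ⟨⟨A, hA⟩, rfl⟩
      refine hres hWV _ fun S' V' h hV' r => ?_
      have h1 : f A ∈ valuedIn F V := mem_valuedIn.2 fun z hz => (hfF z hz _).2 fun B hB => by
        rw [← hf.isBasis.fiberBasis_apply, Module.Basis.repr_self, Finsupp.single_eq_of_ne]
        rintro rfl
        exact hB hA
      exact mem_derivIn_of_chart hV'
        (res_mem_derivIn h (hF.mem_derivIn_of_euler_eq_zero hE h1 (hfT A) r))
  · intro U Y s hs S V h hV r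
    rw [N.nabla_res]
    exact nabla_mem_derivIn (hs S V h hV (r + 1)) _

end Parallel

end Connection

end Supermanifold

end

noncomputable section

namespace Supermanifold

variable {k : WithTop ℕ∞} {n m : ℕ} {M : Type u} [TopologicalSpace M]
  [ChartedSpace (EuclideanSpace ℝ (Fin n)) M] {X : Supermanifold k n m M}
  {E : X.SuperModulePresheaf} {p q p₁ q₁ : ℕ}

open SuperModulePresheaf

/-! ### From an invariant subspace to a parallel field -/

namespace SuperModulePresheaf

theorem IsEvenIso.symm {y z : M} {τ : E.Fiber y ≃ₗ[ℝ] E.Fiber z} (h : IsEvenIso τ) :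
    IsEvenIso τ.symm := fun j v => by
  rw [h j (τ.symm v), LinearEquiv.apply_symm_apply]

theorem IsEvenIso.trans {x y z : M} {τ : E.Fiber x ≃ₗ[ℝ] E.Fiber y} {τ' : E.Fiber y ≃ₗ[ℝ] E.Fiber z}
    (h : IsEvenIso τ) (h' : IsEvenIso τ') : IsEvenIso (τ.trans τ') := fun j v =>
  (h j v).trans (h' j (τ v))

theorem IsSuperSubspace.map {y z : M} {τ : E.Fiber y ≃ₗ[ℝ] E.Fiber z} (h : IsEvenIso τ)
    {F : Submodule ℝ (E.Fiber y)} (hF : IsSuperSubspace F p₁ q₁) :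
    IsSuperSubspace (F.map τ.toLinearMap) p₁ q₁ := by
  have key : ∀ j, F.map τ.toLinearMap ⊓ E.fiberPar z j =
      (F ⊓ E.fiberPar y j).map τ.toLinearMap := by
    intro j
    ext v
    constructor
    · rintro ⟨⟨u, hu, rfl⟩, hv⟩
      exact ⟨u, ⟨hu, (h j u).2 hv⟩, rfl⟩
    · rintro ⟨u, hu, rfl⟩
      exact ⟨⟨u, hu.1, rfl⟩, (h j u).1 hu.2⟩
  refine ⟨?_, ?_, ?_⟩
  · rw [key, key, ← Submodule.map_sup, ← hF.graded]
  · rw [key, ← hF.dim_even]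
    exact LinearEquiv.finrank_map_eq τ _
  · rw [key, ← hF.dim_odd]
    exact LinearEquiv.finrank_map_eq τ _

end SuperModulePresheaf

namespace Connection

/-- The points `x` and `y` are joined by an even parallel displacement whose inverse is a parallel
displacement. -/
def Linked (N : Connection E ⊤) (x y : M) : Prop :=
  ∃ τ : E.Fiber x ≃ₗ[ℝ] E.Fiber y, N.IsTransport x y τ ∧ N.IsTransport y x τ.symm ∧ IsEvenIso τ

variable {N : Connection E ⊤}

theorem Linked.symm {x y : M} (h : N.Linked x y) : N.Linked y x := by
  obtain ⟨τ, h1, h2, h3⟩ := h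
  exact ⟨τ.symm, h2, h1, h3.symm⟩

theorem Linked.trans {x y z : M} (h : N.Linked x y) (h' : N.Linked y z) : N.Linked x z := by
  obtain ⟨τ, h1, h2, h3⟩ := h
  obtain ⟨τ', h1', h2', h3'⟩ := h'
  exact ⟨τ.trans τ', h1.trans h1', h2'.trans h2, h3.trans h3'⟩

/-- The displacements along a coordinate ray and back are inverse to each other and keep coordinates
in a homogeneous frame. This local statement is what connectedness propagates. -/
theorem eventually_linked [IsManifold (𝓡 n) k M] (hk : k = ∞ ∨ k = ω) (N : Connection E ⊤)
    (hE : E.IsLocallyFreeSheaf p q) (x : M) : ∀ᶠ y in 𝓝 x, N.Linked x y := by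
  obtain ⟨S, hxS⟩ := exists_superChart hk X x
  obtain ⟨U, hxU, e, he⟩ := hE.locallyFree x
  obtain ⟨V, hV, hxV, f, hf, _, _, _, hft⟩ := N.exists_radial_frame S hxS hxU he
  filter_upwards [V.2.mem_nhds hxV] with y hy
  refine ⟨hf.isBasis.frameIso hxV hy, (hft y hy).1, ?_, hf.isEvenIso_frameIso S hV hxV hy⟩
  have : (hf.isBasis.frameIso hxV hy).symm = hf.isBasis.frameIso hy hxV := by
    simp [IsBasis.frameIso]
  rw [this]
  exact (hft y hy).2

/-- Going out along `τ`, across along `σ` and back along the inverse of `τ'` is a loop, so it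
preserves the subspace. The base points are separate variables joined by an equation, so that the
types agree after substitution. -/
theorem mem_of_isTransport {x x' y z : M} (hx : x = x') (F₀ : ∀ x : M, Submodule ℝ (E.Fiber x))
    (hF : ∀ τ ∈ N.Hol x, (F₀ x).map τ.toLinearMap = F₀ x)
    {τ : E.Fiber x ≃ₗ[ℝ] E.Fiber y} (hτ : N.IsTransport x y τ)
    {τ' : E.Fiber x' ≃ₗ[ℝ] E.Fiber z} (hτ' : N.IsTransport z x' τ'.symm)
    {σ : E.Fiber y ≃ₗ[ℝ] E.Fiber z} (hσ : N.IsTransport y z σ) {v : E.Fiber y}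
    (hv : v ∈ (F₀ x).map τ.toLinearMap) : σ v ∈ (F₀ x').map τ'.toLinearMap := by
  subst hx
  obtain ⟨u, hu, rfl⟩ := hv
  have h1 := hF _ (Subgroup.subset_closure ((hτ.trans hσ).trans hτ'))
  refine ⟨τ'.symm (σ (τ u)), ?_, τ'.apply_symm_apply _⟩
  have h2 : ((τ.trans σ).trans τ'.symm) u ∈
      (F₀ x).map ((τ.trans σ).trans τ'.symm).toLinearMap := ⟨u, hu, rfl⟩
  rw [h1] at h2
  exact h2

/-- The subspace at the base point is carried along one chosen displacement. A generator of the
holonomy algebra is a covariant derivative of the curvature conjugated in just this way, so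
invariance at the base point becomes invariance at `y`. -/
theorem exists_isParallelField (N : Connection E ⊤) (base : M → M)
    (hbase : ∀ y, N.Linked (base y) y) (hconst : ∀ y z, N.Linked y z → base y = base z)
    (F₀ : ∀ x : M, Submodule ℝ (E.Fiber x))
    (hF₀ : ∀ y, N.IsHolInvariant (base y) p₁ q₁ (F₀ (base y))) :
    ∃ F, N.IsParallelField p₁ q₁ F := by
  choose τ h1 h2 h3 using hbase
  refine ⟨fun y => (F₀ (base y)).map (τ y).toLinearMap, fun y => (hF₀ y).superSubspace.map (h3 y),
    fun y z σ hσ hσ' hσe v hv => ?_, fun y U hy N' r Y A B T hT v hv => ?_⟩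
  · exact mem_of_isTransport (hconst y z ⟨σ, hσ, hσ', hσe⟩) F₀ (hF₀ y).Hol_map_eq (h1 y) (h2 z) hσ hv
  · obtain ⟨u, hu, rfl⟩ := hv
    have hgen : (τ y).symm.toLinearMap ∘ₗ T ∘ₗ (τ y).toLinearMap ∈ N.holAlg (base y) := by
      refine Submodule.mem_sInf.2 fun L hL => hL.1 ?_
      exact ⟨y, τ y, h1 y, U, hy, N', r, Y, A, B, T, hT, rfl⟩
    refine ⟨(τ y).symm (T (τ y u)), (hF₀ y).holAlg_map_le _ hgen ⟨u, hu, rfl⟩,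
      (τ y).apply_symm_apply _⟩

end Connection

end Supermanifold

/-! ### A linear differential inequality -/

/-- Gronwall's inequality gives uniqueness forward in time, and the reflection `t ↦ -t` gives it
backward. -/
theorem eq_zero_of_norm_deriv_le {G : Type*} [NormedAddCommGroup G] [NormedSpace ℝ G]
    {x : ℝ → G} {a b K : ℝ}
    (h : ∀ t ∈ Icc a b, ∃ x', HasDerivWithinAt x x' (Icc a b) t ∧ ‖x'‖ ≤ K * ‖x t‖)
    {t₁ t₂ : ℝ} (h₁ : t₁ ∈ Icc a b) (h₂ : t₂ ∈ Icc a b) (h0 : x t₁ = 0) : x t₂ = 0 := by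
  have fwd : ∀ (x : ℝ → G) (a b : ℝ),
      (∀ t ∈ Icc a b, ∃ x', HasDerivWithinAt x x' (Icc a b) t ∧ ‖x'‖ ≤ K * ‖x t‖) →
      ∀ t₁ ∈ Icc a b, ∀ t₂ ∈ Icc a b, t₁ ≤ t₂ → x t₁ = 0 → x t₂ = 0 := by
    intro x a b h t₁ h₁ t₂ h₂ hle h0
    choose! x' hx' hb using h
    have hsub : Icc t₁ t₂ ⊆ Icc a b := Icc_subset_Icc h₁.1 h₂.2
    refine eq_zero_of_abs_deriv_le_mul_abs_self_of_eq_zero_right (f' := x') (K := K)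
      (fun t ht => ((hx' t (hsub ht)).mono hsub).continuousWithinAt) (fun t ht => ?_) h0
      (fun t ht => hb t (hsub (Ico_subset_Icc_self ht))) t₂ ⟨hle, le_rfl⟩
    refine (hx' t (hsub (Ico_subset_Icc_self ht))).mono_of_mem_nhdsWithin ?_
    exact Icc_mem_nhdsGE_of_mem ⟨h₁.1.trans ht.1, lt_of_lt_of_le ht.2 h₂.2⟩
  rcases le_total t₁ t₂ with hle | hle
  · exact fwd x a b h t₁ h₁ t₂ h₂ hle h0
  · have := fwd (fun s => x (-s)) (-b) (-a) (fun t ht => ?_) (-t₁) ⟨by linarith [h₁.2],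
      by linarith [h₁.1]⟩ (-t₂) ⟨by linarith [h₂.2], by linarith [h₂.1]⟩ (by linarith)
      (by simpa using h0)
    · simpa using this
    · obtain ⟨x', hx', hb⟩ := h (-t) ⟨by linarith [ht.2], by linarith [ht.1]⟩
      refine ⟨-x', ?_, by simpa using hb⟩
      have h1 : HasDerivWithinAt (fun s : ℝ => -s) (-1) (Icc (-b) (-a)) t :=
        (hasDerivAt_neg t).hasDerivWithinAt
      have h2 : HasDerivWithinAt (fun s => x (-s)) ((-1 : ℝ) • x') (Icc (-b) (-a)) t :=
        hx'.scomp t h1 fun s hs => ⟨by linarith [hs.2], by linarith [hs.1]⟩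
      rwa [neg_one_smul] at h2

namespace Supermanifold

variable {k : WithTop ℕ∞} {n m : ℕ} {M : Type u} [TopologicalSpace M]
  [ChartedSpace (EuclideanSpace ℝ (Fin n)) M] {X : Supermanifold k n m M}
  {E : X.SuperModulePresheaf} {p q p₁ q₁ : ℕ}

open SuperModulePresheaf

namespace Connection

variable {N : Connection E ⊤}

/-! ### The parallel displacement in a basis -/

theorem IsVelocity.hasDerivWithinAt {γ : ℝ → M} {a b t : ℝ} {V : Opens M} {Y : X.tangent.Sec V}
    (hY : IsVelocity γ a b t Y) (hγ : ContinuousWithinAt γ (Icc a b) t) {W W' : Opens M}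
    (hV : W' ≤ V) (hW : W' ≤ W) (ht : γ t ∈ W') (f : X.O W) :
    HasDerivWithinAt (fun s => X.val f (γ s))
      (X.val (lieDer (X.tangent.res hV Y) (X.res hW f)) (γ t)) (Icc a b) t := by
  refine (hY W' hV ht (X.res hW f)).congr_of_eventuallyEq ?_ (val_res hW f ht).symm
  filter_upwards [hγ.eventually (W'.2.mem_nhds ht)] with s hs
  exact (val_res hW f hs).symm

/-- A parallel section comes with some basis `e₁` of the definition, while the argument needs an
adapted one. The transition coefficients are differentiated along the curve and combined with the
Leibniz rule to give the parallel transport equation in `e₂`. -/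
theorem hasDerivWithinAt_coef {ι κ : Type} [Fintype ι] [Fintype κ] {U₁ U₂ : Opens M}
    {e₁ : κ → E.Sec U₁} {e₂ : ι → E.Sec U₂} (hb : E.IsBasis e₂) {γ : ℝ → M} {a b t : ℝ}
    (hγ : ContinuousWithinAt γ (Icc a b) t) {c : κ → ℝ → ℝ} {c' : κ → ℝ}
    (hc : ∀ A, HasDerivWithinAt (c A) (c' A) (Icc a b) t) {W : Opens M} (hW₁ : W ≤ U₁)
    (hW₂ : W ≤ U₂) {V : Opens M} (hV : V ≤ U₁) {Y : X.tangent.Sec V} (hY : Y ∈ X.tangent.par V 0)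
    (hv : IsVelocity γ a b t Y) (htU : γ t ∈ U₁) (htV : γ t ∈ V) {W' : Opens M} (hW'V : W' ≤ V)
    (hW' : W' ≤ W) (ht' : γ t ∈ W')
    (hpar : ∑ A, (c' A • E.ev (γ t) htU (e₁ A) +
      c A t • E.ev (γ t) htV (N.nabla V le_top Y (E.res hV (e₁ A)))) = 0) (C : ι) :
    HasDerivWithinAt (fun s => ∑ A, c A s * X.val (hb.coef hW₂ (E.res hW₁ (e₁ A)) C) (γ s))
      (-∑ D, (∑ A, c A t * X.val (hb.coef hW₂ (E.res hW₁ (e₁ A)) D) (γ t)) *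
        X.val (hb.coef (hW'.trans hW₂)
          (N.nabla W' le_top (X.tangent.res hW'V Y) (E.res (hW'.trans hW₂) (e₂ D))) C) (γ t))
      (Icc a b) t := by
  classical
  set Y' := X.tangent.res hW'V Y with hY'
  have hY'e : Y' ∈ X.tangent.par W' 0 := X.tangent.par_res hW'V 0 _ hY
  let P : κ → ι → X.O W := fun A D => hb.coef hW₂ (E.res hW₁ (e₁ A)) D
  have h1 : ∀ A, HasDerivWithinAt (fun s => c A s * X.val (P A C) (γ s))
      (c' A * X.val (P A C) (γ t) + c A t * X.val (lieDer Y' (X.res hW' (P A C))) (γ t))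
      (Icc a b) t := fun A => (hc A).mul (hv.hasDerivWithinAt hγ hW'V hW' ht' (P A C))
  have h2 := HasDerivWithinAt.fun_sum fun A (_ : A ∈ Finset.univ) => h1 A
  have hrep := congrArg (fun v => (hb.fiberBasis (hW₂ (hW' ht'))).repr v C) hpar
  have hterm : ∀ A, (hb.fiberBasis (hW₂ (hW' ht'))).repr (c' A • E.ev (γ t) htU (e₁ A) +
      c A t • E.ev (γ t) htV (N.nabla V le_top Y (E.res hV (e₁ A)))) C =
      c' A * X.val (P A C) (γ t) + c A t * (X.val (lieDer Y' (X.res hW' (P A C))) (γ t) +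
        ∑ D, X.val (P A D) (γ t) * X.val (hb.coef (hW'.trans hW₂)
          (N.nabla W' le_top Y' (E.res (hW'.trans hW₂) (e₂ D))) C) (γ t)) := by
    intro A
    have e1 : E.ev (γ t) htU (e₁ A) = E.ev (γ t) (hW' ht') (E.res hW₁ (e₁ A)) :=
      (E.ev_res hW₁ (hW' ht') (e₁ A)).symm
    have e2 : E.ev (γ t) htV (N.nabla V le_top Y (E.res hV (e₁ A))) =
        E.ev (γ t) ht' (N.nabla W' le_top Y' (E.res (hW'.trans hW₁) (e₁ A))) := by
      rw [← E.ev_res hW'V ht', N.nabla_res, E.res_res]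
    have e3 : E.res (hW'.trans hW₁) (e₁ A) =
        ∑ D, X.res hW' (P A D) • E.res (hW'.trans hW₂) (e₂ D) := by
      rw [← E.res_res hW' hW₁, ← hb.sum_coef hW₂ (E.res hW₁ (e₁ A)), map_sum]
      exact Finset.sum_congr rfl fun D _ => by rw [E.res_smul, E.res_res]
    have e4 : hb.coef (hW'.trans hW₂)
        (N.nabla W' le_top Y' (E.res (hW'.trans hW₁) (e₁ A))) C =
        lieDer Y' (X.res hW' (P A C)) + ∑ D, X.res hW' (P A D) * hb.coef (hW'.trans hW₂)
          (N.nabla W' le_top Y' (E.res (hW'.trans hW₂) (e₂ D))) C := by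
      rw [e3, map_sum]
      simp only [N.nabla_smul_of_even hY'e]
      rw [Finset.sum_add_distrib, map_add, Pi.add_apply, hb.coef_sum, map_sum, Finset.sum_apply]
      congr 1
      exact Finset.sum_congr rfl fun D _ => by rw [map_smul, Pi.smul_apply, smul_eq_mul]
    rw [map_add, Finsupp.add_apply, map_smul, map_smul, Finsupp.smul_apply, Finsupp.smul_apply,
      e1, e2, hb.fiberBasis_repr hW₂ (hW' ht'), hb.fiberBasis_repr (hW'.trans hW₂) ht', e4,
      val_eq (_ + _) ht', map_add, map_sum, ← val_eq _ ht']
    have e6 : ∀ g : X.O W', ∀ D, X.valHom ht' (X.res hW' (P A D) * g) =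
        X.val (P A D) (γ t) * X.val g (γ t) := fun g D => by
      rw [map_mul, ← val_eq _ ht', ← val_eq _ ht', val_res hW' _ ht']
    simp only [e6, smul_eq_mul]
    rfl
  simp only [map_sum, Finsupp.finsetSum_apply, hterm, map_zero, Finsupp.zero_apply] at hrep
  refine h2.congr_deriv ?_
  rw [eq_neg_iff_add_eq_zero, ← hrep]
  have e5 : ∑ D, (∑ A, c A t * X.val (P A D) (γ t)) * X.val (hb.coef (hW'.trans hW₂)
        (N.nabla W' le_top Y' (E.res (hW'.trans hW₂) (e₂ D))) C) (γ t) =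
      ∑ A, c A t * ∑ D, X.val (P A D) (γ t) * X.val (hb.coef (hW'.trans hW₂)
        (N.nabla W' le_top Y' (E.res (hW'.trans hW₂) (e₂ D))) C) (γ t) := by
    simp only [Finset.sum_mul, Finset.mul_sum, mul_assoc]
    exact Finset.sum_comm
  change _ + ∑ D, (∑ A, c A t * X.val (P A D) (γ t)) * _ = _
  rw [e5, ← Finset.sum_add_distrib]
  exact Finset.sum_congr rfl fun A _ => by ring

end Connection

end Supermanifold

end

/-! ### From a parallel subsheaf to invariant subspaces. -/

noncomputable section

namespace Supermanifold

variable {k : WithTop ℕ∞} {n m : ℕ} {M : Type u} [TopologicalSpace M]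
  [ChartedSpace (EuclideanSpace ℝ (Fin n)) M] {X : Supermanifold k n m M}
  {E : X.SuperModulePresheaf} {p q p₁ q₁ : ℕ}

open SuperModulePresheaf

/-! ### The fibres of a locally direct subsheaf -/

namespace LocallyDirectSubsheaf

variable (G : LocallyDirectSubsheaf E p q p₁ q₁)

/-- The values at a point of the sections of a subsheaf. -/
def fiber (x : M) : Submodule ℝ (E.Fiber x) :=
  ⨆ (V : Opens M) (hx : x ∈ V), ((G.sec V).restrictScalars ℝ).map (E.ev x hx)

variable {G}

theorem ev_mem_fiber {V : Opens M} {x : M} (hx : x ∈ V) {s : E.Sec V} (hs : s ∈ G.sec V) :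
    E.ev x hx s ∈ G.fiber x :=
  (le_iSup₂_of_le (f := fun (V : Opens M) (hx : x ∈ V) =>
    ((G.sec V).restrictScalars ℝ).map (E.ev x hx)) V hx le_rfl) ⟨s, hs, rfl⟩

variable (G) in
/-- A homogeneous basis of the sheaf whose first members form a basis of the subsheaf. -/
structure IsAdapted {U : Opens M} (e : Fin p ⊕ Fin q → E.Sec U) : Prop where
  isSuperBasis : E.IsSuperBasis e
  sec_eq : ∀ (W : Opens M) (h : W ≤ U), G.sec W = Submodule.span (X.O W)
    (range fun A : {A : Fin p ⊕ Fin q // IsFirst p₁ q₁ A} => E.res h (e A.1))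

namespace IsAdapted

variable {U : Opens M} {e : Fin p ⊕ Fin q → E.Sec U} (he : G.IsAdapted e)

theorem mem_sec (he : G.IsAdapted e) {A : Fin p ⊕ Fin q} (hA : IsFirst p₁ q₁ A) {W : Opens M}
    (h : W ≤ U) : E.res h (e A) ∈ G.sec W := by
  rw [he.sec_eq W h]
  exact Submodule.subset_span ⟨⟨A, hA⟩, rfl⟩

theorem coef_eq_zero (he : G.IsAdapted e) {W : Opens M} (h : W ≤ U) {s : E.Sec W}
    (hs : s ∈ G.sec W) {B : Fin p ⊕ Fin q} (hB : ¬ IsFirst p₁ q₁ B) :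
    he.isSuperBasis.isBasis.coef h s B = 0 := by
  have : G.sec W ≤ LinearMap.ker ((LinearMap.proj B) ∘ₗ he.isSuperBasis.isBasis.coef h) := by
    rw [he.sec_eq W h, Submodule.span_le]
    rintro _ ⟨A, rfl⟩
    have hne : B ≠ A.1 := fun hBA => hB (hBA ▸ A.2)
    rw [SetLike.mem_coe, LinearMap.mem_ker, LinearMap.comp_apply,
      he.isSuperBasis.isBasis.coef_basis, LinearMap.proj_apply, Pi.single_eq_of_ne hne]
  exact this hs

theorem mem_fiber_iff (he : G.IsAdapted e) {x : M} (hx : x ∈ U) {v : E.Fiber x} :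
    v ∈ G.fiber x ↔
      ∀ B, ¬ IsFirst p₁ q₁ B → (he.isSuperBasis.isBasis.fiberBasis hx).repr v B = 0 := by
  constructor
  · intro hv B hB
    have : G.fiber x ≤ LinearMap.ker ((he.isSuperBasis.isBasis.fiberBasis hx).coord B) := by
      refine iSup₂_le fun V hxV => ?_
      rintro _ ⟨s, hs, rfl⟩
      rw [LinearMap.mem_ker, Module.Basis.coord_apply,
        ← E.ev_res (inf_le_left : V ⊓ U ≤ V) ⟨hxV, hx⟩,
        he.isSuperBasis.isBasis.fiberBasis_repr inf_le_right ⟨hxV, hx⟩,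
        he.coef_eq_zero inf_le_right (G.res_mem inf_le_left s hs) hB]
      rw [val_eq _ (⟨hxV, hx⟩ : x ∈ V ⊓ U), map_zero]
    exact this hv
  · intro hv
    rw [← (he.isSuperBasis.isBasis.fiberBasis hx).sum_repr v]
    refine Submodule.sum_mem _ fun A _ => ?_
    by_cases hA : IsFirst p₁ q₁ A
    · refine Submodule.smul_mem _ _ ?_
      rw [he.isSuperBasis.isBasis.fiberBasis_apply, ← E.res_self (e A)]
      exact ev_mem_fiber hx (he.mem_sec hA le_rfl)
    · rw [hv A hA, zero_smul]
      exact zero_mem _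

theorem isSuperSubspace_fiber (he : G.IsAdapted e) (S : X.SuperChart) {x : M} (hxS : x ∈ S.U)
    (hx : x ∈ U) (hp : p₁ ≤ p) (hq : q₁ ≤ q) : IsSuperSubspace (G.fiber x) p₁ q₁ := by
  have hb := he.isSuperBasis
  have hmem : ∀ j v, v ∈ G.fiber x ⊓ E.fiberPar x j ↔ ∀ A, ¬ (IsFirst p₁ q₁ A ∧ coordPar A = j) →
      (hb.isBasis.fiberBasis hx).repr v A = 0 := by
    intro j v
    rw [Submodule.mem_inf, he.mem_fiber_iff hx, hb.mem_fiberPar_iff S hxS hx]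
    constructor
    · rintro ⟨h1, h2⟩ A hA
      by_cases hA1 : IsFirst p₁ q₁ A
      · exact h2 A fun hA2 => hA ⟨hA1, hA2⟩
      · exact h1 A hA1
    · intro h
      exact ⟨fun A hA => h A fun h' => hA h'.1, fun A hA => h A fun h' => hA h'.2⟩
  refine ⟨le_antisymm (fun v hv => ?_) (sup_le inf_le_left inf_le_left), ?_, ?_⟩
  · obtain ⟨v₀, h0, v₁, h1, rfl⟩ := Submodule.mem_sup.1
      ((hb.fiberPar_isCompl S hxS hx).sup_eq_top ▸ Submodule.mem_top :
        v ∈ E.fiberPar x 0 ⊔ E.fiberPar x 1)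
    have h0' := (hb.mem_fiberPar_iff S hxS hx 0 v₀).1 h0
    have h1' := (hb.mem_fiberPar_iff S hxS hx 1 v₁).1 h1
    rw [he.mem_fiber_iff hx] at hv
    refine Submodule.add_mem_sup ⟨(he.mem_fiber_iff hx).2 fun A hA => ?_, h0⟩
      ⟨(he.mem_fiber_iff hx).2 fun A hA => ?_, h1⟩
    · by_cases hA0 : coordPar A = 0
      · have := hv A hA
        rwa [map_add, Finsupp.add_apply, h1' A (by rw [hA0]; decide), add_zero] at this
      · exact h0' A hA0
    · by_cases hA1 : coordPar A = 1
      · have := hv A hA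
        rwa [map_add, Finsupp.add_apply, h0' A (by rw [hA1]; decide), zero_add] at this
      · exact h1' A hA1
  · rw [finrank_eq_card_of_mem_iff_repr _ _ (hmem 0), card_isFirst_even hp]
  · rw [finrank_eq_card_of_mem_iff_repr _ _ (hmem 1), card_isFirst_odd hq]

end IsAdapted

variable (G) in
theorem exists_isAdapted (x : M) : ∃ U : Opens M, x ∈ U ∧
    ∃ e : Fin p ⊕ Fin q → E.Sec U, G.IsAdapted e := by
  obtain ⟨U, hx, e, he, h⟩ := G.locally_direct x
  exact ⟨U, hx, e, he, h⟩

theorem IsParallel.covCurv_mem {N : Connection E ⊤} (hG : G.IsParallel N) {U : Opens M}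
    (N' : Connection X.tangent U) {V : Opens M} (hV : V ≤ U) (r : ℕ)
    (Y : Fin r → X.tangent.HomSec V) (A B : X.tangent.HomSec V) {s : E.Sec V}
    (hs : s ∈ G.sec V) : N.covCurv N' hV r Y A B s ∈ G.sec V := by
  induction r generalizing A B s with
  | zero =>
    exact sub_mem (sub_mem (hG V _ _ (hG V _ _ hs))
      (Submodule.smul_of_tower_mem _ _ (hG V _ _ (hG V _ _ hs)))) (hG V _ _ hs)
  | succ r ih =>
    refine sub_mem (sub_mem (sub_mem (sub_mem (hG V _ _ (ih _ _ _ hs)) ?_) ?_) ?_) ?_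
    · rw [LinearMap.sum_apply]
      exact Submodule.sum_mem _ fun l _ => Submodule.smul_of_tower_mem _ _ (ih _ _ _ hs)
    · exact Submodule.smul_of_tower_mem _ _ (ih _ _ _ hs)
    · exact Submodule.smul_of_tower_mem _ _ (ih _ _ _ hs)
    · exact Submodule.smul_of_tower_mem _ _ (ih _ _ _ (hG V _ _ hs))

theorem IsParallel.isCovCurvAt_mem {N : Connection E ⊤} (hG : G.IsParallel N) {U : Opens M}
    {N' : Connection X.tangent U} {y : M} (hy : y ∈ U) {r : ℕ} {Y : Fin r → X.tangent.HomSec U}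
    {A B : X.tangent.HomSec U} {T : Module.End ℝ (E.Fiber y)}
    (hT : N.IsCovCurvAt N' y r Y A B T) {v : E.Fiber y} (hv : v ∈ G.fiber y) :
    T v ∈ G.fiber y := by
  have : G.fiber y ≤ (G.fiber y).comap T := by
    refine iSup₂_le fun V hyV => ?_
    rintro _ ⟨s, hs, rfl⟩
    rw [Submodule.mem_comap, ← E.ev_res (inf_le_left : V ⊓ U ≤ V) ⟨hyV, hy⟩,
      hT (V ⊓ U) inf_le_right ⟨hyV, hy⟩]
    exact ev_mem_fiber _ (hG.covCurv_mem N' _ r _ _ _ (G.res_mem inf_le_left s hs))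
  exact this hv

end LocallyDirectSubsheaf

/-! ### The stabilizer of a subspace in the Lie superalgebra of a fibre -/

/-- The endomorphisms that preserve a subspace. -/
def stabilizerEnd {V : Type*} [AddCommGroup V] [Module ℝ V] (F : Submodule ℝ V) :
    Submodule ℝ (Module.End ℝ V) where
  carrier := {A | ∀ v ∈ F, A v ∈ F}
  add_mem' hA hB v hv := add_mem (hA v hv) (hB v hv)
  zero_mem' _ _ := zero_mem _
  smul_mem' c _ hA v hv := Submodule.smul_mem _ c (hA v hv)

/-- The parity projections preserve a graded subspace, so the even and the odd component of an
endomorphism that preserves it do so too. -/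
theorem isSuperSubalgebra_stabilizerEnd {x : M} {F : Submodule ℝ (E.Fiber x)}
    (hc : IsCompl (E.fiberPar x 0) (E.fiberPar x 1))
    (hF : F = (F ⊓ E.fiberPar x 0) ⊔ (F ⊓ E.fiberPar x 1)) :
    IsSuperSubalgebra (stabilizerEnd F) := by
  have hor : ∀ a : ZMod 2, a = 0 ∨ a = 1 := by decide
  have hproj : ∃ π : ZMod 2 → Module.End ℝ (E.Fiber x), (∀ j v, π j v ∈ E.fiberPar x j) ∧
      (∀ j, ∀ v ∈ E.fiberPar x j, π j v = v) ∧
      (∀ j, ∀ v ∈ E.fiberPar x j, π (j + 1) v = 0) ∧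
      (∀ v, v = π 0 v + π 1 v) := by
    let π₀ : Module.End ℝ (E.Fiber x) := (E.fiberPar x 0).projection (E.fiberPar x 1) hc
    have h1 : ∀ v, π₀ v ∈ E.fiberPar x 0 := fun v => Submodule.projection_apply_mem hc v
    have h2 : ∀ v ∈ E.fiberPar x 0, π₀ v = v := fun v hv =>
      Submodule.projection_apply_left hc ⟨v, hv⟩
    have h3 : ∀ v ∈ E.fiberPar x 1, π₀ v = 0 := fun v hv =>
      (Submodule.projection_apply_eq_zero_iff hc).2 hv
    have h4 : ∀ v, v - π₀ v ∈ E.fiberPar x 1 := fun v => by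
      rw [← Submodule.projection_apply_eq_zero_iff hc, map_sub]
      exact sub_eq_zero.2 (h2 _ (h1 v)).symm
    refine ⟨fun j => if j = 0 then π₀ else 1 - π₀, ?_, ?_, ?_, ?_⟩
    · intro j v
      obtain rfl | rfl := hor j
      · exact h1 v
      · exact h4 v
    · intro j v hv
      obtain rfl | rfl := hor j
      · exact h2 v hv
      · change v - π₀ v = v
        rw [h3 v hv, sub_zero]
    · intro j v hv
      obtain rfl | rfl := hor j
      · change v - π₀ v = 0
        rw [h2 v hv, sub_self]
      · exact h3 v hv
    · intro v
      exact (add_sub_cancel (π₀ v) v).symm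
  obtain ⟨π, hm, hid, hz, hsum⟩ := hproj
  have hπF : ∀ j, ∀ v ∈ F, π j v ∈ F := by
    intro j v hv
    rw [hF] at hv
    obtain ⟨v₀, h0, v₁, h1, rfl⟩ := Submodule.mem_sup.1 hv
    rw [map_add]
    obtain rfl | rfl := hor j
    · have : π 0 v₁ = 0 := hz 1 v₁ h1.2
      rw [hid 0 v₀ h0.2, this, add_zero]
      exact h0.1
    · have : π 1 v₀ = 0 := hz 0 v₀ h0.2
      rw [hid 1 v₁ h1.2, this, zero_add]
      exact h1.1
  refine ⟨le_antisymm (fun A hA => ?_) (sup_le inf_le_left inf_le_left), ?_⟩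
  · let P : ZMod 2 → Module.End ℝ (E.Fiber x) := fun i => π i * A * π 0 + π (i + 1) * A * π 1
    have hP : ∀ i, P i ∈ stabilizerEnd F ⊓ E.glPar x i := by
      refine fun i => ⟨fun v hv => add_mem (hπF _ _ (hA _ (hπF _ _ hv)))
        (hπF _ _ (hA _ (hπF _ _ hv))), fun j v hv => ?_⟩
      have e : P i v = π i (A (π 0 v)) + π (i + 1) (A (π 1 v)) := rfl
      obtain rfl | rfl := hor j
      · have : π 1 v = 0 := hz 0 v hv
        rw [e, this, map_zero, map_zero, add_zero, add_zero]
        exact hm _ _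
      · have : π 0 v = 0 := hz 1 v hv
        rw [e, this, map_zero, map_zero, zero_add]
        exact hm _ _
    have hAP : A = P 0 + P 1 := by
      refine LinearMap.ext fun v => ?_
      calc A v = A (π 0 v) + A (π 1 v) := by rw [← map_add, ← hsum]
        _ = (π 0 (A (π 0 v)) + π 1 (A (π 0 v))) + (π 0 (A (π 1 v)) + π 1 (A (π 1 v))) := by
          rw [← hsum, ← hsum]
        _ = (π 0 (A (π 0 v)) + π 1 (A (π 1 v))) + (π 1 (A (π 0 v)) + π 0 (A (π 1 v))) := by
          abel
        _ = (P 0 + P 1) v := rfl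
    rw [hAP]
    exact Submodule.add_mem_sup (hP 0) (hP 1)
  · intro i j A B hA _ hB _
    exact sub_mem (fun v hv => hA _ (hB v hv))
      (Submodule.smul_mem _ _ (fun v hv => hB _ (hA v hv)))

end Supermanifold

end

noncomputable section

theorem exists_Icc_of_eventually {a b t₀ : ℝ} (hab : a < b) (ht : t₀ ∈ Icc a b) {P : ℝ → Prop}
    (h : ∀ᶠ t in 𝓝[Icc a b] t₀, P t) : ∃ c d, c < d ∧ t₀ ∈ Icc c d ∧ Icc c d ⊆ Icc a b ∧
      Icc c d ∈ 𝓝[Icc a b] t₀ ∧ ∀ t ∈ Icc c d, P t := by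
  obtain ⟨δ, hδ, hP⟩ := Metric.mem_nhdsWithin_iff.1 h
  refine ⟨max a (t₀ - δ / 2), min b (t₀ + δ / 2), ?_, ⟨?_, ?_⟩, ?_, ?_, ?_⟩
  · refine max_lt (lt_min hab ?_) (lt_min ?_ ?_) <;> linarith [ht.1, ht.2]
  · exact max_le ht.1 (by linarith)
  · exact le_min ht.2 (by linarith)
  · exact Icc_subset_Icc (le_max_left _ _) (min_le_left _ _)
  · refine Metric.mem_nhdsWithin_iff.2 ⟨δ / 2, half_pos hδ, ?_⟩
    rintro t ⟨ht1, ht2⟩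
    rw [Metric.mem_ball, Real.dist_eq, abs_lt] at ht1
    exact ⟨max_le ht2.1 (by linarith), le_min ht2.2 (by linarith)⟩
  · intro t ht'
    have h1 := (max_le_iff.1 ht'.1)
    have h2 := (le_min_iff.1 ht'.2)
    refine hP ⟨?_, h1.1, h2.1⟩
    rw [Metric.mem_ball, Real.dist_eq, abs_lt]
    constructor <;> linarith

namespace Supermanifold

variable {k : WithTop ℕ∞} {n m : ℕ} {M : Type u} [TopologicalSpace M]
  [ChartedSpace (EuclideanSpace ℝ (Fin n)) M] {X : Supermanifold k n m M}
  {E : X.SuperModulePresheaf} {p q p₁ q₁ : ℕ}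

open SuperModulePresheaf

/-! ### Bounds along a curve -/

theorem continuousOn_val {W : Opens M} (f : X.O W) : ContinuousOn (X.val f) W := by
  rw [continuousOn_iff_continuous_domRestrict]
  have : (W : Set M).domRestrict (X.val f) = X.body W f := funext fun z => val_of_mem f z.2
  rw [this]
  exact (X.body W f).contMDiff.continuous

theorem SuperChart.val_x_inl (S : X.SuperChart) {W : Opens M} (hW : W ≤ S.U) (i : Fin n) {z : M}
    (hz : z ∈ W) : X.val (S.x hW (Sum.inl i)) z = S.φ z i := by
  rw [val_of_mem _ hz]
  exact congrArg (fun f : CkFun k n W => f ⟨z, hz⟩) (S.body_lift hW _)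

/-- The fields `Y` at different times are unrelated, but each must give the derivative of the
coordinate along the curve, which is continuous on a compact interval. The bound is therefore
uniform in `Y`. -/
theorem exists_bound_velocity [IsManifold (𝓡 n) k M] (S : X.SuperChart) {W : Opens M}
    (hW : W ≤ S.U) {γ : ℝ → M} {a b c d : ℝ} (hcd : c < d) (hsub : Icc c d ⊆ Icc a b)
    (hγ : ContMDiffOn 𝓘(ℝ, ℝ) (𝓡 n) ∞ γ (Icc a b)) (hγW : ∀ t ∈ Icc c d, γ t ∈ W) (i : Fin n) :
    ∃ K, ∀ t ∈ Icc c d, ∀ (V : Opens M) (Y : X.tangent.Sec V), Connection.IsVelocity γ a b t Y →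
      ∀ (W' : Opens M) (hV : W' ≤ V) (hW' : W' ≤ W), γ t ∈ W' →
        |X.val (lieDer (X.tangent.res hV Y) (S.x (hW'.trans hW) (Sum.inl i))) (γ t)| ≤ K := by
  have hk : (1 : WithTop ℕ∞) ≤ k := by
    rcases S.smooth_or_analytic with rfl | rfl <;> simp
  have hφ1 : S.φ ∈ IsManifold.maximalAtlas (𝓡 n) 1 M :=
    IsManifold.maximalAtlas_subset_of_le hk S.mem_atlas
  have hM1 : IsManifold (𝓡 n) 1 M := IsManifold.of_le hk
  have h1 : ContMDiffOn 𝓘(ℝ, ℝ) (𝓡 n) 1 (fun t => S.φ (γ t)) (Icc c d) :=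
    (contMDiffOn_of_mem_maximalAtlas hφ1).comp ((hγ.of_le (by simp)).mono hsub)
      fun t ht => S.subset_source (hW (hγW t ht))
  have h2 : ContDiffOn ℝ 1 (fun t => S.φ (γ t) i) (Icc c d) :=
    (EuclideanSpace.proj (𝕜 := ℝ) i).contDiff.comp_contDiffOn (contMDiffOn_iff_contDiffOn.1 h1)
  have hu := uniqueDiffOn_Icc hcd
  obtain ⟨K, hK⟩ := isCompact_Icc.exists_bound_of_continuousOn
    (h2.continuousOn_derivWithin hu le_rfl)
  refine ⟨K, fun t ht V Y hY W' hV hW' htW' => ?_⟩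
  have h3 : HasDerivWithinAt (fun s => S.φ (γ s) i)
      (X.val (lieDer (X.tangent.res hV Y) (S.x (hW'.trans hW) (Sum.inl i))) (γ t))
      (Icc c d) t := by
    have h4 := hY.hasDerivWithinAt (hγ.continuousOn t (hsub ht)) hV hW' htW' (S.x hW (Sum.inl i))
    rw [S.res_x] at h4
    exact (h4.mono hsub).congr (fun s hs => (S.val_x_inl hW i (hγW s hs)).symm)
      (S.val_x_inl hW i (hγW t ht)).symm
  rw [← h3.derivWithin (hu t ht)]
  exact hK t ht

/-- Expanded in coordinate fields, the odd directions drop out because an even field sends odd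
coordinates to odd superfunctions. The even ones are velocities times coefficients continuous along
the curve. -/
theorem exists_bound_christoffel [IsManifold (𝓡 n) k M] (N : Connection E ⊤) (S : X.SuperChart)
    {ι : Type} [Fintype ι] {U : Opens M} {e : ι → E.Sec U} (hb : E.IsBasis e) {W : Opens M}
    (hW : W ≤ S.U) (hWU : W ≤ U) {γ : ℝ → M} {a b c d : ℝ} (hcd : c < d)
    (hsub : Icc c d ⊆ Icc a b) (hγ : ContMDiffOn 𝓘(ℝ, ℝ) (𝓡 n) ∞ γ (Icc a b))
    (hγW : ∀ t ∈ Icc c d, γ t ∈ W) (C D : ι) :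
    ∃ K, ∀ t ∈ Icc c d, ∀ (V : Opens M), ∀ Y ∈ X.tangent.par V 0, Connection.IsVelocity γ a b t Y →
      ∀ (W' : Opens M) (hV : W' ≤ V) (hW' : W' ≤ W), γ t ∈ W' →
        |X.val (hb.coef (hW'.trans hWU) (N.nabla W' le_top (X.tangent.res hV Y)
          (E.res (hW'.trans hWU) (e D))) C) (γ t)| ≤ K := by
  choose K hK using fun i => exists_bound_velocity S hW hcd hsub hγ hγW i
  have h1 : ∀ i, ∃ L, ∀ t ∈ Icc c d,
      |X.val (hb.coef hWU (N.nab S hW (Sum.inl i) (E.res hWU (e D))) C) (γ t)| ≤ L := fun i =>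
    isCompact_Icc.exists_bound_of_continuousOn
      ((continuousOn_val _).comp (hγ.continuousOn.mono hsub) hγW)
  choose L hL using h1
  refine ⟨∑ i, K i * L i, fun t ht V Y hY hv W' hV hW' htW' => ?_⟩
  have hY' : X.tangent.res hV Y ∈ X.tangent.par W' 0 := X.tangent.par_res hV 0 _ hY
  have hodd : ∀ r, X.val (lieDer (X.tangent.res hV Y) (S.x (hW'.trans hW) (Sum.inr r))) (γ t) = 0 := by
    intro r
    refine S.val_eq_zero_of_odd (hW (hγW t ht)) ?_
    exact hY'.2.1 W' le_rfl 1 _ (S.x_mem (hW'.trans hW) (Sum.inr r))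
  have h2 : X.val (hb.coef (hW'.trans hWU) (N.nabla W' le_top (X.tangent.res hV Y)
      (E.res (hW'.trans hWU) (e D))) C) (γ t) =
      ∑ i, X.val (lieDer (X.tangent.res hV Y) (S.x (hW'.trans hW) (Sum.inl i))) (γ t) *
        X.val (hb.coef hWU (N.nab S hW (Sum.inl i) (E.res hWU (e D))) C) (γ t) := by
    have h3 : ∀ i, hb.coef (hW'.trans hWU) (N.nab S (hW'.trans hW) i
        (E.res (hW'.trans hWU) (e D))) C =
        X.res hW' (hb.coef hWU (N.nab S hW i (E.res hWU (e D))) C) := fun i => by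
      rw [← hb.coef_res hWU hW', N.res_nab, E.res_res]
    rw [N.nabla_eq_sum_nab S (hW'.trans hW), map_sum, Finset.sum_apply, val_eq _ htW', map_sum]
    simp only [map_smul, Pi.smul_apply, smul_eq_mul, map_mul, h3]
    simp only [← val_eq _ htW', val_res hW' _ htW', Fintype.sum_sum_type, hodd, zero_mul,
      Finset.sum_const_zero, add_zero]
  rw [h2]
  refine (Finset.abs_sum_le_sum_abs _ _).trans (Finset.sum_le_sum fun i _ => ?_)
  rw [abs_mul]
  have hKi := hK i t ht V Y hv W' hV hW' htW'
  exact mul_le_mul hKi (hL i t ht) (abs_nonneg _) ((abs_nonneg _).trans hKi)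

/-! ### Parallel displacement preserves the fibres of a parallel subsheaf -/

namespace LocallyDirectSubsheaf

variable {G : LocallyDirectSubsheaf E p q p₁ q₁} {N : Connection E ⊤}

/-- On a short interval, membership means that the components outside the adapted part vanish. These
components satisfy a linear differential inequality by themselves, so they vanish at all times or at
none. -/
theorem IsParallel.eventually_mem_iff [IsManifold (𝓡 n) k M] (hk : k = ∞ ∨ k = ω)
    (hG : G.IsParallel N) {γ : ℝ → M}
    {a b : ℝ} (hab : a < b) (hγ : ContMDiffOn 𝓘(ℝ, ℝ) (𝓡 n) ∞ γ (Icc a b))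
    {s : ∀ t, E.Fiber (γ t)} (hs : N.IsParallelAlong γ a b s) {t₀ : ℝ} (ht₀ : t₀ ∈ Icc a b) :
    ∀ᶠ t in 𝓝[Icc a b] t₀, (s t₀ ∈ G.fiber (γ t₀) ↔ s t ∈ G.fiber (γ t)) := by
  obtain ⟨S, hS⟩ := exists_superChart hk X (γ t₀)
  obtain ⟨U₂, hU₂, e₂, he⟩ := G.exists_isAdapted (γ t₀)
  obtain ⟨U₁, r, e₁, x, hb₁, hev⟩ := hs t₀ ht₀
  have hU₁ : γ t₀ ∈ U₁ := (hev.self_of_nhdsWithin ht₀).choose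
  let W : Opens M := U₁ ⊓ U₂ ⊓ S.U
  have hW₁ : W ≤ U₁ := inf_le_left.trans inf_le_left
  have hW₂ : W ≤ U₂ := inf_le_left.trans inf_le_right
  have hWS : W ≤ S.U := inf_le_right
  have hγW := (hγ.continuousOn t₀ ht₀).eventually (W.2.mem_nhds ⟨⟨hU₁, hU₂⟩, hS⟩)
  obtain ⟨c, d, hcd, ht₀', hsub, hnhds, hJ⟩ := exists_Icc_of_eventually hab ht₀ (hev.and hγW)
  have hJW : ∀ t ∈ Icc c d, γ t ∈ W := fun t ht => (hJ t ht).2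
  have hb := he.isSuperBasis.isBasis
  let β : Fin p ⊕ Fin q → ℝ → ℝ := fun C t =>
    ∑ A, x A t * X.val (hb.coef hW₂ (E.res hW₁ (e₁ A)) C) (γ t)
  have hrepr : ∀ t (ht : t ∈ Icc c d) C,
      (hb.fiberBasis (hW₂ (hJW t ht))).repr (s t) C = β C t := by
    intro t ht C
    obtain ⟨h1, h2, -⟩ := (hJ t ht).1
    rw [h2, map_sum, Finsupp.finsetSum_apply]
    refine Finset.sum_congr rfl fun A _ => ?_
    rw [map_smul, Finsupp.smul_apply, smul_eq_mul, ← E.ev_res hW₁ (hJW t ht),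
      hb.fiberBasis_repr hW₂ (hJW t ht)]
  let y : ℝ → ({C : Fin p ⊕ Fin q // ¬ IsFirst p₁ q₁ C} → ℝ) := fun t C => β C.1 t
  have hmem : ∀ t (ht : t ∈ Icc c d), s t ∈ G.fiber (γ t) ↔ y t = 0 := by
    intro t ht
    rw [he.mem_fiber_iff (hW₂ (hJW t ht)), funext_iff]
    simp only [hrepr t ht]
    exact ⟨fun h C => h C.1 C.2, fun h C hC => h ⟨C, hC⟩⟩
  choose K hK using fun C D => exists_bound_christoffel N S hb hWS hW₂ hcd hsub hγ hJW C D
  have hK0 : ∀ C D, K C D ≤ |K C D| := fun C D => le_abs_self _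
  let L : ℝ := ∑ C, ∑ D, |K C D|
  have hder : ∀ t ∈ Icc c d, ∃ y', HasDerivWithinAt y y' (Icc c d) t ∧ ‖y'‖ ≤ L * ‖y t‖ := by
    intro t ht
    obtain ⟨h1, h2, x', hx', V, hV, htV, Y, hY, hv, hpar⟩ := (hJ t ht).1
    have htW' : γ t ∈ V ⊓ W := ⟨htV, hJW t ht⟩
    let Γ : Fin p ⊕ Fin q → Fin p ⊕ Fin q → ℝ := fun C D =>
      X.val (hb.coef ((inf_le_right : V ⊓ W ≤ W).trans hW₂) (N.nabla (V ⊓ W) le_top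
        (X.tangent.res inf_le_left Y) (E.res (inf_le_right.trans hW₂) (e₂ D))) C) (γ t)
    have hΓ : ∀ C D, |Γ C D| ≤ |K C D| := fun C D =>
      (hK C D t ht V Y hY hv (V ⊓ W) inf_le_left inf_le_right htW').trans (hK0 C D)
    -- This is where parallelism of `G` enters: it decouples the outer components from the inner
    -- ones.
    have hΓ0 : ∀ C D, ¬ IsFirst p₁ q₁ C → IsFirst p₁ q₁ D → Γ C D = 0 := by
      intro C D hC hD
      have h3 := he.coef_eq_zero (inf_le_right.trans hW₂)
        (hG (V ⊓ W) (X.tangent.res inf_le_left Y) _ (he.mem_sec hD (inf_le_right.trans hW₂))) hC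
      change X.val _ _ = 0
      rw [h3, val_eq _ htW', map_zero]
    have hβ : ∀ C, HasDerivWithinAt (β C) (-∑ D, β D t * Γ C D) (Icc c d) t := fun C =>
      (Connection.hasDerivWithinAt_coef hb (hγ.continuousOn t (hsub ht)) hx' hW₁ hW₂ hV hY hv h1 htV
        inf_le_left inf_le_right htW' hpar C).mono hsub
    refine ⟨fun C => -∑ D, β D t * Γ C.1 D, hasDerivWithinAt_pi.2 fun C => hβ C.1, ?_⟩
    have hL : 0 ≤ L * ‖y t‖ := mul_nonneg
      (Finset.sum_nonneg fun C _ => Finset.sum_nonneg fun D _ => abs_nonneg _) (norm_nonneg _)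
    rw [pi_norm_le_iff_of_nonneg hL]
    intro C
    rw [norm_neg]
    refine (norm_sum_le _ _).trans ?_
    have h4 : ∀ D, ‖β D t * Γ C.1 D‖ ≤ |K C.1 D| * ‖y t‖ := by
      intro D
      by_cases hD : IsFirst p₁ q₁ D
      · rw [hΓ0 C.1 D C.2 hD, mul_zero, norm_zero]
        exact mul_nonneg (abs_nonneg _) (norm_nonneg _)
      · rw [norm_mul, mul_comm]
        exact mul_le_mul (hΓ C.1 D) (norm_le_pi_norm (y t) ⟨D, hD⟩) (norm_nonneg _) (abs_nonneg _)
    refine (Finset.sum_le_sum fun D _ => h4 D).trans ?_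
    rw [← Finset.sum_mul]
    refine mul_le_mul_of_nonneg_right ?_ (norm_nonneg _)
    exact Finset.single_le_sum (f := fun C => ∑ D, |K C D|)
      (fun C _ => Finset.sum_nonneg fun D _ => abs_nonneg _) (Finset.mem_univ C.1)
  filter_upwards [hnhds] with t ht
  rw [hmem t₀ ht₀', hmem t ht]
  exact ⟨eq_zero_of_norm_deriv_le hder ht₀' ht, eq_zero_of_norm_deriv_le hder ht ht₀'⟩

theorem IsParallel.mem_fiber_iff_of_isTransport [IsManifold (𝓡 n) k M] (hk : k = ∞ ∨ k = ω)
    (hG : G.IsParallel N) {y z : M} {τ : E.Fiber y ≃ₗ[ℝ] E.Fiber z} (hτ : N.IsTransport y z τ)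
    (v : E.Fiber y) : v ∈ G.fiber y ↔ τ v ∈ G.fiber z := by
  induction hτ with
  | smooth γ a b hab hγ τ hτ =>
    obtain ⟨s, hs, rfl, hb⟩ := hτ v
    rw [← hb]
    -- The equivalence holds near each time of the interval; connectedness extends it to the two
    -- ends.
    refine isPreconnected_Icc.induction₂' (fun t t' =>
      s t ∈ G.fiber (γ t) ↔ s t' ∈ G.fiber (γ t')) (fun t ht => ?_)
      (fun t t' t'' _ _ _ h h' => h.trans h') (left_mem_Icc.2 hab.le) (right_mem_Icc.2 hab.le)
    filter_upwards [hG.eventually_mem_iff hk hab hγ hs ht] with t' ht'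
    exact ⟨ht', ht'.symm⟩
  | trans _ _ ih ih' => exact (ih v).trans (ih' _)

theorem IsParallel.isHolInvariant [IsManifold (𝓡 n) k M] (hk : k = ∞ ∨ k = ω)
    (hG : G.IsParallel N) (hp : p₁ ≤ p) (hq : q₁ ≤ q) (x : M) :
    N.IsHolInvariant x p₁ q₁ (G.fiber x) := by
  obtain ⟨S, hxS⟩ := exists_superChart hk X x
  obtain ⟨U, hx, e, he⟩ := G.exists_isAdapted x
  have hF := he.isSuperSubspace_fiber S hxS hx hp hq
  refine ⟨hF, fun A hA => ?_, fun τ hτ => ?_⟩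
  · have hA' : A ∈ stabilizerEnd (G.fiber x) := by
      refine Submodule.mem_sInf.1 hA _ ⟨?_, isSuperSubalgebra_stabilizerEnd
        (he.isSuperBasis.fiberPar_isCompl S hxS hx) hF.graded⟩
      rintro _ ⟨y, τ, hτ, U, hy, N', r, Y, A, B, T, hT, rfl⟩ v hv
      rw [hG.mem_fiber_iff_of_isTransport hk hτ]
      change τ (τ.symm (T (τ v))) ∈ _
      rw [LinearEquiv.apply_symm_apply]
      exact hG.isCovCurvAt_mem hy hT ((hG.mem_fiber_iff_of_isTransport hk hτ v).1 hv)
    rw [Submodule.map_le_iff_le_comap]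
    exact hA'
  · have h : ∀ v, v ∈ G.fiber x ↔ τ v ∈ G.fiber x := by
      induction hτ using Subgroup.closure_induction with
      | mem τ hτ => exact hG.mem_fiber_iff_of_isTransport hk hτ
      | one => exact fun v => Iff.rfl
      | mul σ τ _ _ hσ hτ => exact fun v => (hτ v).trans (hσ _)
      | inv τ _ hτ =>
        intro v
        rw [hτ (τ⁻¹ v)]
        change _ ↔ τ (τ.symm v) ∈ _
        rw [LinearEquiv.apply_symm_apply]
    ext v
    constructor
    · rintro ⟨u, hu, rfl⟩
      exact (h u).1 hu
    · intro hv
      refine ⟨τ.symm v, (h _).2 ?_, τ.apply_symm_apply v⟩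
      rwa [LinearEquiv.apply_symm_apply]

end LocallyDirectSubsheaf

end Supermanifold

end

/-! ### The equivalence. -/

theorem mainTheorem2 {k : WithTop ℕ∞} (hk : k = ∞ ∨ k = ω) {n m p q : ℕ}
    {M : Type u} [TopologicalSpace M] [T2Space M] [SecondCountableTopology M]
    [ChartedSpace (EuclideanSpace ℝ (Fin n)) M] [IsManifold (𝓡 n) k M]
    (X : Supermanifold k n m M) (E : X.SuperModulePresheaf) (hE : E.IsLocallyFreeSheaf p q)
    (N : Supermanifold.Connection E ⊤) (p₁ q₁ : ℕ) (hp : p₁ ≤ p) (hq : q₁ ≤ q) :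
    ((∃ F : Supermanifold.LocallyDirectSubsheaf E p q p₁ q₁, F.IsParallel N) ↔
      ∀ x : M, ∃ Fx : Submodule ℝ (E.Fiber x), N.IsHolInvariant x p₁ q₁ Fx) ∧
    (ConnectedSpace M → ∀ x : M,
      ((∃ F : Supermanifold.LocallyDirectSubsheaf E p q p₁ q₁, F.IsParallel N) ↔
        ∃ Fx : Submodule ℝ (E.Fiber x), N.IsHolInvariant x p₁ q₁ Fx)) := by
  classical
  have hlink := N.eventually_linked hk hE
  have hfield : ∀ F₀ : ∀ x : M, Submodule ℝ (E.Fiber x), ∀ base : M → M,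
      (∀ y, N.Linked (base y) y) → (∀ y z, N.Linked y z → base y = base z) →
      (∀ y, N.IsHolInvariant (base y) p₁ q₁ (F₀ (base y))) →
      ∃ F : Supermanifold.LocallyDirectSubsheaf E p q p₁ q₁, F.IsParallel N := by
    intro F₀ base h1 h2 h3
    obtain ⟨F, hF⟩ := N.exists_isParallelField base h1 h2 F₀ h3
    exact hF.exists_subsheaf hk hE
  refine ⟨⟨fun ⟨G, hG⟩ x => ⟨G.fiber x, hG.isHolInvariant hk hp hq x⟩, fun h => ?_⟩,
    fun hM x => ⟨fun ⟨G, hG⟩ => ⟨G.fiber x, hG.isHolInvariant hk hp hq x⟩, fun ⟨Fx, hFx⟩ => ?_⟩⟩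
  · choose F₀ hF₀ using h
    -- The subspaces given at different points need not be compatible, so only the one at a
    -- representative of each class is kept.
    let r : Setoid M := ⟨N.Linked, fun y => (hlink y).self_of_nhds, fun h => h.symm,
      fun h h' => h.trans h'⟩
    refine hfield F₀ (fun y => (Quotient.mk r y).out) (fun y => Quotient.mk_out y)
      (fun y z h => ?_) fun y => hF₀ _
    have : Quotient.mk r y = Quotient.mk r z := Quotient.sound h
    change (Quotient.mk r y).out = (Quotient.mk r z).out
    rw [this]
  · refine hfield (Function.update (fun _ => ⊥) x Fx) (fun _ => x) (fun y => ?_) (fun _ _ _ => rfl)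
      fun y => by rwa [Function.update_self]
    have : IsTrans M N.Linked := ⟨fun _ _ _ h h' => h.trans h'⟩
    refine PreconnectedSpace.induction₂' N.Linked (fun y => ?_) this x y
    filter_upwards [hlink y] with z hz
    exact ⟨hz, hz.symm⟩
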